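/- Let $k$ be a commutative ring and $A$, $U$ unital associative $k$-algebras. Let $(U,A)$ be a left bialgebroid (in the sense of Takeuchi) with source map $s\colon A\to U$, target map $t\colon A^{\mathrm{op}}\to U$, coproduct $\Delta(u)=u_{(1)}\otimes_A u_{(2)}$ and counit $\varepsilon\colon U\to A$. Write $$a\triangleright u\triangleleft b:=s(a)t(b)u,\qquad a\blacktriangleright u\blacktriangleleft b:=u\,t(a)s(b)\qquad(a,b\in A,\ u\in U).$$ Assume that $(U,A)$ is a left Hopf algebroid, that is, the Hopf–Galois map ${}_\blacktriangleright U\otimes_{A^{\mathrm{op}}}U_\triangleleft\to U_\triangleleft\otimes_A{}_\triangleright U$, $u\otimes v\mapsto u_{(1)}\otimes u_{(2)}v$, is bijective, and write $u_+\otimes_{A^{\mathrm{op}}}u_-$ for the preimage of $u\otimes_A1$. No finiteness or projectivity of $U$ over $A$ is assumed. Let $M$ be a right $U$-contramodule: a right $A$-module with a map $\gamma\colon\operatorname{Hom}_{A^{\mathrm{op}}}(U_\triangleleft,M)\to M$ such that $\gamma(f(a\triangleright-))=\gamma(f)a$, $\gamma(m\,\varepsilon(-))=m$, and $\dot\gamma(\ddot\gamma(g(\cdot\otimes_A\cdot\cdot)))=\gamma(g(-_{(1)}\otimes_A-_{(2)}))$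 for all $g\in\operatorname{Hom}_{A^{\mathrm{op}}}(U_\triangleleft\otimes_A{}_\triangleright U,M)$, where $\ddot\gamma$ is applied first, to the second tensor factor. Let $M$ also be a left $U$-module whose right $A$-action agrees with that of the contramodule: $t(a)m=ma$ for $a\in A$, $m\in M$. For $n\ge0$ put $C^n(U,M):=\operatorname{Hom}_{A^{\mathrm{op}}}(U^{\otimes_{A^{\mathrm{op}}}n},M)$, where the tensor power is formed with respect to the bimodule ${}_\blacktriangleright U_\triangleleft$ and is a right $A$-module through its first factor, and $C^0(U,M)=M$. Then the formulas $$(\delta_if)(u^1,\dots,u^{n+1})=\begin{cases}f(u^1,\dots,\varepsilon(u^{n+1})\blacktriangleright u^n)&i=0,\\ f(u^1,\dots,u^{n-i+1}u^{n-i+2},\dots,u^{n+1})&1\le i\le n,\\ u^1f(u^2,\dots,u^{n+1})&i=n+1,\end{cases}$$ for $f\in C^n(U,M)$ (for $n=0$: $(\delta_0m)(u)=m\,\varepsilon(u)$ and $(\delta_1m)(u)=um$), $$(\sigma_jf)(u^1,\dots,u^n)=f(u^1,\dots,u^{n-j},1,u^{n-j+1},\dots,u^n),\qquad f\in C^{n+1}(U,M),\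 0\le j\le n,$$ $$(\tau f)(u^1,\dots,u^n)=\gamma\big(u^1_+f(u^2_+,\dots,u^n_+,u^n_-\cdots u^1_-(-))\big),\qquad f\in C^n(U,M)$$ (for $n=0$: $\tau m=\gamma((-)m)$), give well-defined $k$-linear maps $\delta_i\colon C^n(U,M)\to C^{n+1}(U,M)$, $\sigma_j\colon C^{n+1}(U,M)\to C^n(U,M)$ and $\tau\colon C^n(U,M)\to C^n(U,M)$, and with them $C^\bullet(U,M)$ is a para-cocyclic $k$-module, that is, it satisfies all relations of a cocyclic $k$-module except possibly $\tau^{n+1}=\mathrm{id}$ on $C^n(U,M)$. If moreover $M$ is a stable anti Yetter–Drinfel'd contramodule, then $C^\bullet(U,M)$ is a cocyclic $k$-module, that is, also $\tau^{n+1}=\mathrm{id}$ on $C^n(U,M)$ for all $n\ge0$. Here $M$ is an anti Yetter–Drinfel'd contramodule if $s(a)m=\gamma(m\,\varepsilon(a\blacktriangleright-))$ and $t(a)m=ma$ for all $a\in A$, $m\in M$, and $$u\,\gamma(f)=\gamma\big(u_{+(2)}f(u_-(-)u_{+(1)})\big)=\gamma\big((u_{(2)})_+f((u_{(2)})_-(-)u_{(1)})\big)$$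 for all $u\in U$, $f\in\operatorname{Hom}_{A^{\mathrm{op}}}(U_\triangleleft,M)$; it is stable if $\gamma((-)m)=m$ for all $m\in M$, where $(-)m$ is the map $u\mapsto um$. -/

import Mathlib

open TensorProduct MulOpposite

noncomputable section

namespace HopfAlgebroid

/-- An `Aᵉ`-ring `U`: a source map `s : A → U` and a target map `t : Aᵒᵖ → U` with commuting
images, i.e. an algebra map `η : A ⊗ Aᵒᵖ → U`, `η (a ⊗ b) = s a * t b`.
The four induced `A`-actions on `U` are
`a ▹ u ◃ b = s a * t b * u` and `a ▸ u ◂ b = u * t a * s b`. -/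
structure AeRing (k A U : Type*) [CommRing k] [Ring A] [Algebra k A] [Ring U] [Algebra k U] where
  /-- the source map -/
  src : A →ₐ[k] U
  /-- the target map -/
  tgt : Aᵐᵒᵖ →ₐ[k] U
  src_tgt_comm : ∀ a b : A, src a * tgt (op b) = tgt (op b) * src a

namespace AeRing

variable {k A U : Type*} [CommRing k] [Ring A] [Algebra k A] [Ring U] [Algebra k U]
variable (E : AeRing k A U)

/-- The source map `s`. -/
abbrev s (a : A) : U := E.src a

/-- The target map `t`, as a function on `A`; it reverses products. -/
abbrev t (a : A) : U := E.tgt (op a)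

/-- The relations `(x ◃ a) ⊗ y = x ⊗ (a ▹ y)`. -/
def rel : Submodule k (U ⊗[k] U) :=
  Submodule.span k {z | ∃ (a : A) (x y : U), z = (E.t a * x) ⊗ₜ[k] y - x ⊗ₜ[k] (E.s a * y)}

/-- The tensor product `U_◃ ⊗_A ▹U`. -/
abbrev Tensor : Type _ := (U ⊗[k] U) ⧸ E.rel

/-- The element `x ⊗_A y` of `U_◃ ⊗_A ▹U`. -/
def tmul (x y : U) : E.Tensor := E.rel.mkQ (x ⊗ₜ[k] y)

/-- The relations `(a ▸ x) ⊗ y = x ⊗ (y ◃ a)`. -/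
def relOp : Submodule k (U ⊗[k] U) :=
  Submodule.span k {z | ∃ (a : A) (x y : U), z = (x * E.t a) ⊗ₜ[k] y - x ⊗ₜ[k] (E.t a * y)}

/-- The tensor product `▸U ⊗_{Aᵒᵖ} U_◃`. -/
abbrev TensorOp : Type _ := (U ⊗[k] U) ⧸ E.relOp

/-- The element `x ⊗_{Aᵒᵖ} y` of `▸U ⊗_{Aᵒᵖ} U_◃`. -/
def tmulOp (x y : U) : E.TensorOp := E.relOp.mkQ (x ⊗ₜ[k] y)

theorem rel_le_ker {N : Type*} [AddCommGroup N] [Module k N] (f : U ⊗[k] U →ₗ[k] N)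
    (h : ∀ (a : A) (x y : U), f ((E.t a * x) ⊗ₜ[k] y) = f (x ⊗ₜ[k] (E.s a * y))) :
    E.rel ≤ LinearMap.ker f := by
  rw [rel, Submodule.span_le]
  rintro _ ⟨a, x, y, rfl⟩
  rw [SetLike.mem_coe, LinearMap.mem_ker, map_sub, h, sub_self]

theorem relOp_le_ker {N : Type*} [AddCommGroup N] [Module k N] (f : U ⊗[k] U →ₗ[k] N)
    (h : ∀ (a : A) (x y : U), f ((x * E.t a) ⊗ₜ[k] y) = f (x ⊗ₜ[k] (E.t a * y))) :
    E.relOp ≤ LinearMap.ker f := by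
  rw [relOp, Submodule.span_le]
  rintro _ ⟨a, x, y, rfl⟩
  rw [SetLike.mem_coe, LinearMap.mem_ker, map_sub, h, sub_self]

/-- The relations that define the threefold tensor product over `A`. -/
def rel₃ : Submodule k (U ⊗[k] (U ⊗[k] U)) :=
  Submodule.span k
    ({z | ∃ (a : A) (x y w : U),
        z = (E.t a * x) ⊗ₜ[k] (y ⊗ₜ[k] w) - x ⊗ₜ[k] ((E.s a * y) ⊗ₜ[k] w)} ∪
     {z | ∃ (a : A) (x y w : U),
        z = x ⊗ₜ[k] ((E.t a * y) ⊗ₜ[k] w) - x ⊗ₜ[k] (y ⊗ₜ[k] (E.s a * w))})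

/-- The tensor product `U_◃ ⊗_A ▹U_◃ ⊗_A ▹U`. -/
abbrev Tensor₃ : Type _ := (U ⊗[k] (U ⊗[k] U)) ⧸ E.rel₃

/-- The map `y ⊗_A w ↦ x ⊗_A y ⊗_A w`. -/
def consTmul (x : U) : E.Tensor →ₗ[k] E.Tensor₃ :=
  E.rel.liftQ (E.rel₃.mkQ ∘ₗ TensorProduct.mk k U (U ⊗[k] U) x) <| E.rel_le_ker _ fun a y w => by
    simp only [LinearMap.comp_apply, TensorProduct.mk_apply]
    rw [← sub_eq_zero, ← map_sub, Submodule.mkQ_apply, Submodule.Quotient.mk_eq_zero]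
    exact Submodule.subset_span (Or.inr ⟨a, x, y, w, rfl⟩)

/-- The map `x ⊗_A y ↦ x ⊗_A y ⊗_A w`. -/
def tmulSnoc (w : U) : E.Tensor →ₗ[k] E.Tensor₃ :=
  E.rel.liftQ (E.rel₃.mkQ ∘ₗ (TensorProduct.assoc k U U U).toLinearMap ∘ₗ
      (TensorProduct.mk k (U ⊗[k] U) U).flip w) <| E.rel_le_ker _ fun a x y => by
    simp only [LinearMap.comp_apply, LinearMap.flip_apply, TensorProduct.mk_apply,
      LinearEquiv.coe_coe, TensorProduct.assoc_tmul]
    rw [← sub_eq_zero, ← map_sub, Submodule.mkQ_apply, Submodule.Quotient.mk_eq_zero]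
    exact Submodule.subset_span (Or.inl ⟨a, x, y, w, rfl⟩)

/-- The map `x ⊗_A y ↦ x ⊗_A y * v`. -/
def mulRight (v : U) : E.Tensor →ₗ[k] E.Tensor :=
  E.rel.liftQ (E.rel.mkQ ∘ₗ TensorProduct.map LinearMap.id (LinearMap.mulRight k v)) <|
    E.rel_le_ker _ fun a x y => by
      simp only [LinearMap.comp_apply, TensorProduct.map_tmul, LinearMap.id_apply,
        LinearMap.mulRight_apply]
      rw [← sub_eq_zero, ← map_sub, Submodule.mkQ_apply, Submodule.Quotient.mk_eq_zero]
      exact Submodule.subset_span ⟨a, x, y * v, by rw [mul_assoc]⟩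

theorem tmul_add (x y y' : U) : E.tmul x (y + y') = E.tmul x y + E.tmul x y' := by
  simp only [tmul, TensorProduct.tmul_add, map_add]

theorem tmul_smul (c : k) (x y : U) : E.tmul x (c • y) = c • E.tmul x y := by
  simp only [tmul, TensorProduct.tmul_smul, map_smul]

theorem mulRight_tmul (v x y : U) : E.mulRight v (E.tmul x y) = E.tmul x (y * v) := rfl

/-- Every element of `U ⊗_A U` is a finite sum of elementary tensors. -/
theorem exists_sum_tmul (z : E.Tensor) :
    ∃ (N : ℕ) (x y : Fin N → U), z = ∑ i, E.tmul (x i) (y i) := by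
  obtain ⟨r, rfl⟩ := Submodule.mkQ_surjective _ z
  induction r using TensorProduct.induction_on with
  | zero => exact ⟨0, Fin.elim0, Fin.elim0, by simp⟩
  | tmul x y => exact ⟨1, fun _ => x, fun _ => y, by simp [tmul]⟩
  | add r r' h h' =>
    obtain ⟨N, x, y, h⟩ := h
    obtain ⟨N', x', y', h'⟩ := h'
    exact ⟨N + N', Fin.append x x', Fin.append y y', by
      rw [map_add, h, h', Fin.sum_univ_add]; simp⟩

section Hom

variable (M : Type*) [AddCommGroup M] [Module k M] [Module Aᵐᵒᵖ M] [IsScalarTower k Aᵐᵒᵖ M]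

/-- `Hom_{Aᵒᵖ}(U_◃, M)`: the maps `f : U → M` with `f (u ◃ a) = f u · a`, where the right
`A`-action on `M` is written as an action of `Aᵐᵒᵖ`. -/
def homOp : Submodule k (U →ₗ[k] M) where
  carrier := {f | ∀ (a : A) (u : U), f (E.t a * u) = op a • f u}
  zero_mem' := fun a u => by simp
  add_mem' := fun {f g} hf hg a u => by simp [hf a u, hg a u]
  smul_mem' := fun c f hf a u => by
    rw [LinearMap.smul_apply, LinearMap.smul_apply, hf a u, smul_comm c (op a)]

/-- `C^n(U, M) = Hom_{Aᵒᵖ}(U^{⊗_{Aᵒᵖ} n}, M)`, where the tensor product is formed with respect to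
the `A`-bimodule `▸U_◃`, and is itself a right `A`-module through its first factor. Such a map is
a `k`-multilinear map `f (u¹, …, uⁿ)` that is balanced,
`f (…, a ▸ uⁱ, uⁱ⁺¹, …) = f (…, uⁱ, uⁱ⁺¹ ◃ a, …)`,
and right `A`-linear, `f (u¹ ◃ a, u², …, uⁿ) = f (u¹, …, uⁿ) · a`.
For `n = 0` both conditions are empty, and `C^0(U, M) = Hom_{Aᵒᵖ}(A, M) ≃ M`. -/
def cochain (n : ℕ) : Submodule k (MultilinearMap k (fun _ : Fin n => U) M) where
  carrier := {f |
    (∀ (a : A) (u : Fin n → U) (i : Fin n), (i : ℕ) = 0 →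
      f (Function.update u i (E.t a * u i)) = op a • f u) ∧
    (∀ (a : A) (u : Fin n → U) (i j : Fin n), (j : ℕ) = (i : ℕ) + 1 →
      f (Function.update u i (u i * E.t a)) = f (Function.update u j (E.t a * u j)))}
  zero_mem' := by simp
  add_mem' := fun {f g} hf hg =>
    ⟨fun a u i hi => by simp [hf.1 a u i hi, hg.1 a u i hi],
      fun a u i j hij => by simp [hf.2 a u i j hij, hg.2 a u i j hij]⟩
  smul_mem' := fun c f hf =>
    ⟨fun a u i hi => by
        rw [_root_.smul_apply, _root_.smul_apply, hf.1 a u i hi,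
          smul_comm c (op a)],
      fun a u i j hij => by simp [hf.2 a u i j hij]⟩

end Hom

end AeRing

/-- A left bialgebroid `(U, A, s, t, Δ, ε)`. Sweedler's notation `Δ u = u₍₁₎ ⊗_A u₍₂₎` is spelled
out: `x i` and `y i` are the factors in a presentation of `Δ u` as a sum of elementary tensors. -/
structure LeftBialgebroid (k A U : Type*) [CommRing k] [Ring A] [Algebra k A] [Ring U]
    [Algebra k U] extends AeRing k A U where
  /-- the coproduct `Δ : U → U_◃ ⊗_A ▹U` -/
  comul : U →ₗ[k] toAeRing.Tensor
  /-- the counit `ε : U → A` -/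
  counit : U →ₗ[k] A
  /-- `Δ (a ▹ u) = a ▹ u₍₁₎ ⊗ u₍₂₎` -/
  comul_src_mul : ∀ (a : A) (u : U) (N : ℕ) (x y : Fin N → U),
    comul u = ∑ i, toAeRing.tmul (x i) (y i) →
      comul (toAeRing.s a * u) = ∑ i, toAeRing.tmul (toAeRing.s a * x i) (y i)
  /-- `Δ (u ◃ a) = u₍₁₎ ⊗ u₍₂₎ ◃ a` -/
  comul_tgt_mul : ∀ (a : A) (u : U) (N : ℕ) (x y : Fin N → U),
    comul u = ∑ i, toAeRing.tmul (x i) (y i) →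
      comul (toAeRing.t a * u) = ∑ i, toAeRing.tmul (x i) (toAeRing.t a * y i)
  /-- `ε (a ▹ u) = a ε(u)` -/
  counit_src_mul : ∀ (a : A) (u : U), counit (toAeRing.s a * u) = a * counit u
  /-- `ε (u ◃ a) = ε(u) a` -/
  counit_tgt_mul : ∀ (a : A) (u : U), counit (toAeRing.t a * u) = counit u * a
  /-- `Δ(u₍₁₎) ⊗ u₍₂₎ = u₍₁₎ ⊗ Δ(u₍₂₎)` -/
  coassoc : ∀ (u : U) (N : ℕ) (x y : Fin N → U),
    comul u = ∑ i, toAeRing.tmul (x i) (y i) →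
      ∑ i, toAeRing.tmulSnoc (y i) (comul (x i)) = ∑ i, toAeRing.consTmul (x i) (comul (y i))
  /-- `ε(u₍₁₎) ▹ u₍₂₎ = u` -/
  counit_comul_left : ∀ (u : U) (N : ℕ) (x y : Fin N → U),
    comul u = ∑ i, toAeRing.tmul (x i) (y i) →
      ∑ i, toAeRing.s (counit (x i)) * y i = u
  /-- `u₍₁₎ ◃ ε(u₍₂₎) = u` -/
  counit_comul_right : ∀ (u : U) (N : ℕ) (x y : Fin N → U),
    comul u = ∑ i, toAeRing.tmul (x i) (y i) →
      ∑ i, toAeRing.t (counit (y i)) * x i = u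
  /-- `Δ` takes values in the Sweedler-Takeuchi product: `a ▸ u₍₁₎ ⊗ u₍₂₎ = u₍₁₎ ⊗ u₍₂₎ ◂ a` -/
  takeuchi : ∀ (a : A) (u : U) (N : ℕ) (x y : Fin N → U),
    comul u = ∑ i, toAeRing.tmul (x i) (y i) →
      ∑ i, toAeRing.tmul (x i * toAeRing.t a) (y i) = ∑ i, toAeRing.tmul (x i) (y i * toAeRing.s a)
  comul_one : comul 1 = toAeRing.tmul 1 1
  /-- `Δ (u v) = u₍₁₎ v₍₁₎ ⊗ u₍₂₎ v₍₂₎` -/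
  comul_mul : ∀ (u v : U) (N N' : ℕ) (x y : Fin N → U) (x' y' : Fin N' → U),
    comul u = ∑ i, toAeRing.tmul (x i) (y i) → comul v = ∑ j, toAeRing.tmul (x' j) (y' j) →
      comul (u * v) = ∑ i, ∑ j, toAeRing.tmul (x i * x' j) (y i * y' j)
  counit_one : counit 1 = 1
  /-- `ε (a ▸ u) = ε (u ◂ a)` -/
  counit_mul_tgt : ∀ (a : A) (u : U),
    counit (u * toAeRing.t a) = counit (u * toAeRing.s a)
  /-- `ε (u v) = ε (u ◂ ε(v))` -/
  counit_mul : ∀ u v : U, counit (u * v) = counit (u * toAeRing.s (counit v))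

namespace LeftBialgebroid

variable {k A U : Type*} [CommRing k] [Ring A] [Algebra k A] [Ring U] [Algebra k U]
variable (B : LeftBialgebroid k A U)

theorem comul_mul_tgt (a : A) (u : U) :
    B.comul (u * B.t a) = B.mulRight (B.t a) (B.comul u) := by
  obtain ⟨N, x, y, h⟩ := B.exists_sum_tmul (B.comul u)
  have h1 : B.comul (B.t a) = ∑ _j : Fin 1, B.tmul 1 (B.t a) := by
    have := B.comul_tgt_mul a 1 1 (fun _ => 1) (fun _ => 1) (by simp [B.comul_one])
    simpa using this
  rw [B.comul_mul u (B.t a) N 1 x y _ _ h h1, h, map_sum]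
  simp [AeRing.mulRight_tmul]

theorem mulRight_mul (v w : U) (z : B.Tensor) :
    B.mulRight (v * w) z = B.mulRight w (B.mulRight v z) := by
  obtain ⟨N, x, y, rfl⟩ := B.exists_sum_tmul z
  simp [AeRing.mulRight_tmul, mul_assoc]

theorem mulRight_add (v w : U) (z : B.Tensor) :
    B.mulRight (v + w) z = B.mulRight v z + B.mulRight w z := by
  obtain ⟨N, x, y, rfl⟩ := B.exists_sum_tmul z
  simp only [map_sum, AeRing.mulRight_tmul, mul_add, AeRing.tmul_add, Finset.sum_add_distrib]

theorem mulRight_smul (c : k) (v : U) (z : B.Tensor) :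
    B.mulRight (c • v) z = c • B.mulRight v z := by
  obtain ⟨N, x, y, rfl⟩ := B.exists_sum_tmul z
  simp only [map_sum, AeRing.mulRight_tmul, mul_smul_comm, AeRing.tmul_smul, Finset.smul_sum]

/-- The Hopf-Galois map
`▸U ⊗_{Aᵒᵖ} U_◃ → U_◃ ⊗_A ▹U`, `u ⊗_{Aᵒᵖ} v ↦ u₍₁₎ ⊗_A u₍₂₎ v`. -/
def galois : B.TensorOp →ₗ[k] B.Tensor :=
  B.relOp.liftQ
    (TensorProduct.lift
      (LinearMap.mk₂ k (fun u v => B.mulRight v (B.comul u))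
        (fun u u' v => by rw [map_add, map_add])
        (fun c u v => by rw [map_smul, map_smul])
        (fun u v v' => B.mulRight_add v v' _)
        (fun c u v => B.mulRight_smul c v _))) <| B.relOp_le_ker _ fun a x y => by
    rw [TensorProduct.lift.tmul, TensorProduct.lift.tmul, LinearMap.mk₂_apply, LinearMap.mk₂_apply,
      comul_mul_tgt, mulRight_mul]

theorem galois_tmulOp (u v : U) : B.galois (B.tmulOp u v) = B.mulRight v (B.comul u) := by
  rw [galois, AeRing.tmulOp, Submodule.mkQ_apply, Submodule.liftQ_apply, TensorProduct.lift.tmul,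
    LinearMap.mk₂_apply]

end LeftBialgebroid

/-- A left Hopf algebroid: a left bialgebroid whose Hopf-Galois map is bijective. -/
structure LeftHopfAlgebroid (k A U : Type*) [CommRing k] [Ring A] [Algebra k A] [Ring U]
    [Algebra k U] extends LeftBialgebroid k A U where
  galois_bijective : Function.Bijective toLeftBialgebroid.galois

namespace LeftHopfAlgebroid

variable {k A U : Type*} [CommRing k] [Ring A] [Algebra k A] [Ring U] [Algebra k U]
variable (H : LeftHopfAlgebroid k A U)

/-- The translation map `u ↦ u₊ ⊗_{Aᵒᵖ} u₋`, where `u₊ ⊗_{Aᵒᵖ} u₋` is the preimage of `u ⊗_A 1`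
under the Hopf-Galois map. -/
def translation (u : U) : H.TensorOp :=
  (LinearEquiv.ofBijective H.galois H.galois_bijective).symm (H.tmul u 1)

end LeftHopfAlgebroid

section Contramodule

variable {k A U : Type*} [CommRing k] [Ring A] [Algebra k A] [Ring U] [Algebra k U]

namespace LeftBialgebroid

variable (B : LeftBialgebroid k A U)
variable {M : Type*} [AddCommGroup M] [Module k M] [Module Aᵐᵒᵖ M] [IsScalarTower k Aᵐᵒᵖ M]

/-- The right `A`-action `f a = f (a ▹ -)` on `Hom_{Aᵒᵖ}(U_◃, M)`. -/
def homAct (a : A) (f : B.homOp M) : B.homOp M :=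
  ⟨f.1 ∘ₗ LinearMap.mulLeft k (B.s a), fun b u => by
    simp only [LinearMap.comp_apply, LinearMap.mulLeft_apply]
    rw [← mul_assoc, B.src_tgt_comm, mul_assoc]
    exact f.2 b _⟩

/-- The map `m ε(-)` in `Hom_{Aᵒᵖ}(U_◃, M)`. -/
def counitHom (m : M) : B.homOp M :=
  ⟨{ toFun := fun u => op (B.counit u) • m
     map_add' := fun u v => by rw [map_add, op_add, add_smul]
     map_smul' := fun c u => by rw [map_smul, op_smul, smul_assoc, RingHom.id_apply] },
   fun a u => by
    change op (B.counit (B.t a * u)) • m = op a • op (B.counit u) • m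
    rw [B.counit_tgt_mul, op_mul, mul_smul]⟩

/-- The map `f (a ▸ -)` for `f` in `Hom_{Aᵒᵖ}(U_◃, M)`. -/
def homActBlack (a : A) (f : B.homOp M) : B.homOp M :=
  ⟨f.1 ∘ₗ LinearMap.mulRight k (B.t a), fun b u => by
    simp only [LinearMap.comp_apply, LinearMap.mulRight_apply, mul_assoc]
    exact f.2 b _⟩

end LeftBialgebroid

/-- A right contramodule over a left bialgebroid: a right `A`-module `M` with a contraaction
`γ : Hom_{Aᵒᵖ}(U_◃, M) → M` which is right `A`-linear, contraassociative and contraunital. -/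
structure Contramodule (B : LeftBialgebroid k A U) (M : Type*) [AddCommGroup M] [Module k M]
    [Module Aᵐᵒᵖ M] [IsScalarTower k Aᵐᵒᵖ M] where
  /-- the contraaction -/
  γ : B.homOp M →ₗ[k] M
  /-- `γ (f (a ▹ -)) = γ(f) a` -/
  γ_act : ∀ (a : A) (f : B.homOp M), γ (B.homAct a f) = op a • γ f
  /-- `γ (u ↦ γ (v ↦ g (u ⊗ v))) = γ (u ↦ g (u₍₁₎ ⊗ u₍₂₎))` for all right `A`-linear
  `g : U_◃ ⊗_A ▹U → M`. The three arguments of `γ` are named `ψ u = g (u ⊗ -)`,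
  `φ = γ (g (- ⊗ ··))` and `χ = g ∘ Δ`; they lie in `Hom_{Aᵒᵖ}(U_◃, M)` for every such `g`. -/
  γ_assoc : ∀ (g : B.Tensor →ₗ[k] M),
    (∀ (a : A) (u v : U), g (B.tmul u (B.t a * v)) = op a • g (B.tmul u v)) →
    ∀ (ψ : U → B.homOp M) (φ χ : B.homOp M),
      (∀ u v : U, (ψ u).1 v = g (B.tmul u v)) → (∀ u : U, φ.1 u = γ (ψ u)) →
      (∀ u : U, χ.1 u = g (B.comul u)) → γ φ = γ χ
  /-- `γ (m ε(-)) = m` -/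
  γ_unit : ∀ m : M, γ (B.counitHom m) = m

/-- The left `A`-action `a m = γ (m ε(a ▸ -))` on a right contramodule. -/
def Contramodule.leftAct {B : LeftBialgebroid k A U} {M : Type*} [AddCommGroup M] [Module k M]
    [Module Aᵐᵒᵖ M] [IsScalarTower k Aᵐᵒᵖ M] (C : Contramodule B M) (a : A) (m : M) : M :=
  C.γ (B.homActBlack a (B.counitHom m))

variable (H : LeftHopfAlgebroid k A U)
variable {M : Type*} [AddCommGroup M] [Module k M] [Module Aᵐᵒᵖ M] [IsScalarTower k Aᵐᵒᵖ M]
  [Module U M] [IsScalarTower k U M]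

/-- An anti Yetter-Drinfel'd contramodule: a left `U`-module and right `U`-contramodule `M` whose
two `A`-bimodule structures `s(a) t(b) m` and `a m b` coincide, such that
`u γ(f) = γ (u₊₍₂₎ f (u₋ (-) u₊₍₁₎)) = γ ((u₍₂₎)₊ f ((u₍₂₎)₋ (-) u₍₁₎))`.
In `action_contra`, `Δ u = ∑ x i ⊗ y i`, the translation of `y i` is `∑ p i l ⊗ q i l`, and `φ` is
the argument of `γ`, which lies in `Hom_{Aᵒᵖ}(U_◃, M)` for every such presentation. -/
structure IsAYD (C : Contramodule H.toLeftBialgebroid M) : Prop where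
  left_compat : ∀ (a : A) (m : M), H.s a • m = C.leftAct a m
  right_compat : ∀ (a : A) (m : M), H.t a • m = op a • m
  action_contra : ∀ (u : U) (f : H.homOp M) (N : ℕ) (x y : Fin N → U),
    H.comul u = ∑ i, H.tmul (x i) (y i) →
    ∀ (L : ℕ) (p q : Fin N → Fin L → U),
      (∀ i, H.translation (y i) = ∑ l, H.tmulOp (p i l) (q i l)) →
    ∀ φ : H.homOp M,
      (∀ w : U, φ.1 w = ∑ i, ∑ l, p i l • f.1 (q i l * w * x i)) →
      u • C.γ f = C.γ φ

/-- Stability: `γ ((-) m) = m`, where `(-) m` is the map `u ↦ u m` (which lies in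
`Hom_{Aᵒᵖ}(U_◃, M)` as soon as the two right `A`-actions on `M` coincide). -/
def IsStable (C : Contramodule H.toLeftBialgebroid M) : Prop :=
  ∀ (m : M) (φ : H.homOp M), (∀ u : U, φ.1 u = u • m) → C.γ φ = m

end Contramodule

section Cocyclic

variable {k : Type*} [CommRing k] {X : ℕ → Type*} [∀ n, AddCommGroup (X n)] [∀ n, Module k (X n)]

variable (k X) in
/-- Candidates for cofaces `δ_i : X n → X (n+1)`, `0 ≤ i ≤ n+1`, codegeneracies
`σ_j : X (n+1) → X n`, `0 ≤ j ≤ n`, and cocyclic operators `τ : X n → X n`. -/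
structure Operators where
  δ : ∀ n : ℕ, Fin (n + 2) → X n →ₗ[k] X (n + 1)
  σ : ∀ n : ℕ, Fin (n + 1) → X (n + 1) →ₗ[k] X n
  τ : ∀ n : ℕ, X n →ₗ[k] X n

/-- A para-cocyclic `k`-module: all relations of a cocyclic `k`-module except `τ^{n+1} = id`. -/
structure Operators.IsParaCocyclic (P : Operators k X) : Prop where
  /-- `δ_{j+1} δ_i = δ_i δ_j` for `i ≤ j` -/
  δ_δ : ∀ (n : ℕ) (i j : Fin (n + 2)), i ≤ j →
    P.δ (n + 1) j.succ ∘ₗ P.δ n i = P.δ (n + 1) i.castSucc ∘ₗ P.δ n j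
  /-- `σ_j σ_i = σ_i σ_{j+1}` for `i ≤ j` -/
  σ_σ : ∀ (n : ℕ) (i j : Fin (n + 1)), i ≤ j →
    P.σ n j ∘ₗ P.σ (n + 1) i.castSucc = P.σ n i ∘ₗ P.σ (n + 1) j.succ
  /-- `σ_{j+1} δ_i = δ_i σ_j` for `i ≤ j` -/
  σ_δ_of_le : ∀ (n : ℕ) (i : Fin (n + 2)) (j : Fin (n + 1)), i ≤ j.castSucc →
    P.σ (n + 1) j.succ ∘ₗ P.δ (n + 1) i.castSucc = P.δ n i ∘ₗ P.σ n j
  /-- `σ_j δ_j = id` -/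
  σ_δ_self : ∀ (n : ℕ) (j : Fin (n + 1)), P.σ n j ∘ₗ P.δ n j.castSucc = LinearMap.id
  /-- `σ_j δ_{j+1} = id` -/
  σ_δ_succ : ∀ (n : ℕ) (j : Fin (n + 1)), P.σ n j ∘ₗ P.δ n j.succ = LinearMap.id
  /-- `σ_j δ_{i+1} = δ_i σ_j` for `i > j` -/
  σ_δ_of_gt : ∀ (n : ℕ) (i : Fin (n + 2)) (j : Fin (n + 1)), j.castSucc < i →
    P.σ (n + 1) j.castSucc ∘ₗ P.δ (n + 1) i.succ = P.δ n i ∘ₗ P.σ n j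
  /-- `τ δ_0 = δ_{n+1}` -/
  τ_δ_zero : ∀ n : ℕ, P.τ (n + 1) ∘ₗ P.δ n 0 = P.δ n (Fin.last (n + 1))
  /-- `τ δ_i = δ_{i-1} τ` for `1 ≤ i ≤ n+1` -/
  τ_δ_succ : ∀ (n : ℕ) (i : Fin (n + 1)),
    P.τ (n + 1) ∘ₗ P.δ n i.succ = P.δ n i.castSucc ∘ₗ P.τ n
  /-- `τ σ_0 = σ_n τ²` -/
  τ_σ_zero : ∀ n : ℕ, P.τ n ∘ₗ P.σ n 0 = P.σ n (Fin.last n) ∘ₗ P.τ (n + 1) ∘ₗ P.τ (n + 1)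
  /-- `τ σ_j = σ_{j-1} τ` for `1 ≤ j` -/
  τ_σ_succ : ∀ (n : ℕ) (j : Fin (n + 1)),
    P.τ (n + 1) ∘ₗ P.σ (n + 1) j.succ = P.σ (n + 1) j.castSucc ∘ₗ P.τ (n + 2)

/-- A cocyclic `k`-module. -/
structure Operators.IsCocyclic (P : Operators k X) : Prop extends P.IsParaCocyclic where
  τ_pow : ∀ n : ℕ, P.τ n ^ (n + 1) = LinearMap.id

end Cocyclic

section Formulas

variable {k A U : Type*} [CommRing k] [Ring A] [Algebra k A] [Ring U] [Algebra k U]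
variable {M : Type*} [AddCommGroup M] [Module k M] [Module Aᵐᵒᵖ M] [IsScalarTower k Aᵐᵒᵖ M]
  [Module U M] [IsScalarTower k U M]

/-- The value `(δ_0 f)(u¹, …, uⁿ⁺¹)`, which is `f (u¹, …, ε(uⁿ⁺¹) ▸ uⁿ)` for `n ≥ 1` and
`m ε(u¹)` for `n = 0` and `f = m ∈ M`. -/
def cofaceZero (B : LeftBialgebroid k A U) :
    (n : ℕ) → MultilinearMap k (fun _ : Fin n => U) M → (Fin (n + 1) → U) → M
  | 0, f, u => op (B.counit (u 0)) • f ![]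
  | n + 1, f, u => f (Function.update (Fin.init u) (Fin.last n)
      (Fin.init u (Fin.last n) * B.t (B.counit (u (Fin.last (n + 1))))))

/-- The expression `p¹ f (p², …, pⁿ, qⁿ ⋯ q¹ w)`, which is `w f` for `n = 0`. -/
def cyclicTerm :
    (n : ℕ) → MultilinearMap k (fun _ : Fin n => U) M → (p q : Fin n → U) → (w : U) → M
  | 0, f, _, _, w => w • f ![]
  | n + 1, f, p, q, w =>
      p 0 • f (Fin.snoc (α := fun _ => U) (fun i : Fin n => p i.succ)
        ((List.ofFn q).reverse.prod * w))

/-- The operators on `C^•(U, M)` are given by the formulas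
* `(δ_0 f)(u¹, …, uⁿ⁺¹) = f (u¹, …, ε(uⁿ⁺¹) ▸ uⁿ)`,
* `(δ_i f)(u¹, …, uⁿ⁺¹) = f (u¹, …, uⁿ⁻ⁱ⁺¹ uⁿ⁻ⁱ⁺², …, uⁿ⁺¹)` for `1 ≤ i ≤ n`,
* `(δ_{n+1} f)(u¹, …, uⁿ⁺¹) = u¹ f (u², …, uⁿ⁺¹)`,
* `(σ_j f)(u¹, …, uⁿ) = f (u¹, …, uⁿ⁻ʲ, 1, uⁿ⁻ʲ⁺¹, …, uⁿ)` for `f` of degree `n + 1`,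
* `(τ f)(u¹, …, uⁿ) = γ (u¹₊ f (u²₊, …, uⁿ₊, uⁿ₋ ⋯ u¹₋ (-)))`.

In the last one, `∑ l, p i l ⊗ q i l` is any presentation of `uⁱ₊ ⊗ uⁱ₋` (with a common
number of terms, which is no restriction: pad with zeros), and `φ` is the argument of `γ`; that the
argument lies in `Hom_{Aᵒᵖ}(U_◃, M)` is part of the assertion. -/
structure IsGivenByFormulas (H : LeftHopfAlgebroid k A U) (C : Contramodule H.toLeftBialgebroid M)
    (P : Operators k (fun n => H.cochain M n)) : Prop where
  δ_zero : ∀ (n : ℕ) (f : H.cochain M n) (u : Fin (n + 1) → U),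
    (P.δ n 0 f).1 u = cofaceZero H.toLeftBialgebroid n f.1 u
  δ_mid : ∀ (n : ℕ) (i : Fin (n + 2)) (_ : 1 ≤ (i : ℕ)) (_ : (i : ℕ) ≤ n) (f : H.cochain M n)
      (u : Fin (n + 1) → U),
    (P.δ n i f).1 u = f.1 (Fin.contractNth ⟨n - (i : ℕ), by lia⟩ (· * ·) u)
  δ_last : ∀ (n : ℕ) (f : H.cochain M n) (u : Fin (n + 1) → U),
    (P.δ n (Fin.last (n + 1)) f).1 u = u 0 • f.1 (Fin.tail u)
  σ_apply : ∀ (n : ℕ) (j : Fin (n + 1)) (f : H.cochain M (n + 1)) (u : Fin n → U),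
    (P.σ n j f).1 u = f.1 ((Fin.rev j).insertNth (α := fun _ => U) 1 u)
  τ_apply : ∀ (n : ℕ) (f : H.cochain M n) (u : Fin n → U) (L : ℕ) (p q : Fin n → Fin L → U),
    (∀ i, H.translation (u i) = ∑ l, H.tmulOp (p i l) (q i l)) →
    ∃ φ : H.homOp M,
      (∀ w : U, φ.1 w = ∑ l : Fin n → Fin L,
        cyclicTerm n f.1 (fun i => p i (l i)) (fun i => q i (l i)) w) ∧
      (P.τ n f).1 u = C.γ φ

end Formulas

end HopfAlgebroid

end

/-! A cochain `f` is studied through `f̂(u⁰,…,uⁿ) = u⁰ f(u¹,…,uⁿ)` (`actHead`), which is balanced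
because `t(a)m = ma`. On `f̂`, the coface `δ_0` absorbs the last argument through `ε`, every other
coface multiplies two neighbours, and a codegeneracy inserts `1`. The relations without `τ` are then
elementary identities for functions on lists. The operator `τ f` is `contraEval` applied to `f̂`,
where `contraEval` sends `g` to `γ(g(u¹₊,…,uⁿ₊,uⁿ₋⋯u¹₋(-)))`.

The relations with `τ` reflect the rules of the translation map. Multiplicativity and unitality of
`u ↦ u₊ ⊗ u₋` let `contraEval` commute with products and insertions. The rule `u₊u₋ = s(ε(u))`
handles the product with the last slot (`transEval_contract_last`). The rule `u₊ t(ε(u₋)) = u`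
together with contraunitality gives `τδ_0 = δ_{n+1}` (`contraEval_contractEnd`). Contraassociativity
together with `u₊₊ ⊗ u₋ ⊗ u₊₋ = u₊ ⊗ u₋₍₁₎ ⊗ u₋₍₂₎` gives `τσ_0 = σ_nτ²` (`contraEval_contraEval`).

For cyclicity, `g` is rewritten in Galois coordinates as `g(v⁰₊, v⁰₋v¹₊, …, vⁿ⁻¹₋vⁿ)`
(`galoisForm`), which loses no information (`eq_of_galoisForm_eq`). The anti Yetter–Drinfel'd
condition makes `τ` a rotation there: the form of `τ f` at `(v,x,…)` is `γ` of the form of `f` at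
`(x,…,(-)v)` (`galoisForm_contraEval`). After `n+1` rotations every slot `vⁱ` carries its own
contraaction, as `wᵢvⁱ`. Contraassociativity merges these into a single `γ` with the diagonal
arguments `w₍ᵢ₎vⁱ`, and in Galois coordinates the diagonal action is left multiplication of the head
by `w` (`nestedContra_galoisForm`). Since `f̂` is `U`-linear in its head, what remains is `γ((-)m)`,
which stability identifies with `m`.

The formulas determine the operators (`eq_of_isGivenByFormulas`), so everything is proved for one
explicit model. -/

noncomputable section

set_option linter.unusedSectionVars false

namespace HopfAlgebroid

/-! ### Balanced functions and their descent to tensor products -/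

section Bilinear

variable {k A U : Type*} [CommRing k] [Ring A] [Algebra k A] [Ring U] [Algebra k U]
variable {N : Type*} [AddCommGroup N] [Module k N] {N' : Type*} [AddCommGroup N'] [Module k N']

variable (k) in
/-- `k`-bilinearity of a function of two variables. -/
structure Bilinear (F : U → U → N) : Prop where
  add_left : ∀ x x' y, F (x + x') y = F x y + F x' y
  add_right : ∀ x y y', F x (y + y') = F x y + F x y'
  smul_left : ∀ (c : k) x y, F (c • x) y = c • F x y
  smul_right : ∀ (c : k) x y, F x (c • y) = c • F x y

/-- A `k`-bilinear function that descends to `U_◃ ⊗_A ▹U`. -/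
structure AeRing.Balanced (E : AeRing k A U) (F : U → U → N) : Prop extends Bilinear k F where
  bal : ∀ (a : A) x y, F (E.t a * x) y = F x (E.s a * y)

/-- A `k`-bilinear function that descends to `▸U ⊗_{Aᵒᵖ} U_◃`. -/
structure AeRing.BalancedOp (E : AeRing k A U) (F : U → U → N) : Prop extends Bilinear k F where
  bal : ∀ (a : A) x y, F (x * E.t a) y = F x (E.t a * y)

theorem Bilinear.exists_lift {F : U → U → N} (h : Bilinear k F) :
    ∃ L : U ⊗[k] U →ₗ[k] N, ∀ x y, L (x ⊗ₜ y) = F x y :=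
  ⟨TensorProduct.lift (LinearMap.mk₂ k F h.add_left h.smul_left h.add_right h.smul_right),
    fun _ _ => rfl⟩

theorem Bilinear.mul {F : U → U → N} (h : Bilinear k F) (a b c d : U) :
    Bilinear k (fun x y => F (a * x * b) (c * y * d)) where
  add_left x x' y := by rw [mul_add, add_mul, h.add_left]
  add_right x y y' := by rw [mul_add, add_mul, h.add_right]
  smul_left c x y := by rw [mul_smul_comm, smul_mul_assoc, h.smul_left]
  smul_right c x y := by rw [mul_smul_comm, smul_mul_assoc, h.smul_right]

theorem Bilinear.sum {ι : Type*} (s : Finset ι) {F : ι → U → U → N}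
    (h : ∀ i, Bilinear k (F i)) : Bilinear k (fun x y => ∑ i ∈ s, F i x y) where
  add_left x x' y := by simp only [(h _).add_left, Finset.sum_add_distrib]
  add_right x y y' := by simp only [(h _).add_right, Finset.sum_add_distrib]
  smul_left c x y := by simp only [(h _).smul_left, Finset.smul_sum]
  smul_right c x y := by simp only [(h _).smul_right, Finset.smul_sum]

namespace AeRing

variable {E : AeRing k A U}

theorem Balanced.exists_lift {F : U → U → N} (h : E.Balanced F) :
    ∃ L : E.Tensor →ₗ[k] N, ∀ x y, L (E.tmul x y) = F x y := by
  obtain ⟨L, hL⟩ := h.toBilinear.exists_lift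
  exact ⟨E.rel.liftQ L (E.rel_le_ker _ fun a x y => by simp only [hL, h.bal]),
    fun x y => by simp only [tmul, Submodule.mkQ_apply, Submodule.liftQ_apply, hL]⟩

theorem BalancedOp.exists_lift {F : U → U → N} (h : E.BalancedOp F) :
    ∃ L : E.TensorOp →ₗ[k] N, ∀ x y, L (E.tmulOp x y) = F x y := by
  obtain ⟨L, hL⟩ := h.toBilinear.exists_lift
  exact ⟨E.relOp.liftQ L (E.relOp_le_ker _ fun a x y => by simp only [hL, h.bal]),
    fun x y => by simp only [tmulOp, Submodule.mkQ_apply, Submodule.liftQ_apply, hL]⟩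

variable (E) in
theorem t_mul (a b : A) : E.t (a * b) = E.t b * E.t a := map_mul E.tgt (op b) (op a)

variable (E) in
theorem s_mul (a b : A) : E.s (a * b) = E.s a * E.s b := map_mul E.src a b

variable (E) in
theorem t_add (a b : A) : E.t (a + b) = E.t a + E.t b := map_add E.tgt (op a) (op b)

variable (E) in
theorem s_add (a b : A) : E.s (a + b) = E.s a + E.s b := map_add E.src a b

variable (E) in
theorem t_smul (c : k) (a : A) : E.t (c • a) = c • E.t a := map_smul E.tgt c (op a)

variable (E) in
theorem s_smul (c : k) (a : A) : E.s (c • a) = c • E.s a := map_smul E.src c a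

variable (E) in
theorem t_one : E.t 1 = 1 := map_one E.tgt

variable (E) in
theorem s_one : E.s 1 = 1 := map_one E.src

theorem Balanced.mul_right {F : U → U → N} (h : E.Balanced F) (v w : U) :
    E.Balanced (fun x y => F (x * v) (y * w)) where
  toBilinear := by simpa only [one_mul] using h.toBilinear.mul 1 v 1 w
  bal a x y := by rw [mul_assoc, h.bal, mul_assoc]

theorem Balanced.mul_right_snd {F : U → U → N} (h : E.Balanced F) (w : U) :
    E.Balanced (fun x y => F x (y * w)) := by
  simpa only [mul_one] using h.mul_right 1 w

theorem Balanced.mul_right_fst {F : U → U → N} (h : E.Balanced F) (w : U) :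
    E.Balanced (fun x y => F (x * w) y) := by
  simpa only [mul_one] using h.mul_right w 1

theorem Balanced.tgt_mul {F : U → U → N} (h : E.Balanced F) (a : A) :
    E.Balanced (fun x y => F x (E.t a * y)) where
  toBilinear := by simpa only [one_mul, mul_one] using h.toBilinear.mul 1 1 (E.t a) 1
  bal b x y := by rw [h.bal, ← mul_assoc, ← mul_assoc, E.src_tgt_comm]

theorem Balanced.src_mul {F : U → U → N} (h : E.Balanced F) (a : A) :
    E.Balanced (fun x y => F (E.s a * x) y) where
  toBilinear := by simpa only [one_mul, mul_one] using h.toBilinear.mul (E.s a) 1 1 1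
  bal b x y := by rw [← mul_assoc, E.src_tgt_comm, mul_assoc, h.bal]

theorem BalancedOp.mul {F : U → U → N} (h : E.BalancedOp F) (v w : U) :
    E.BalancedOp (fun x y => F (v * x) (y * w)) where
  toBilinear := by simpa only [one_mul, mul_one] using h.toBilinear.mul v 1 1 w
  bal a x y := by rw [← mul_assoc, h.bal, mul_assoc]

theorem BalancedOp.mul_right {F : U → U → N} (h : E.BalancedOp F) (w : U) :
    E.BalancedOp (fun x y => F x (y * w)) := by
  simpa only [one_mul] using h.mul 1 w

theorem BalancedOp.mul_left {F : U → U → N} (h : E.BalancedOp F) (w : U) :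
    E.BalancedOp (fun x y => F (w * x) y) := by
  simpa only [mul_one] using h.mul w 1

theorem balanced_tmul : E.Balanced E.tmul where
  add_left x x' y := by simp only [tmul, TensorProduct.add_tmul, map_add]
  add_right := E.tmul_add
  smul_left c x y := by simp only [tmul, ← TensorProduct.smul_tmul', map_smul]
  smul_right := E.tmul_smul
  bal a x y := by
    rw [tmul, tmul, ← sub_eq_zero, ← map_sub, Submodule.mkQ_apply, Submodule.Quotient.mk_eq_zero]
    exact Submodule.subset_span ⟨a, x, y, rfl⟩

theorem exists_sum_tmulOp (z : E.TensorOp) :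
    ∃ (n : ℕ) (x y : Fin n → U), z = ∑ i, E.tmulOp (x i) (y i) := by
  obtain ⟨r, rfl⟩ := Submodule.mkQ_surjective _ z
  induction r using TensorProduct.induction_on with
  | zero => exact ⟨0, Fin.elim0, Fin.elim0, by simp⟩
  | tmul x y => exact ⟨1, fun _ => x, fun _ => y, by simp [tmulOp]⟩
  | add r r' h h' =>
    obtain ⟨n, x, y, h⟩ := h
    obtain ⟨n', x', y', h'⟩ := h'
    exact ⟨n + n', Fin.append x x', Fin.append y y', by
      rw [map_add, h, h', Fin.sum_univ_add]; simp⟩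

theorem exists_lift₃ {F : U → U → U → N} (h₁ : ∀ x, E.Balanced (F x))
    (h₂ : ∀ z, E.Balanced (fun x y => F x y z)) :
    ∃ L : E.Tensor₃ →ₗ[k] N,
      (∀ x y z, L (E.consTmul x (E.tmul y z)) = F x y z) ∧
      ∀ x y z, L (E.tmulSnoc z (E.tmul x y)) = F x y z := by
  let B : U →ₗ[k] U →ₗ[k] U →ₗ[k] N := LinearMap.mk₂ k
    (fun x y =>
      { toFun := F x y
        map_add' := (h₁ x).add_right y
        map_smul' := fun c z => (h₁ x).smul_right c y z })
    (fun x x' y => LinearMap.ext fun z => (h₂ z).add_left x x' y)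
    (fun c x y => LinearMap.ext fun z => (h₂ z).smul_left c x y)
    (fun x y y' => LinearMap.ext fun z => (h₂ z).add_right x y y')
    (fun c x y => LinearMap.ext fun z => (h₂ z).smul_right c x y)
  let L₀ : U ⊗[k] (U ⊗[k] U) →ₗ[k] N :=
    TensorProduct.lift (TensorProduct.lift B) ∘ₗ (TensorProduct.assoc k U U U).symm.toLinearMap
  have hL₀ : ∀ x y z, L₀ (x ⊗ₜ (y ⊗ₜ z)) = F x y z := fun x y z => rfl
  have hker : E.rel₃ ≤ LinearMap.ker L₀ := by
    rw [rel₃, Submodule.span_le]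
    rintro _ (⟨a, x, y, z, rfl⟩ | ⟨a, x, y, z, rfl⟩)
    · rw [SetLike.mem_coe, LinearMap.mem_ker, map_sub, hL₀, hL₀, (h₂ z).bal, sub_self]
    · rw [SetLike.mem_coe, LinearMap.mem_ker, map_sub, hL₀, hL₀, (h₁ x).bal, sub_self]
  exact ⟨E.rel₃.liftQ L₀ hker, fun x y z => hL₀ x y z, fun x y z => hL₀ x y z⟩

end AeRing

end Bilinear

/-! ### Sweedler calculus for the coproduct -/

namespace LeftBialgebroid

variable {k A U : Type*} [CommRing k] [Ring A] [Algebra k A] [Ring U] [Algebra k U]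
variable (B : LeftBialgebroid k A U)
variable {N : Type*} [AddCommGroup N] [Module k N] {N' : Type*} [AddCommGroup N'] [Module k N']

/-- The number of terms in a chosen presentation of `Δ u`. -/
def comulCard (u : U) : ℕ := (B.exists_sum_tmul (B.comul u)).choose

/-- The first factors in a chosen presentation of `Δ u`. -/
def comulFst (u : U) : Fin (B.comulCard u) → U := (B.exists_sum_tmul (B.comul u)).choose_spec.choose

/-- The second factors in a chosen presentation of `Δ u`. -/
def comulSnd (u : U) : Fin (B.comulCard u) → U :=
  (B.exists_sum_tmul (B.comul u)).choose_spec.choose_spec.choose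

theorem comul_eq (u : U) : B.comul u = ∑ i, B.tmul (B.comulFst u i) (B.comulSnd u i) :=
  (B.exists_sum_tmul (B.comul u)).choose_spec.choose_spec.choose_spec

/-- The Sweedler sum `F (u₍₁₎, u₍₂₎)`. -/
def sumComul (u : U) (F : U → U → N) : N := ∑ i, F (B.comulFst u i) (B.comulSnd u i)

variable {B}

theorem map_comul {L : B.Tensor →ₗ[k] N} {F : U → U → N} (hL : ∀ x y, L (B.tmul x y) = F x y)
    (u : U) : L (B.comul u) = B.sumComul u F := by
  rw [comul_eq, map_sum]; simp only [hL, sumComul]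

/-- A balanced `F` descends to the tensor product over `A`, so any presentation of `Δ u` may replace
the chosen one. -/
theorem sumComul_eq {F : U → U → N} (hF : B.Balanced F) {ι : Type*} [Fintype ι] {u : U}
    {x y : ι → U} (h : B.comul u = ∑ i, B.tmul (x i) (y i)) :
    B.sumComul u F = ∑ i, F (x i) (y i) := by
  obtain ⟨L, hL⟩ := hF.exists_lift
  rw [← map_comul hL, h, map_sum]; simp only [hL]

theorem sumComul_add {F : U → U → N} (hF : B.Balanced F) (u v : U) :
    B.sumComul (u + v) F = B.sumComul u F + B.sumComul v F := by
  obtain ⟨L, hL⟩ := hF.exists_lift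
  simp only [← map_comul hL, map_add]

theorem sumComul_smul {F : U → U → N} (hF : B.Balanced F) (c : k) (u : U) :
    B.sumComul (c • u) F = c • B.sumComul u F := by
  obtain ⟨L, hL⟩ := hF.exists_lift
  simp only [← map_comul hL, map_smul]

theorem sumComul_src_mul {F : U → U → N} (hF : B.Balanced F) (a : A) (u : U) :
    B.sumComul (B.s a * u) F = B.sumComul u (fun x y => F (B.s a * x) y) :=
  sumComul_eq hF (B.comul_src_mul a u _ _ _ (B.comul_eq u))

theorem sumComul_tgt_mul {F : U → U → N} (hF : B.Balanced F) (a : A) (u : U) :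
    B.sumComul (B.t a * u) F = B.sumComul u (fun x y => F x (B.t a * y)) :=
  sumComul_eq hF (B.comul_tgt_mul a u _ _ _ (B.comul_eq u))

theorem sumComul_mul {F : U → U → N} (hF : B.Balanced F) (u v : U) :
    B.sumComul (u * v) F =
      B.sumComul u (fun x y => B.sumComul v (fun x' y' => F (x * x') (y * y'))) := by
  have h := B.comul_mul u v _ _ _ _ _ _ (B.comul_eq u) (B.comul_eq v)
  rw [← Fintype.sum_prod_type'] at h
  rw [sumComul_eq hF h, Fintype.sum_prod_type]; rfl

theorem sumComul_one {F : U → U → N} (hF : B.Balanced F) : B.sumComul 1 F = F 1 1 := by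
  have h : B.comul 1 = ∑ _i : Unit, B.tmul 1 1 := by simp [B.comul_one]
  rw [sumComul_eq hF h]; simp

theorem sumComul_takeuchi {F : U → U → N} (hF : B.Balanced F) (a : A) (u : U) :
    B.sumComul u (fun x y => F (x * B.t a) y) = B.sumComul u (fun x y => F x (y * B.s a)) := by
  obtain ⟨L, hL⟩ := hF.exists_lift
  have h := congrArg L (B.takeuchi a u _ _ _ (B.comul_eq u))
  simpa only [map_sum, hL, sumComul] using h

theorem sumComul_mul_tgt {F : U → U → N} (hF : B.Balanced F) (a : A) (u : U) :
    B.sumComul (u * B.t a) F = B.sumComul u (fun x y => F x (y * B.t a)) := by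
  have h := B.comul_mul_tgt a u
  rw [B.comul_eq u, map_sum] at h
  exact sumComul_eq hF h

theorem sumComul_coassoc {F : U → U → U → N} (h₁ : ∀ x, B.Balanced (F x))
    (h₂ : ∀ z, B.Balanced (fun x y => F x y z)) (u : U) :
    B.sumComul u (fun x z => B.sumComul x (fun x₁ x₂ => F x₁ x₂ z)) =
      B.sumComul u (fun x z => B.sumComul z (F x)) := by
  obtain ⟨L, hL₁, hL₂⟩ := AeRing.exists_lift₃ h₁ h₂
  have h := congrArg L (B.coassoc u _ _ _ (B.comul_eq u))
  simp only [map_sum] at h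
  rw [sumComul, sumComul]
  convert h using 2 with i _ i _
  · rw [B.comul_eq (B.comulFst u i), map_sum, map_sum]; simp only [hL₂]; rfl
  · rw [B.comul_eq (B.comulSnd u i), map_sum, map_sum]; simp only [hL₁]; rfl

theorem sumComul_counit_left (u : U) : B.sumComul u (fun x y => B.s (B.counit x) * y) = u :=
  B.counit_comul_left u _ _ _ (B.comul_eq u)

theorem sumComul_counit_right (u : U) : B.sumComul u (fun x y => B.t (B.counit y) * x) = u :=
  B.counit_comul_right u _ _ _ (B.comul_eq u)

theorem sumComul_map (u : U) (φ : N →ₗ[k] N') (F : U → U → N) :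
    φ (B.sumComul u F) = B.sumComul u (fun x y => φ (F x y)) := map_sum _ _ _

/-- Left multiplication by `Δ u` respects the tensor product over `A` only because of the Takeuchi
condition. -/
theorem balanced_sumComul_mul {F : U → U → N} (hF : B.Balanced F) (u : U) :
    B.Balanced (fun x z => B.sumComul u (fun x' y' => F (x' * x) (y' * z))) where
  toBilinear := Bilinear.sum _ fun i => by
    simpa only [mul_one] using hF.toBilinear.mul (B.comulFst u i) 1 (B.comulSnd u i) 1
  bal a x z := by
    have := sumComul_takeuchi (hF.mul_right x z) a u
    simpa only [mul_assoc] using this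

theorem balanced_counit_left : B.Balanced (fun x y => B.s (B.counit x) * y) where
  add_left x x' y := by rw [map_add, B.s_add, add_mul]
  add_right x y y' := mul_add _ _ _
  smul_left c x y := by rw [map_smul, B.s_smul, smul_mul_assoc]
  smul_right c x y := mul_smul_comm _ _ _
  bal a x y := by rw [B.counit_tgt_mul, B.s_mul, mul_assoc]

theorem balanced_counit_right : B.Balanced (fun x y => B.t (B.counit y) * x) where
  add_left x x' y := mul_add _ _ _
  add_right x y y' := by rw [map_add, B.t_add, add_mul]
  smul_left c x y := mul_smul_comm _ _ _
  smul_right c x y := by rw [map_smul, B.t_smul, smul_mul_assoc]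
  bal a x y := by rw [B.counit_src_mul, B.t_mul, mul_assoc]

theorem counit_mul' (u v : U) : B.counit (u * v) = B.counit (u * B.t (B.counit v)) := by
  rw [B.counit_mul, B.counit_mul_tgt]

end LeftBialgebroid

/-! ### Sweedler calculus for the translation map -/

namespace LeftHopfAlgebroid

open LeftBialgebroid AeRing

variable {k A U : Type*} [CommRing k] [Ring A] [Algebra k A] [Ring U] [Algebra k U]
variable (H : LeftHopfAlgebroid k A U)
variable {N : Type*} [AddCommGroup N] [Module k N] {N' : Type*} [AddCommGroup N'] [Module k N']

/-- The number of terms in a chosen presentation of `u₊ ⊗ u₋`. -/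
def transCard (u : U) : ℕ := (H.exists_sum_tmulOp (H.translation u)).choose

/-- The first factors in a chosen presentation of `u₊ ⊗ u₋`. -/
def transFst (u : U) : Fin (H.transCard u) → U :=
  (H.exists_sum_tmulOp (H.translation u)).choose_spec.choose

/-- The second factors in a chosen presentation of `u₊ ⊗ u₋`. -/
def transSnd (u : U) : Fin (H.transCard u) → U :=
  (H.exists_sum_tmulOp (H.translation u)).choose_spec.choose_spec.choose

theorem translation_eq (u : U) :
    H.translation u = ∑ i, H.tmulOp (H.transFst u i) (H.transSnd u i) :=
  (H.exists_sum_tmulOp (H.translation u)).choose_spec.choose_spec.choose_spec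

/-- The Sweedler sum `F (u₊, u₋)`. -/
def sumTrans (u : U) (F : U → U → N) : N := ∑ i, F (H.transFst u i) (H.transSnd u i)

theorem translation_add (u v : U) :
    H.translation (u + v) = H.translation u + H.translation v := by
  simp only [translation, AeRing.balanced_tmul.add_left, map_add]

theorem translation_smul (c : k) (u : U) : H.translation (c • u) = c • H.translation u := by
  simp only [translation, AeRing.balanced_tmul.smul_left, map_smul]

theorem galois_translation (u : U) : H.galois (H.translation u) = H.tmul u 1 :=
  LinearEquiv.apply_symm_apply (LinearEquiv.ofBijective H.galois H.galois_bijective) _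

variable {H}

theorem map_translation {L : H.TensorOp →ₗ[k] N} {F : U → U → N}
    (hL : ∀ x y, L (H.tmulOp x y) = F x y) (u : U) : L (H.translation u) = H.sumTrans u F := by
  rw [translation_eq, map_sum]; simp only [hL, sumTrans]

theorem sumTrans_eq {F : U → U → N} (hF : H.BalancedOp F) {ι : Type*} [Fintype ι] {u : U}
    {p q : ι → U} (h : H.translation u = ∑ i, H.tmulOp (p i) (q i)) :
    H.sumTrans u F = ∑ i, F (p i) (q i) := by
  obtain ⟨L, hL⟩ := hF.exists_lift
  rw [← map_translation hL, h, map_sum]; simp only [hL]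

theorem sumTrans_add {F : U → U → N} (hF : H.BalancedOp F) (u v : U) :
    H.sumTrans (u + v) F = H.sumTrans u F + H.sumTrans v F := by
  obtain ⟨L, hL⟩ := hF.exists_lift
  simp only [← map_translation hL, translation_add, map_add]

theorem sumTrans_smul {F : U → U → N} (hF : H.BalancedOp F) (c : k) (u : U) :
    H.sumTrans (c • u) F = c • H.sumTrans u F := by
  obtain ⟨L, hL⟩ := hF.exists_lift
  simp only [← map_translation hL, translation_smul, map_smul]

theorem galois_tmulOp_eq_sumComul (p q : U) :
    H.galois (H.tmulOp p q) = H.sumComul p (fun x y => H.tmul x (y * q)) := by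
  rw [H.galois_tmulOp, H.comul_eq, map_sum]; rfl

/-- Injectivity of the Galois map: tensors in `u₊ ⊗ u₋` are compared through their images, where the
coproduct can be computed. -/
theorem sum_tmulOp_ext {ι κ : Type*} [Fintype ι] [Fintype κ] {p q : ι → U} {p' q' : κ → U}
    (h : ∑ i, H.sumComul (p i) (fun x y => H.tmul x (y * q i)) =
      ∑ j, H.sumComul (p' j) (fun x y => H.tmul x (y * q' j))) :
    ∑ i, H.tmulOp (p i) (q i) = ∑ j, H.tmulOp (p' j) (q' j) := by
  apply H.galois_bijective.1
  simpa only [map_sum, galois_tmulOp_eq_sumComul] using h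

theorem translation_eq_sum {ι : Type*} [Fintype ι] {u : U} {p q : ι → U}
    (h : ∑ i, H.sumComul (p i) (fun x y => H.tmul x (y * q i)) = H.tmul u 1) :
    H.translation u = ∑ i, H.tmulOp (p i) (q i) := by
  apply H.galois_bijective.1
  simpa only [map_sum, galois_tmulOp_eq_sumComul, galois_translation] using h.symm

/-- `u₊₍₁₎ ⊗ u₊₍₂₎ u₋ = u ⊗ 1` -/
theorem sumTrans_sumComul {F : U → U → N} (hF : H.Balanced F) (u : U) :
    H.sumTrans u (fun p q => H.sumComul p (fun x y => F x (y * q))) = F u 1 := by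
  obtain ⟨L, hL⟩ := hF.exists_lift
  have h := congrArg L (H.galois_translation u)
  rw [H.translation_eq, map_sum, map_sum, hL] at h
  rw [← h]
  refine Finset.sum_congr rfl fun i _ => ?_
  rw [galois_tmulOp_eq_sumComul, sumComul_map]; simp only [hL]

theorem sumTrans_sumComul_mul {F : U → U → N} (hF : H.Balanced F) (u v : U) :
    H.sumTrans u (fun p q => H.sumComul p (fun x y => F x (y * q * v))) = F u v := by
  simpa only [one_mul] using sumTrans_sumComul (hF.mul_right_snd v) u

/-- `u₍₁₎₊ ⊗ u₍₁₎₋ u₍₂₎ = u ⊗ 1` -/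
theorem sumComul_sumTrans {F : U → U → N} (hF : H.BalancedOp F) (u : U) :
    H.sumComul u (fun x y => H.sumTrans x (fun p q => F p (q * y))) = F u 1 := by
  obtain ⟨L, hL⟩ := hF.exists_lift
  have h : ∑ i, ∑ j, H.tmulOp (H.transFst (H.comulFst u i) j)
      (H.transSnd (H.comulFst u i) j * H.comulSnd u i) = H.tmulOp u 1 := by
    -- Both sides have the Galois image `Δ u`: on the left, `u₊₍₁₎ ⊗ u₊₍₂₎u₋ = u ⊗ 1` is applied to
    -- the factor `u₍₁₎`.
    apply H.galois_bijective.1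
    simp only [map_sum, galois_tmulOp_eq_sumComul, ← mul_assoc]
    have h₁ : H.sumComul u (fun x y => H.tmul x (y * 1)) = H.comul u := by
      simp only [mul_one]; exact (H.comul_eq u).symm
    rw [h₁, H.comul_eq]
    exact Finset.sum_congr rfl fun i _ => sumTrans_sumComul_mul balanced_tmul _ _
  have := congrArg L h
  simpa only [map_sum, hL, sumComul, sumTrans] using this

theorem sumComul_sumTrans_mul {F : U → U → N} (hF : H.BalancedOp F) (u v : U) :
    H.sumComul u (fun x y => H.sumTrans x (fun p q => F p (q * y * v))) = F u v := by
  simpa only [one_mul] using sumComul_sumTrans (hF.mul_right v) u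

/-- `u₊ ◃ a ⊗ u₋ = u₊ ⊗ a ▸ u₋` -/
theorem sumTrans_takeuchi {F : U → U → N} (hF : H.BalancedOp F) (a : A) (u : U) :
    H.sumTrans u (fun p q => F (H.t a * p) q) = H.sumTrans u (fun p q => F p (q * H.t a)) := by
  have h : ∑ i, H.tmulOp (H.t a * H.transFst u i) (H.transSnd u i) =
      ∑ i, H.tmulOp (H.transFst u i) (H.transSnd u i * H.t a) := by
    apply sum_tmulOp_ext
    simp only [sumComul_tgt_mul (balanced_tmul.mul_right_snd _)]
    have h₁ := sumTrans_sumComul ((balanced_tmul (E := H.toAeRing)).tgt_mul a) u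
    have h₂ := sumTrans_sumComul ((balanced_tmul (E := H.toAeRing)).mul_right_snd (H.t a)) u
    simp only [sumTrans, ← mul_assoc, mul_one, one_mul] at h₁ h₂ ⊢
    rw [h₁, h₂]
  obtain ⟨L, hL⟩ := hF.exists_lift
  have := congrArg L h
  simpa only [map_sum, hL, sumTrans] using this

/-- The Galois image of `u₊ ⊗ u₋s(a)` is `u ⊗ s(a) = t(a)u ⊗ 1`, which characterises the translation
of `t(a)u`. -/
theorem sumTrans_tgt_mul {F : U → U → N} (hF : H.BalancedOp F) (a : A) (u : U) :
    H.sumTrans (H.t a * u) F = H.sumTrans u (fun p q => F p (q * H.s a)) := by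
  refine sumTrans_eq hF (translation_eq_sum ?_)
  have h₁ := sumTrans_sumComul ((balanced_tmul (E := H.toAeRing)).mul_right_snd (H.s a)) u
  simp only [sumTrans, ← mul_assoc, one_mul] at h₁ ⊢
  rw [h₁, balanced_tmul.bal, mul_one]

/-- By the Takeuchi condition `u₊₍₁₎ ⊗ u₊₍₂₎s(a)u₋ = u₊₍₁₎t(a) ⊗ u₊₍₂₎u₋ = ut(a) ⊗ 1`. -/
theorem sumTrans_mul_tgt {F : U → U → N} (hF : H.BalancedOp F) (a : A) (u : U) :
    H.sumTrans (u * H.t a) F = H.sumTrans u (fun p q => F p (H.s a * q)) := by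
  refine sumTrans_eq hF (translation_eq_sum ?_)
  have h₁ := sumTrans_sumComul ((balanced_tmul (E := H.toAeRing)).mul_right_fst (H.t a)) u
  simp only [sumTrans, ← mul_assoc] at h₁ ⊢
  rw [← h₁]
  refine Finset.sum_congr rfl fun i _ => ?_
  exact (sumComul_takeuchi (balanced_tmul.mul_right_snd (H.transSnd u i)) a _).symm

theorem sumTrans_one {F : U → U → N} (hF : H.BalancedOp F) : H.sumTrans 1 F = F 1 1 := by
  have h : H.translation 1 = ∑ _i : Unit, H.tmulOp 1 1 := by
    apply translation_eq_sum
    simp [sumComul_one balanced_tmul]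
  rw [sumTrans_eq hF h]; simp

/-- `(u v)₊ ⊗ (u v)₋ = u₊ v₊ ⊗ v₋ u₋` -/
theorem sumTrans_mul {F : U → U → N} (hF : H.BalancedOp F) (u v : U) :
    H.sumTrans (u * v) F =
      H.sumTrans u (fun p q => H.sumTrans v (fun p' q' => F (p * p') (q' * q))) := by
  have h : H.translation (u * v) = ∑ ij : Fin (H.transCard u) × Fin (H.transCard v),
      H.tmulOp (H.transFst u ij.1 * H.transFst v ij.2)
        (H.transSnd v ij.2 * H.transSnd u ij.1) := by
    apply translation_eq_sum
    rw [Fintype.sum_prod_type]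
    -- The inner pair `v₊, v₋` collapses first, under left multiplication by `Δ(u₊)`; the outer pair
    -- `u₊, u₋` then collapses in the same way.
    have h₁ (i) : ∑ j, H.sumComul (H.transFst u i * H.transFst v j)
        (fun x y => H.tmul x (y * (H.transSnd v j * H.transSnd u i))) =
        H.sumComul (H.transFst u i) (fun x y => H.tmul (x * v) (y * H.transSnd u i)) := by
      have h₂ := sumTrans_sumComul (balanced_sumComul_mul
        ((balanced_tmul (E := H.toAeRing)).mul_right_snd (H.transSnd u i)) (H.transFst u i)) v
      simp only [mul_one] at h₂
      rw [← h₂]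
      refine Finset.sum_congr rfl fun j _ => ?_
      rw [sumComul_mul (balanced_tmul.mul_right_snd _)]
      simp only [sumComul]
      rw [Finset.sum_comm]
      simp only [mul_assoc]
    simp only [h₁]
    have h₂ := sumTrans_sumComul ((balanced_tmul (E := H.toAeRing)).mul_right_fst v) u
    exact h₂
  rw [sumTrans_eq hF h, Fintype.sum_prod_type]; rfl

/-- `u₊ u₋ = s(ε(u))` -/
theorem sumTrans_mul_self (u : U) : H.sumTrans u (fun p q => p * q) = H.s (H.counit u) := by
  have h := sumTrans_sumComul (balanced_counit_left (B := H.toLeftBialgebroid)) u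
  rw [mul_one] at h
  rw [← h]
  refine Finset.sum_congr rfl fun i _ => ?_
  conv_lhs => rw [← sumComul_counit_left (B := H.toLeftBialgebroid) (H.transFst u i)]
  simp only [sumComul, Finset.sum_mul, mul_assoc]

theorem balancedOp_counit : H.BalancedOp (fun p q => p * H.t (H.counit q)) where
  add_left x x' y := add_mul _ _ _
  add_right x y y' := by rw [map_add, H.t_add, mul_add]
  smul_left c x y := smul_mul_assoc _ _ _
  smul_right c x y := by rw [map_smul, H.t_smul, mul_smul_comm]
  bal a x y := by rw [H.counit_tgt_mul, H.t_mul, mul_assoc]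

/-- `ε(u₋) ▸ u₊ = u` -/
theorem sumTrans_counit (u : U) : H.sumTrans u (fun p q => p * H.t (H.counit q)) = u := by
  have h := sumTrans_sumComul (balanced_counit_right (B := H.toLeftBialgebroid)) u
  rw [H.counit_one, H.t_one, one_mul] at h
  conv_rhs => rw [← h]
  refine Finset.sum_congr rfl fun i _ => ?_
  -- After `ε(u₊₍₂₎u₋)` becomes `ε(u₊₍₂₎t(ε(u₋)))`, the coproduct is that of `u₊t(ε(u₋))`, and
  -- counitality removes it.
  simp only [H.counit_mul' _ (H.transSnd u i)]
  rw [← sumComul_mul_tgt balanced_counit_right, sumComul_counit_right]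

/-- The element `t(ε(v))` inside `ε(u₋t(ε(v)))` passes to the left of `u₊`, and `u₊t(ε(u₋)) = u`
finishes. Repeated use telescopes `ε(uⁿ₋⋯u¹₋w)`. -/
theorem sumTrans_counit_mul (u v : U) :
    H.sumTrans u (fun p q => p * H.t (H.counit (q * v))) = H.t (H.counit v) * u := by
  simp only [H.counit_mul' _ v]
  rw [← sumTrans_takeuchi balancedOp_counit]
  conv_rhs => rw [← sumTrans_counit (H := H) u]
  simp only [sumTrans, Finset.mul_sum, mul_assoc]

end LeftHopfAlgebroid

/-! ### Iterated translations -/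

namespace LeftHopfAlgebroid

open LeftBialgebroid AeRing

variable {k A U : Type*} [CommRing k] [Ring A] [Algebra k A] [Ring U] [Algebra k U]
variable {H : LeftHopfAlgebroid k A U}
variable {N : Type*} [AddCommGroup N] [Module k N]

theorem sumTrans_fun_add {N₀ : Type*} [AddCommGroup N₀] (u : U) (F G : U → U → N₀) :
    H.sumTrans u (fun p q => F p q + G p q) = H.sumTrans u F + H.sumTrans u G :=
  Finset.sum_add_distrib

theorem sumTrans_fun_smul (u : U) (c : k) (F : U → U → N) :
    H.sumTrans u (fun p q => c • F p q) = c • H.sumTrans u F := Finset.smul_sum.symm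

section Triple

variable {F : U → U → U → N}

/-- A factor `t(a)` to the right of `p` turns into `s(a)` in front of `p₋`; balancing over `A` in
the last two slots of `F` carries it to `q`. -/
theorem balancedOp_sumTrans (h₁ : ∀ x, H.Balanced (F x))
    (h₂ : ∀ y, H.BalancedOp (fun x z => F x y z)) (c d : U) :
    H.BalancedOp (fun p q => H.sumTrans p (fun p' q' => F p' (q * c) (q' * d))) where
  add_left x x' y := sumTrans_add ((h₂ _).mul_right d) _ _
  add_right x y y' := by simp only [add_mul, (h₁ _).add_left, sumTrans_fun_add]
  smul_left c x y := sumTrans_smul ((h₂ _).mul_right d) _ _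
  smul_right c x y := by simp only [smul_mul_assoc, (h₁ _).smul_left, sumTrans_fun_smul]
  bal a x y := by
    simp only [sumTrans_mul_tgt ((h₂ _).mul_right d), mul_assoc, (h₁ _).bal]

theorem balanced_sumTrans_sumTrans_right (h₁ : ∀ x, H.Balanced (F x))
    (h₂ : ∀ y, H.BalancedOp (fun x z => F x y z)) (x y z : U) :
    H.Balanced (fun w₁ w₂ => H.sumTrans x (fun p q => H.sumTrans p (fun p' q' =>
      F p' (q * (w₁ * y)) (q' * (w₂ * z))))) where
  add_left w w' v := by simp only [add_mul, mul_add, (h₁ _).add_left, sumTrans_fun_add]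
  add_right w v v' := by simp only [add_mul, mul_add, (h₁ _).add_right, sumTrans_fun_add]
  smul_left c w v := by
    simp only [smul_mul_assoc, mul_smul_comm, (h₁ _).smul_left, sumTrans_fun_smul]
  smul_right c w v := by
    simp only [smul_mul_assoc, mul_smul_comm, (h₁ _).smul_right, sumTrans_fun_smul]
  bal a w v := by
    have h := sumTrans_takeuchi (balancedOp_sumTrans h₁ h₂ (w * y) (v * z)) a x
    simp only [sumTrans_tgt_mul ((h₂ _).mul_right _), mul_assoc] at h ⊢
    exact h.symm

theorem balanced_sumTrans_sumTrans_left (h₁ : ∀ x, H.Balanced (F x))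
    (h₂ : ∀ y, H.BalancedOp (fun x z => F x y z)) (y v : U) :
    H.Balanced (fun x w => H.sumTrans x (fun p q => H.sumTrans p (fun p' q' =>
      F p' (q * (w * y)) (q' * v)))) where
  add_left w w' v := sumTrans_add (balancedOp_sumTrans h₁ h₂ _ _) _ _
  add_right w v v' := by simp only [add_mul, mul_add, (h₁ _).add_left, sumTrans_fun_add]
  smul_left c w v := sumTrans_smul (balancedOp_sumTrans h₁ h₂ _ _) _ _
  smul_right c w v := by
    simp only [smul_mul_assoc, mul_smul_comm, (h₁ _).smul_left, sumTrans_fun_smul]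
  bal a w v := by
    simp only [sumTrans_tgt_mul (balancedOp_sumTrans h₁ h₂ _ _), mul_assoc]

/-- After coassociativity, `u₍₁₎₊ ⊗ u₍₁₎₋u₍₂₎ = u ⊗ 1` is used twice, innermost first. This inverts
the double translation in `sumTrans_sumTrans`. -/
theorem sumComul_sumComul_sumTrans_sumTrans (h₁ : ∀ x, H.Balanced (F x))
    (h₂ : ∀ y, H.BalancedOp (fun x z => F x y z)) (u y z : U) :
    H.sumComul u (fun x w => H.sumComul w (fun w₁ w₂ => H.sumTrans x (fun p q =>
      H.sumTrans p (fun p' q' => F p' (q * (w₁ * y)) (q' * (w₂ * z)))))) = F u y z := by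
  rw [← sumComul_coassoc (fun x => balanced_sumTrans_sumTrans_right h₁ h₂ x y z)
    (fun w => balanced_sumTrans_sumTrans_left h₁ h₂ y (w * z))]
  have h (x w : U) := sumComul_sumTrans_mul (balancedOp_sumTrans h₁ h₂ 1 (w * z)) x y
  simp only [mul_one, mul_assoc] at h
  simp only [h]
  have h' := sumComul_sumTrans_mul (h₂ y) u z
  simpa only [mul_assoc] using h'

/-- `u₊₊ ⊗ u₋ ⊗ u₊₋ = u₊ ⊗ u₋₍₁₎ ⊗ u₋₍₂₎` -/
theorem sumTrans_sumTrans (h₁ : ∀ x, H.Balanced (F x))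
    (h₂ : ∀ y, H.BalancedOp (fun x z => F x y z)) (u : U) :
    H.sumTrans u (fun p q => H.sumTrans p (fun p' q' => F p' q q')) =
      H.sumTrans u (fun p q => H.sumComul q (F p)) := by
  have hb (x : U) := balanced_sumTrans_sumTrans_right h₁ h₂ x 1 1
  -- At `(u, 1)` the function `K(x,v) = F(x₊₊, x₋v₍₁₎, x₊₋v₍₂₎)` gives the left side. Evaluated on
  -- `u₊₍₁₎ ⊗ u₊₍₂₎u₋`, which is the same tensor, it gives the right side by the previous lemma.
  have hK : H.Balanced (fun x v => H.sumComul v (fun v₁ v₂ => H.sumTrans x (fun p q =>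
      H.sumTrans p (fun p' q' => F p' (q * (v₁ * 1)) (q' * (v₂ * 1)))))) :=
    { add_left := fun x x' v => by
        simp only [(balanced_sumTrans_sumTrans_left h₁ h₂ _ _).add_left]
        exact Finset.sum_add_distrib
      add_right := fun x v v' => sumComul_add (hb x) v v'
      smul_left := fun c x v => by
        simp only [(balanced_sumTrans_sumTrans_left h₁ h₂ _ _).smul_left]
        exact Finset.smul_sum.symm
      smul_right := fun c x v => sumComul_smul (hb x) c v
      bal := fun a x v => by
        rw [sumComul_src_mul (hb x)]
        simp only [(balanced_sumTrans_sumTrans_left h₁ h₂ _ _).bal] }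
  have h := sumTrans_sumComul hK u
  rw [sumComul_one (hb u)] at h
  simp only [mul_one] at h hb
  rw [← h]
  refine Finset.sum_congr rfl fun i _ => ?_
  have h' := sumComul_sumComul_sumTrans_sumTrans h₁ h₂ (H.transFst u i)
  simp only [sumComul_mul (hb _)]
  change _ = H.sumComul _ (fun y z => F _ y z)
  simp only [← h']
  simp only [sumComul]
  rw [Finset.sum_comm]
  refine Finset.sum_congr rfl fun j _ => Finset.sum_comm.symm.trans ?_
  rfl

end Triple

/-- `u₊₊ ⊗ u₋₊ ⊗ u₋₋ u₊₋ = u₊ ⊗ u₋ ⊗ 1` -/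
theorem sumTrans_sumTrans_sumTrans {F : U → U → U → N} (h₁ : ∀ x, H.BalancedOp (F x))
    (h₂ : ∀ z, H.BalancedOp (fun x y => F x y z)) (u : U) :
    H.sumTrans u (fun p q => H.sumTrans p (fun p' q' => H.sumTrans q (fun p'' q'' =>
      F p' p'' (q'' * q')))) = H.sumTrans u (fun p q => F p q 1) := by
  -- This turns `u₋, u₊₋` into `u₋₍₁₎, u₋₍₂₎`, so that `u₋₍₁₎₊ ⊗ u₋₍₁₎₋u₍₋₎₍₂₎` collapses to `u₋ ⊗
  -- 1`.
  rw [sumTrans_sumTrans (F := fun x y z => H.sumTrans y (fun p q => F x p (q * z)))]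
  · simp only [sumComul_sumTrans (h₁ _)]
  · exact fun x =>
      { add_left := fun y y' z => sumTrans_add ((h₁ x).mul_right z) _ _
        add_right := fun y z z' => by simp only [mul_add, (h₁ _).add_right, sumTrans_fun_add]
        smul_left := fun c y z => sumTrans_smul ((h₁ x).mul_right z) _ _
        smul_right := fun c y z => by
          simp only [mul_smul_comm, (h₁ _).smul_right, sumTrans_fun_smul]
        bal := fun a y z => by
          simp only [sumTrans_tgt_mul ((h₁ x).mul_right z), mul_assoc] }
  · exact fun y =>
      { add_left := fun x x' z => by simp only [(h₂ _).add_left, sumTrans_fun_add]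
        add_right := fun y z z' => by simp only [mul_add, (h₁ _).add_right, sumTrans_fun_add]
        smul_left := fun c y z => by simp only [(h₂ _).smul_left, sumTrans_fun_smul]
        smul_right := fun c y z => by
          simp only [mul_smul_comm, (h₁ _).smul_right, sumTrans_fun_smul]
        bal := fun a x z => by
          have h := sumTrans_takeuchi ((h₁ x).mul_right z) a y
          simp only [mul_assoc] at h
          simp only [(h₂ _).bal, h] }

end LeftHopfAlgebroid

/-! ### Cochains on lists and their evaluation on translations -/

open LeftBialgebroid AeRing

/-- A function on lists that is `k`-multilinear and balanced, `f (…, a ▸ x, y, …) =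
f (…, x, y ◃ a, …)`. -/
structure AeRing.ListBalanced {k A U : Type*} [CommRing k] [Ring A] [Algebra k A] [Ring U]
    [Algebra k U] (E : AeRing k A U) {N : Type*} [AddCommGroup N] [Module k N]
    (g : List U → N) : Prop where
  add : ∀ l x y l', g (l ++ (x + y) :: l') = g (l ++ x :: l') + g (l ++ y :: l')
  smul : ∀ l (c : k) x l', g (l ++ (c • x) :: l') = c • g (l ++ x :: l')
  bal : ∀ l x y (a : A) l', g (l ++ (x * E.t a) :: y :: l') = g (l ++ x :: (E.t a * y) :: l')

/-- A balanced multilinear function that is right `A`-linear in its first argument. -/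
structure AeRing.ListCochain {k A U : Type*} [CommRing k] [Ring A] [Algebra k A] [Ring U]
    [Algebra k U] (E : AeRing k A U) {M : Type*} [AddCommGroup M] [Module k M] [Module Aᵐᵒᵖ M]
    (g : List U → M) : Prop extends E.ListBalanced g where
  lin : ∀ (a : A) x l, g (E.t a * x :: l) = op a • g (x :: l)

/-- Multiply the first entry of a list from the left. -/
def headMul {U : Type*} [Ring U] (u : U) : List U → List U
  | [] => []
  | x :: l => u * x :: l

namespace AeRing

variable {k A U : Type*} [CommRing k] [Ring A] [Algebra k A] [Ring U] [Algebra k U]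
variable {E : AeRing k A U} {N : Type*} [AddCommGroup N] [Module k N]

theorem ListBalanced.cons {g : List U → N} (h : E.ListBalanced g) (p : U) :
    E.ListBalanced (fun l => g (p :: l)) where
  add l := h.add (p :: l)
  smul l := h.smul (p :: l)
  bal l := h.bal (p :: l)

theorem ListBalanced.add_head {g : List U → N} (h : E.ListBalanced g) (x y : U) (l : List U) :
    g ((x + y) :: l) = g (x :: l) + g (y :: l) := h.add [] x y l

theorem ListBalanced.smul_head {g : List U → N} (h : E.ListBalanced g) (c : k) (x : U)
    (l : List U) : g ((c • x) :: l) = c • g (x :: l) := h.smul [] c x l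

theorem ListBalanced.bal_head {g : List U → N} (h : E.ListBalanced g) (a : A) (x y : U)
    (l : List U) : g (x * E.t a :: y :: l) = g (x :: E.t a * y :: l) := h.bal [] x y a l

theorem ListBalanced.balancedOp {g : List U → N} (h : E.ListBalanced g) (l : List U) :
    E.BalancedOp (fun p q => g (p :: q :: l)) where
  add_left x x' y := h.add_head _ _ _
  add_right x y y' := (h.cons x).add_head _ _ _
  smul_left c x y := h.smul_head _ _ _
  smul_right c x y := (h.cons x).smul_head _ _ _
  bal a x y := h.bal_head _ _ _ _

end AeRing

namespace LeftHopfAlgebroid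

variable {k A U : Type*} [CommRing k] [Ring A] [Algebra k A] [Ring U] [Algebra k U]
variable (H : LeftHopfAlgebroid k A U)
variable {N : Type*} [AddCommGroup N] {N' : Type*} [AddCommGroup N']

/-- `g (u¹₊, …, uⁿ₊, uⁿ₋ ⋯ u¹₋ w)` -/
def transEval : (List U → N) → List U → U → N
  | g, [], w => g [w]
  | g, u :: l, w => H.sumTrans u (fun p q => transEval (fun l' => g (p :: l')) l (q * w))

variable {H}

@[simp]
theorem transEval_nil (g : List U → N) (w : U) : H.transEval g [] w = g [w] := rfl

theorem transEval_cons (g : List U → N) (u : U) (l : List U) (w : U) :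
    H.transEval g (u :: l) w =
      H.sumTrans u (fun p q => H.transEval (fun l' => g (p :: l')) l (q * w)) := rfl

theorem transEval_congr {g g' : List U → N} {l : List U} {w : U}
    (h : ∀ l', l'.length = l.length + 1 → g l' = g' l') :
    H.transEval g l w = H.transEval g' l w := by
  induction l generalizing g g' w with
  | nil => exact h _ rfl
  | cons u l ih =>
    simp only [transEval_cons]
    congr 1; ext p q
    exact ih fun l' hl' => h _ (by simp [hl'])

theorem transEval_comp (φ : N →+ N') (g : List U → N) (l : List U) (w : U) :
    H.transEval (fun l' => φ (g l')) l w = φ (H.transEval g l w) := by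
  induction l generalizing g w with
  | nil => rfl
  | cons u l ih => simp only [transEval_cons, ih, sumTrans, map_sum]

theorem transEval_add (g g' : List U → N) (l : List U) (w : U) :
    H.transEval (fun l' => g l' + g' l') l w = H.transEval g l w + H.transEval g' l w := by
  induction l generalizing g g' w with
  | nil => rfl
  | cons u l ih => simp only [transEval_cons, ih, sumTrans_fun_add]

theorem transEval_smul [Module k N] (c : k) (g : List U → N) (l : List U) (w : U) :
    H.transEval (fun l' => c • g l') l w = c • H.transEval g l w :=
  transEval_comp (DistribSMul.toAddMonoidHom N c) g l w

theorem transEval_zero (l : List U) (w : U) : H.transEval (fun _ => (0 : N)) l w = 0 :=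
  transEval_comp (0 : N →+ N) 0 l w

theorem transEval_sum {ι : Type*} (s : Finset ι) (g : ι → List U → N) (l : List U) (w : U) :
    H.transEval (fun l' => ∑ i ∈ s, g i l') l w = ∑ i ∈ s, H.transEval (g i) l w := by
  induction l generalizing g w with
  | nil => rfl
  | cons u l ih =>
    simp only [transEval_cons, ih, sumTrans]
    exact Finset.sum_comm

theorem transEval_sumTrans (u : U) (g : U → U → List U → N) (l : List U) (w : U) :
    H.transEval (fun l' => H.sumTrans u (fun p q => g p q l')) l w =
      H.sumTrans u (fun p q => H.transEval (g p q) l w) :=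
  transEval_sum _ _ _ _

variable [Module k N]

/-- The four properties need a joint induction. Moving `t(a)` from the argument to the first entry
for a list `u :: l` uses balancedness in `u₊, u₋`, and that balancedness moves `t(a)` through the
tail to the next entry of `g`. -/
theorem transEval_aux (l : List U) : ∀ {g : List U → N}, H.ListBalanced g →
    (∀ w w', H.transEval g l (w + w') = H.transEval g l w + H.transEval g l w') ∧
    (∀ (c : k) w, H.transEval g l (c • w) = c • H.transEval g l w) ∧
    (∀ (a : A) w, H.transEval g l (H.t a * w) =
      H.transEval (fun l' => g (headMul (H.t a) l')) l w) ∧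
    ∀ w, H.BalancedOp (fun p q => H.transEval (fun l' => g (p :: l')) l (q * w)) := by
  induction l with
  | nil =>
    intro g hg
    exact ⟨fun w w' => hg.add_head _ _ _, fun c w => hg.smul_head _ _ _, fun a w => rfl,
      fun w => (hg.balancedOp []).mul_right w⟩
  | cons u l ih =>
    intro g hg
    have hadd (g' : List U → N) (hg' : H.ListBalanced g') (w w' : U) :
        H.transEval g' (u :: l) (w + w') =
          H.transEval g' (u :: l) w + H.transEval g' (u :: l) w' := by
      simp only [transEval_cons, mul_add, (ih (hg'.cons _)).1, sumTrans_fun_add]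
    have hsmul (g' : List U → N) (hg' : H.ListBalanced g') (c : k) (w : U) :
        H.transEval g' (u :: l) (c • w) = c • H.transEval g' (u :: l) w := by
      simp only [transEval_cons, mul_smul_comm, (ih (hg'.cons _)).2.1, sumTrans_fun_smul]
    have htgt (g' : List U → N) (hg' : H.ListBalanced g') (a : A) (w : U) :
        H.transEval g' (u :: l) (H.t a * w) =
          H.transEval (fun l' => g' (headMul (H.t a) l')) (u :: l) w := by
      have h := sumTrans_takeuchi ((ih hg').2.2.2 w) a u
      simp only [transEval_cons, ← mul_assoc]
      exact h.symm
    refine ⟨hadd g hg, hsmul g hg, htgt g hg, fun w => ?_⟩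
    exact
      { add_left := fun x x' y => by simp only [hg.add_head, transEval_add]
        add_right := fun x y y' => by simp only [add_mul, hadd _ (hg.cons _)]
        smul_left := fun c x y => by simp only [hg.smul_head, transEval_smul]
        smul_right := fun c x y => by simp only [smul_mul_assoc, hsmul _ (hg.cons _)]
        bal := fun a x y => by
          rw [mul_assoc, htgt _ (hg.cons _)]
          refine transEval_congr fun l' hl' => ?_
          cases l' with
          | nil => simp at hl'
          | cons z l' => exact hg.bal_head a x z l' }

section

variable {g : List U → N}

theorem transEval_add_right (hg : H.ListBalanced g) (l : List U) (w w' : U) :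
    H.transEval g l (w + w') = H.transEval g l w + H.transEval g l w' :=
  (transEval_aux l hg).1 w w'

theorem transEval_smul_right (hg : H.ListBalanced g) (l : List U) (c : k) (w : U) :
    H.transEval g l (c • w) = c • H.transEval g l w :=
  (transEval_aux l hg).2.1 c w

theorem transEval_tgt_mul (hg : H.ListBalanced g) (l : List U) (a : A) (w : U) :
    H.transEval g l (H.t a * w) = H.transEval (fun l' => g (headMul (H.t a) l')) l w :=
  (transEval_aux l hg).2.2.1 a w

theorem balancedOp_transEval (hg : H.ListBalanced g) (l : List U) (w : U) :
    H.BalancedOp (fun p q => H.transEval (fun l' => g (p :: l')) l (q * w)) :=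
  (transEval_aux l hg).2.2.2 w

theorem transEval_tgt_mul_cons (hg : H.ListBalanced g) (a : A) (u : U) (l : List U) (w : U) :
    H.transEval g (H.t a * u :: l) w = H.transEval g (u :: l) (H.s a * w) := by
  simp only [transEval_cons, sumTrans_tgt_mul (balancedOp_transEval hg l w), mul_assoc]

/-- Both sides insert `s(a)` between `y₋` and `x₋`: on the left it comes from `(xt(a))₋`, on the
right from `(t(a)y)₋`. -/
theorem transEval_bal (hg : H.ListBalanced g) (a : A) (x y : U) (l : List U) (w : U) :
    H.transEval g (x * H.t a :: y :: l) w = H.transEval g (x :: H.t a * y :: l) w := by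
  rw [transEval_cons, sumTrans_mul_tgt (balancedOp_transEval hg (y :: l) w), transEval_cons]
  simp only [transEval_tgt_mul_cons (hg.cons _), mul_assoc]

theorem listBalanced_transEval (hg : H.ListBalanced g) (w : U) :
    H.ListBalanced (fun l => H.transEval g l w) where
  add l x y l' := by
    induction l generalizing g w with
    | nil => exact sumTrans_add (balancedOp_transEval hg l' w) x y
    | cons u l ih => simp only [List.cons_append, transEval_cons, ih (hg.cons _), sumTrans_fun_add]
  smul l c x l' := by
    induction l generalizing g w with
    | nil => exact sumTrans_smul (balancedOp_transEval hg l' w) c x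
    | cons u l ih => simp only [List.cons_append, transEval_cons, ih (hg.cons _), sumTrans_fun_smul]
  bal l x y a l' := by
    induction l generalizing g w with
    | nil => exact transEval_bal hg a x y l' w
    | cons u l ih => simp only [List.cons_append, transEval_cons, ih (hg.cons _)]

end

end LeftHopfAlgebroid

open LeftBialgebroid AeRing

/-! ### Products, insertions and the counit on lists, and their interaction with translations -/

section Operations

variable {U N : Type*} [Ring U] [AddCommGroup N]

/-- `g (…, xʲ xʲ⁺¹, …)`, with positions counted from `0`. -/
def contract : ℕ → (List U → N) → List U → N
  | 0, g, x :: y :: l => g (x * y :: l)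
  | j + 1, g, x :: l => contract j (fun l' => g (x :: l')) l
  | _, _, _ => 0

/-- `g (…, 1, xʲ, …)`, with positions counted from `0`. -/
def insertOne : ℕ → (List U → N) → List U → N
  | 0, g, l => g (1 :: l)
  | j + 1, g, x :: l => insertOne j (fun l' => g (x :: l')) l
  | _ + 1, _, [] => 0

theorem contract_sum {ι : Type*} (s : Finset ι) (j : ℕ) (g : ι → List U → N) (l : List U) :
    contract j (fun l' => ∑ i ∈ s, g i l') l = ∑ i ∈ s, contract j (g i) l := by
  induction j generalizing g l with
  | zero => rcases l with _ | ⟨x, _ | ⟨y, l⟩⟩ <;> simp [contract]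
  | succ j ih => rcases l with _ | ⟨x, l⟩ <;> simp [contract, ih]

theorem insertOne_sum {ι : Type*} (s : Finset ι) (j : ℕ) (g : ι → List U → N) (l : List U) :
    insertOne j (fun l' => ∑ i ∈ s, g i l') l = ∑ i ∈ s, insertOne j (g i) l := by
  induction j generalizing g l with
  | zero => simp [insertOne]
  | succ j ih => rcases l with _ | ⟨x, l⟩ <;> simp [insertOne, ih]

theorem insertOne_length (g : List U → N) (l : List U) :
    insertOne l.length g l = g (l ++ [1]) := by
  induction l generalizing g with
  | nil => rfl
  | cons x l ih => simp only [List.length_cons, insertOne, ih, List.cons_append]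

end Operations

namespace LeftBialgebroid

variable {k A U : Type*} [CommRing k] [Ring A] [Algebra k A] [Ring U] [Algebra k U]
variable (B : LeftBialgebroid k A U) {N : Type*} [AddCommGroup N]

/-- `g (x⁰, …, ε(xⁿ⁺¹) ▸ xⁿ)` -/
def contractEnd : (List U → N) → List U → N
  | g, [x, y] => g [x * B.t (B.counit y)]
  | g, x :: y :: z :: l => contractEnd (fun l' => g (x :: l')) (y :: z :: l)
  | _, _ => 0

theorem contractEnd_sum {ι : Type*} (s : Finset ι) (g : ι → List U → N) (l : List U) :
    B.contractEnd (fun l' => ∑ i ∈ s, g i l') l = ∑ i ∈ s, B.contractEnd (g i) l := by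
  induction l generalizing g with
  | nil => simp [contractEnd]
  | cons x l ih =>
    rcases l with _ | ⟨y, _ | ⟨z, l⟩⟩
    · simp [contractEnd]
    · simp [contractEnd]
    · simp only [contractEnd, ih]

end LeftBialgebroid

namespace LeftHopfAlgebroid

variable {k A U : Type*} [CommRing k] [Ring A] [Algebra k A] [Ring U] [Algebra k U]
variable {H : LeftHopfAlgebroid k A U}
variable {N : Type*} [AddCommGroup N] [Module k N]

theorem _root_.HopfAlgebroid.AeRing.ListBalanced.map_sumTrans {g : List U → N}
    (hg : H.ListBalanced g) (u : U) (F : U → U → U) (l : List U) :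
    g (H.sumTrans u F :: l) = H.sumTrans u (fun p q => g (F p q :: l)) :=
  map_sum (AddMonoidHom.mk' (fun x => g (x :: l)) fun x y => hg.add_head x y l) _ _

/-- Here `(uv)₊ ⊗ (uv)₋ = u₊v₊ ⊗ v₋u₋` does the work; the bound on `j` keeps the product away from
the last slot of `g`, which is not a `uⁱ₊`. -/
theorem transEval_contract {g : List U → N} (hg : H.ListBalanced g) {j : ℕ} {l : List U}
    (hj : j + 2 ≤ l.length) (w : U) :
    H.transEval (contract j g) l w = contract j (fun l' => H.transEval g l' w) l := by
  induction j generalizing g l w with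
  | zero =>
    rcases l with _ | ⟨u, _ | ⟨v, l⟩⟩
    · simp at hj
    · simp at hj
    · simp only [contract, transEval_cons]
      rw [sumTrans_mul (balancedOp_transEval hg l w)]
      simp only [mul_assoc]
  | succ j ih =>
    rcases l with _ | ⟨u, l⟩
    · simp at hj
    · simp only [contract, transEval_cons]
      simp only [List.length_cons] at hj
      simp only [ih (hg.cons _) (show j + 2 ≤ l.length by omega), sumTrans]
      exact (contract_sum _ _ _ _).symm

theorem transEval_contract_zero {g : List U → N} (hg : H.ListBalanced g) (u w : U) :
    H.transEval (contract 0 g) [u] w = g [H.s (H.counit u) * w] := by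
  simp only [transEval_cons, contract, transEval_nil, ← mul_assoc]
  rw [← sumTrans_mul_self]
  have h := hg.map_sumTrans u (fun p q => p * q * w) []
  rw [← h]; simp only [sumTrans, Finset.sum_mul]

/-- The product with the last slot is `uⁿ₊uⁿ₋⋯ = s(ε(uⁿ))⋯`. This factor `s(ε(uⁿ))` stands in front
of `uⁿ⁻¹₋`, so it is the trace of replacing `uⁿ⁻¹` by `uⁿ⁻¹t(ε(uⁿ))`. -/
theorem transEval_contract_last {g : List U → N} (hg : H.ListBalanced g) (u v : U) (l : List U)
    (w : U) :
    H.transEval (contract (l.length + 1) g) (u :: v :: l) w =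
      H.contractEnd (fun l' => H.transEval g l' w) (u :: v :: l) := by
  induction l generalizing g u v w with
  | nil =>
    rw [transEval_cons]
    simp only [List.length_nil, contract, contractEnd]
    rw [transEval_cons, sumTrans_mul_tgt (balancedOp_transEval hg [] w)]
    simp only [transEval_contract_zero (hg.cons _), transEval_nil, mul_assoc]
  | cons z l ih =>
    rw [transEval_cons]
    simp only [List.length_cons, contract, contractEnd] at ih ⊢
    simp only [ih (hg.cons _), transEval_cons _ u]
    exact (contractEnd_sum _ _ _ _).symm

/-- The factor `t(ε(uⁿ₋⋯u¹₋w))` travels to the left: at each entry `sumTrans_counit_mul` removes one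
`uⁱ₋`, and balancedness passes the rest to the preceding entry. -/
theorem transEval_contractEnd {g : List U → N} (hg : H.ListBalanced g) (u : U) (l : List U)
    (w : U) :
    H.transEval (H.contractEnd g) (u :: l) w = g (H.t (H.counit w) * u :: l) := by
  induction l generalizing g u w with
  | nil =>
    simp only [transEval_cons, contractEnd, transEval_nil]
    rw [← sumTrans_counit_mul, hg.map_sumTrans]
  | cons v l ih =>
    rw [transEval_cons]
    have h (p q : U) : H.transEval (fun l' => H.contractEnd g (p :: l')) (v :: l) (q * w) =
        g (p * H.t (H.counit (q * w)) :: v :: l) := by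
      rw [hg.bal_head, ← ih (hg.cons p)]
      refine transEval_congr fun l' hl' => ?_
      rcases l' with _ | ⟨x, _ | ⟨y, l'⟩⟩
      · simp at hl'
      · simp at hl'
      · rfl
    simp only [h]
    rw [← sumTrans_counit_mul, hg.map_sumTrans]

theorem transEval_insertOne {g : List U → N} (hg : H.ListBalanced g) {j : ℕ} {l : List U}
    (hj : j ≤ l.length) (w : U) :
    H.transEval (insertOne j g) l w = insertOne j (fun l' => H.transEval g l' w) l := by
  induction j generalizing g l w with
  | zero =>
    simp only [insertOne, transEval_cons]
    rw [sumTrans_one (balancedOp_transEval hg l w), one_mul]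
  | succ j ih =>
    rcases l with _ | ⟨u, l⟩
    · simp at hj
    · simp only [insertOne, transEval_cons]
      simp only [List.length_cons] at hj
      simp only [ih (hg.cons _) (show j ≤ l.length by omega), sumTrans]
      exact (insertOne_sum _ _ _ _).symm

theorem balanced_transEval_transEval {g : List U → N} (hg : H.ListBalanced g) (l : List U) :
    H.Balanced (fun w' w => H.transEval (fun l' => H.transEval g l' w) l w') where
  add_left x x' y := transEval_add_right (listBalanced_transEval hg y) l x x'
  add_right x y y' := by simp only [transEval_add_right hg, transEval_add]
  smul_left c x y := transEval_smul_right (listBalanced_transEval hg y) l c x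
  smul_right c x y := by simp only [transEval_smul_right hg, transEval_smul]
  bal a x y := by
    rw [transEval_tgt_mul (listBalanced_transEval hg y)]
    refine transEval_congr fun l' hl' => ?_
    rcases l' with _ | ⟨z, l'⟩
    · simp at hl'
    · exact transEval_tgt_mul_cons hg a z l' y

theorem balancedOp_transEval_transEval {g : List U → N} (hg : H.ListBalanced g) (l : List U)
    (w' : U) :
    H.BalancedOp (fun p w => H.transEval (fun l' => H.transEval (fun l'' => g (p :: l'')) l' w)
      l w') where
  add_left x x' y := by simp only [hg.add_head, transEval_add]
  add_right x y y' := by simp only [transEval_add_right (hg.cons _), transEval_add]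
  smul_left c x y := by simp only [hg.smul_head, transEval_smul]
  smul_right c x y := by simp only [transEval_smul_right (hg.cons _), transEval_smul]
  bal a x y := by
    refine transEval_congr fun l' _ => ?_
    simpa only [mul_one] using (balancedOp_transEval hg l' 1).bal a x y

/-- For the empty list this is `w₍₁₎₊ ⊗ w₍₁₎₋w₍₂₎ = w ⊗ 1`. Each further entry contributes `u₊₊, u₋,
u₊₋`, which equals `u₊, u₋₍₁₎, u₋₍₂₎`, and these coproducts multiply to `Δ(u₋w)`. It prepares the
computation of `τ²`. -/
theorem transEval_append_one {g : List U → N} (hg : H.ListBalanced g) (l : List U) (w : U) :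
    H.transEval (fun l' => g (l' ++ [1])) l w =
      H.sumComul w (fun w₁ w₂ => H.transEval (fun l' => H.transEval g l' w₂) l w₁) := by
  induction l generalizing g w with
  | nil => exact (sumComul_sumTrans (hg.balancedOp []) w).symm
  | cons u l ih =>
    have h (w₁ w₂ : U) : H.transEval (fun l' => H.transEval g l' w₂) (u :: l) w₁ =
        H.sumTrans u (fun p q => H.sumComul q (fun q₁ q₂ => H.transEval (fun l' =>
          H.transEval (fun l'' => g (p :: l'')) l' (q₂ * w₂)) l (q₁ * w₁))) := by
      rw [← sumTrans_sumTrans (F := fun p q₁ q₂ => H.transEval (fun l' =>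
          H.transEval (fun l'' => g (p :: l'')) l' (q₂ * w₂)) l (q₁ * w₁))
          (fun p => (balanced_transEval_transEval (hg.cons p) l).mul_right w₁ w₂)
          (fun y => (balancedOp_transEval_transEval hg l (y * w₁)).mul_right w₂)]
      simp only [transEval_cons, transEval_sumTrans]
    simp only [h]
    rw [transEval_cons]
    simp only [List.cons_append, ih (hg.cons _),
      sumComul_mul (balanced_transEval_transEval (hg.cons _) l)]
    simp only [sumTrans, sumComul]
    rw [Finset.sum_comm]
    exact Finset.sum_congr rfl fun i _ => Finset.sum_comm

end LeftHopfAlgebroid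

open LeftBialgebroid AeRing LeftHopfAlgebroid

/-! ### The contraaction on functions -/

section

variable {k A U : Type*} [CommRing k] [Ring A] [Algebra k A] [Ring U] [Algebra k U]
variable {M : Type*} [AddCommGroup M] [Module k M] [Module Aᵐᵒᵖ M] [IsScalarTower k Aᵐᵒᵖ M]

/-- The function `φ` is an element of `Hom_{Aᵒᵖ}(U_◃, M)`. -/
structure AeRing.IsHomOp (E : AeRing k A U) (φ : U → M) : Prop where
  add : ∀ x y, φ (x + y) = φ x + φ y
  smul : ∀ (c : k) x, φ (c • x) = c • φ x
  tgt : ∀ (a : A) x, φ (E.t a * x) = op a • φ x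

theorem AeRing.IsHomOp.exists_eq {E : AeRing k A U} {φ : U → M} (h : E.IsHomOp φ) :
    ∃ F : E.homOp M, (F.1 : U → M) = φ :=
  ⟨⟨⟨⟨φ, h.add⟩, h.smul⟩, h.tgt⟩, rfl⟩

theorem AeRing.IsHomOp.sum {E : AeRing k A U} {ι : Type*} (s : Finset ι) {φ : ι → U → M}
    (h : ∀ i, E.IsHomOp (φ i)) : E.IsHomOp (fun w => ∑ i ∈ s, φ i w) where
  add x y := by simp only [(h _).add, Finset.sum_add_distrib]
  smul c x := by simp only [(h _).smul, Finset.smul_sum]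
  tgt a x := by simp only [(h _).tgt, Finset.smul_sum]

namespace Contramodule

variable {B : LeftBialgebroid k A U} (C : Contramodule B M)

open Classical in
/-- The contraaction, extended by zero to all functions `U → M`. -/
def contra (φ : U → M) : M :=
  if h : ∃ F : B.homOp M, (F.1 : U → M) = φ then C.γ h.choose else 0

theorem contra_coe (F : B.homOp M) : C.contra F.1 = C.γ F := by
  have h : ∃ F' : B.homOp M, (F'.1 : U → M) = F.1 := ⟨F, rfl⟩
  have h' : h.choose = F := Subtype.ext (DFunLike.coe_injective h.choose_spec)
  rw [contra, dif_pos h, h']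

theorem contra_add {φ ψ : U → M} (hφ : B.IsHomOp φ) (hψ : B.IsHomOp ψ) :
    C.contra (fun w => φ w + ψ w) = C.contra φ + C.contra ψ := by
  obtain ⟨F, rfl⟩ := hφ.exists_eq
  obtain ⟨G, rfl⟩ := hψ.exists_eq
  rw [contra_coe, contra_coe, ← map_add, ← contra_coe]; rfl

theorem contra_smul (c : k) {φ : U → M} (hφ : B.IsHomOp φ) :
    C.contra (fun w => c • φ w) = c • C.contra φ := by
  obtain ⟨F, rfl⟩ := hφ.exists_eq
  rw [contra_coe, ← map_smul, ← contra_coe]; rfl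

theorem contra_zero : C.contra (fun _ => 0) = 0 :=
  (C.contra_coe 0).trans (map_zero _)

theorem contra_sum {ι : Type*} (s : Finset ι) {φ : ι → U → M} (h : ∀ i, B.IsHomOp (φ i)) :
    C.contra (fun w => ∑ i ∈ s, φ i w) = ∑ i ∈ s, C.contra (φ i) := by
  classical
  induction s using Finset.induction_on with
  | empty => simpa using C.contra_zero
  | insert i s hi ih =>
    simp only [Finset.sum_insert hi]
    rw [C.contra_add (h i) (AeRing.IsHomOp.sum s h), ih]

theorem contra_src_mul (a : A) {φ : U → M} (hφ : B.IsHomOp φ) :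
    C.contra (fun w => φ (B.s a * w)) = op a • C.contra φ := by
  obtain ⟨F, rfl⟩ := hφ.exists_eq
  rw [contra_coe, ← C.γ_act, ← contra_coe]; rfl

theorem contra_counit (m : M) : C.contra (fun w => op (B.counit w) • m) = m :=
  (C.contra_coe (B.counitHom m)).trans (C.γ_unit m)

theorem isHomOp_sumComul {g : U → U → M} (hg : B.Balanced g)
    (hg' : ∀ (a : A) u v, g u (B.t a * v) = op a • g u v) :
    B.IsHomOp (fun u => B.sumComul u g) where
  add x y := sumComul_add hg x y
  smul c x := sumComul_smul hg c x
  tgt a x := by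
    rw [sumComul_tgt_mul hg]; simp only [hg']
    exact Finset.smul_sum.symm

theorem isHomOp_of_balanced {g : U → U → M} (hg : B.Balanced g)
    (hg' : ∀ (a : A) u v, g u (B.t a * v) = op a • g u v) (u : U) : B.IsHomOp (g u) :=
  ⟨hg.add_right u, fun c => hg.smul_right c u, fun a => hg' a u⟩

/-- Right linearity in the outer variable: `t(a)` on the first tensor factor is `s(a)` on the
second, and `γ(f(s(a)-)) = γ(f)a`. -/
theorem isHomOp_contra {g : U → U → M} (hg : B.Balanced g)
    (hg' : ∀ (a : A) u v, g u (B.t a * v) = op a • g u v) :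
    B.IsHomOp (fun u => C.contra (g u)) where
  add x y := by
    rw [← C.contra_add (isHomOp_of_balanced hg hg' x) (isHomOp_of_balanced hg hg' y)]
    exact congrArg C.contra (funext fun v => hg.add_left x y v)
  smul c x := by
    rw [← C.contra_smul c (isHomOp_of_balanced hg hg' x)]
    exact congrArg C.contra (funext fun v => hg.smul_left c x v)
  tgt a x := by
    rw [← C.contra_src_mul a (isHomOp_of_balanced hg hg' x)]
    exact congrArg C.contra (funext fun v => hg.bal a x v)

theorem contra_contra {g : U → U → M} (hg : B.Balanced g)
    (hg' : ∀ (a : A) u v, g u (B.t a * v) = op a • g u v) :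
    C.contra (fun u => C.contra (g u)) = C.contra (fun u => B.sumComul u g) := by
  obtain ⟨L, hL⟩ := hg.exists_lift
  obtain ⟨φ, hφ⟩ := (C.isHomOp_contra hg hg').exists_eq
  obtain ⟨χ, hχ⟩ := (isHomOp_sumComul hg hg').exists_eq
  choose ψ hψ using fun u => (isHomOp_of_balanced hg hg' u).exists_eq
  rw [← hφ, ← hχ, contra_coe, contra_coe]
  refine C.γ_assoc L (fun a u v => by rw [hL, hL, hg']) ψ φ χ (fun u v => by rw [hψ, hL])
    (fun u => ?_) (fun u => ?_)
  · rw [← contra_coe, hψ, hφ]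
  · rw [hχ, map_comul hL]

end Contramodule

end

section Operations

variable {U N N' : Type*} [Ring U] [AddCommGroup N] [AddCommGroup N']

/-- The condition `hφ` covers lists that are too short, where `contract` has the default value zero.
-/
theorem contract_map (φ : (U → N) → N') (hφ : φ (fun _ => 0) = 0) (j : ℕ) (h : List U → U → N)
    (l : List U) : contract j (fun l' => φ (h l')) l = φ (fun w => contract j (h · w) l) := by
  induction j generalizing h l with
  | zero => rcases l with _ | ⟨x, _ | ⟨y, l⟩⟩ <;> simp [contract, hφ]
  | succ j ih =>
    rcases l with _ | ⟨x, l⟩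
    · simp [contract, hφ]
    · exact ih (fun l' => h (x :: l')) l

theorem insertOne_map (φ : (U → N) → N') (hφ : φ (fun _ => 0) = 0) (j : ℕ) (h : List U → U → N)
    (l : List U) : insertOne j (fun l' => φ (h l')) l = φ (fun w => insertOne j (h · w) l) := by
  induction j generalizing h l with
  | zero => simp [insertOne]
  | succ j ih =>
    rcases l with _ | ⟨x, l⟩
    · simp [insertOne, hφ]
    · exact ih (fun l' => h (x :: l')) l

theorem _root_.HopfAlgebroid.LeftBialgebroid.contractEnd_map {k A : Type*} [CommRing k] [Ring A]
    [Algebra k A] [Algebra k U] (B : LeftBialgebroid k A U)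
    (φ : (U → N) → N') (hφ : φ (fun _ => 0) = 0) (h : List U → U → N)
    (l : List U) : B.contractEnd (fun l' => φ (h l')) l = φ (fun w => B.contractEnd (h · w) l) := by
  induction l generalizing h with
  | nil => simp [contractEnd, hφ]
  | cons x l ih =>
    rcases l with _ | ⟨y, _ | ⟨z, l⟩⟩
    · simp [contractEnd, hφ]
    · simp [contractEnd]
    · exact ih (fun l' => h (x :: l'))

end Operations

/-! ### The cyclic evaluation and its compatibilities -/

section Cyclic

variable {k A U : Type*} [CommRing k] [Ring A] [Algebra k A] [Ring U] [Algebra k U]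
variable {H : LeftHopfAlgebroid k A U}
variable {M : Type*} [AddCommGroup M] [Module k M] [Module Aᵐᵒᵖ M] [IsScalarTower k Aᵐᵒᵖ M]

theorem isHomOp_transEval {g : List U → M} (hg : H.ListCochain g) (l : List U) :
    H.IsHomOp (H.transEval g l) where
  add := transEval_add_right hg.toListBalanced l
  smul := transEval_smul_right hg.toListBalanced l
  tgt a w := by
    rw [transEval_tgt_mul hg.toListBalanced]
    refine Eq.trans (transEval_congr fun l' hl' => ?_)
      (transEval_comp (DistribSMul.toAddMonoidHom M (op a)) g l w)
    rcases l' with _ | ⟨z, l'⟩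
    · simp at hl'
    · exact hg.lin a z l'

variable (C : Contramodule H.toLeftBialgebroid M)

/-- Only finite sums are exchanged with the contraaction. Membership in the domain of `γ` is proved
alongside, since additivity of `contra` requires it. -/
theorem transEval_contra {h : List U → U → M} (hh : ∀ l, H.IsHomOp (h l)) (l : List U) (v : U) :
    H.IsHomOp (fun w => H.transEval (h · w) l v) ∧
    H.transEval (fun l' => C.contra (h l')) l v = C.contra (fun w => H.transEval (h · w) l v) := by
  induction l generalizing h v with
  | nil => exact ⟨hh [v], rfl⟩
  | cons u l ih =>
    have h₁ (p q : U) := ih (fun l' => hh (p :: l')) (q * v)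
    refine ⟨AeRing.IsHomOp.sum Finset.univ (φ := fun i w => H.transEval
      (fun l' => h (H.transFst u i :: l') w) l (H.transSnd u i * v)) fun i => (h₁ _ _).1, ?_⟩
    simp only [transEval_cons, h₁]
    exact (C.contra_sum _ fun i => (h₁ _ _).1).symm

/-- The function `γ (g (u¹₊, …, uⁿ₊, uⁿ₋ ⋯ u¹₋ (-)))` of `u¹, …, uⁿ`, which has one argument less
than `g`. -/
def contraEval (g : List U → M) (l : List U) : M := C.contra (H.transEval g l)

variable {g : List U → M}

theorem listCochain_contraEval (hg : H.ListCochain g) : H.ListCochain (contraEval C g) where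
  add l x y l' := by
    rw [contraEval, contraEval, contraEval,
      ← C.contra_add (isHomOp_transEval hg _) (isHomOp_transEval hg _)]
    exact congrArg C.contra (funext fun w =>
      (listBalanced_transEval hg.toListBalanced w).add l x y l')
  smul l c x l' := by
    rw [contraEval, contraEval, ← C.contra_smul _ (isHomOp_transEval hg _)]
    exact congrArg C.contra (funext fun w =>
      (listBalanced_transEval hg.toListBalanced w).smul l c x l')
  bal l x y a l' := congrArg C.contra (funext fun w =>
      (listBalanced_transEval hg.toListBalanced w).bal l x y a l')
  lin a x l := by
    rw [contraEval, contraEval, ← C.contra_src_mul _ (isHomOp_transEval hg _)]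
    exact congrArg C.contra (funext fun w => transEval_tgt_mul_cons hg.toListBalanced a x l w)

/-- Telescoping leaves `γ(g(u,…) ε(-))`, and contraunitality applies; this is `τδ_0 = δ_{n+1}`. -/
theorem contraEval_contractEnd (hg : H.ListCochain g) (u : U) (l : List U) :
    contraEval C (H.contractEnd g) (u :: l) = g (u :: l) := by
  conv_rhs => rw [← C.contra_counit (g (u :: l))]
  refine congrArg C.contra (funext fun w => ?_)
  rw [transEval_contractEnd hg.toListBalanced, hg.lin]

theorem contraEval_contract (hg : H.ListCochain g) {j : ℕ} {l : List U} (hj : j + 2 ≤ l.length) :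
    contraEval C (contract j g) l = contract j (contraEval C g) l :=
  (congrArg C.contra (funext fun w => transEval_contract hg.toListBalanced hj w)).trans
    (contract_map C.contra C.contra_zero j (H.transEval g) l).symm

theorem contraEval_contract_last (hg : H.ListCochain g) (u v : U) (l : List U) :
    contraEval C (contract (l.length + 1) g) (u :: v :: l) =
      H.contractEnd (contraEval C g) (u :: v :: l) :=
  (congrArg C.contra (funext fun w =>
    transEval_contract_last hg.toListBalanced u v l w)).trans
    (contractEnd_map _ C.contra C.contra_zero (H.transEval g) _).symm

theorem contraEval_contract_zero (hg : H.ListCochain g) (u : U) :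
    contraEval C (contract 0 g) [u] = op (H.counit u) • contraEval C g [] := by
  rw [contraEval, contraEval, ← C.contra_src_mul _ (isHomOp_transEval hg _)]
  exact congrArg C.contra (funext fun w => transEval_contract_zero hg.toListBalanced u w)

theorem contraEval_insertOne (hg : H.ListCochain g) {j : ℕ} {l : List U} (hj : j ≤ l.length) :
    contraEval C (insertOne j g) l = insertOne j (contraEval C g) l :=
  (congrArg C.contra (funext fun w => transEval_insertOne hg.toListBalanced hj w)).trans
    (insertOne_map C.contra C.contra_zero j (H.transEval g) l).symm

/-- Contraassociativity merges the two contraactions into one with the arguments `w₍₁₎, w₍₂₎`, which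
`transEval_append_one` evaluates. -/
theorem contraEval_contraEval (hg : H.ListCochain g) (l : List U) :
    contraEval C (contraEval C g) l = contraEval C (fun l' => g (l' ++ [1])) l := by
  have h : H.transEval (contraEval C g) l =
      fun v => C.contra (fun w => H.transEval (fun l' => H.transEval g l' w) l v) :=
    funext fun v => (transEval_contra C (isHomOp_transEval hg) l v).2
  rw [contraEval, h, C.contra_contra (balanced_transEval_transEval hg.toListBalanced l)
    fun a u v => (transEval_contra C (isHomOp_transEval hg) l u).1.tgt a v]
  exact congrArg C.contra (funext fun w => (transEval_append_one hg.toListBalanced l w).symm)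

theorem contraEval_congr {g' : List U → M} {l : List U}
    (h : ∀ l', l'.length = l.length + 1 → g l' = g' l') : contraEval C g l = contraEval C g' l :=
  congrArg C.contra (funext fun _ => transEval_congr h)

theorem contraEval_add {g' : List U → M} (hg : H.ListCochain g) (hg' : H.ListCochain g')
    (l : List U) :
    contraEval C (fun l' => g l' + g' l') l = contraEval C g l + contraEval C g' l := by
  rw [contraEval, contraEval, contraEval,
    ← C.contra_add (isHomOp_transEval hg l) (isHomOp_transEval hg' l)]
  exact congrArg C.contra (funext fun w => transEval_add _ _ _ _)

theorem contraEval_smul (hg : H.ListCochain g) (c : k) (l : List U) :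
    contraEval C (fun l' => c • g l') l = c • contraEval C g l := by
  rw [contraEval, contraEval, ← C.contra_smul c (isHomOp_transEval hg l)]
  exact congrArg C.contra (funext fun w => transEval_smul _ _ _ _)

end Cyclic

/-! ### The module action as an extra first argument -/

section Extend

variable {k A U : Type*} [CommRing k] [Ring A] [Algebra k A] [Ring U] [Algebra k U]
variable {E : AeRing k A U}
variable {M : Type*} [AddCommGroup M] [Module k M] [Module Aᵐᵒᵖ M] [IsScalarTower k Aᵐᵒᵖ M]
  [Module U M] [IsScalarTower k U M]

/-- `f̂ (u⁰, u¹, …, uⁿ) = u⁰ f (u¹, …, uⁿ)` -/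
def actHead (f : List U → M) : List U → M
  | [] => 0
  | u :: l => u • f l

theorem listCochain_actHead (hM : ∀ (a : A) (m : M), E.t a • m = op a • m) {f : List U → M}
    (hf : E.ListCochain f) : E.ListCochain (actHead f) where
  add l x y l' := by
    rcases l with _ | ⟨u, l⟩
    · exact add_smul _ _ _
    · exact (congrArg (u • ·) (hf.add l x y l')).trans (smul_add _ _ _)
  smul l c x l' := by
    rcases l with _ | ⟨u, l⟩
    · exact smul_assoc _ _ _
    · exact (congrArg (u • ·) (hf.smul l c x l')).trans (smul_comm _ _ _)
  bal l x y a l' := by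
    rcases l with _ | ⟨u, l⟩
    · simp only [List.nil_append, actHead, mul_smul, hf.lin, hM]
    · exact congrArg (u • ·) (hf.bal l x y a l')
  lin a x l := by simp only [actHead, mul_smul, hM]

theorem actHead_headMul (f : List U → M) (u : U) (l : List U) :
    actHead f (headMul u l) = u • actHead f l := by
  rcases l with _ | ⟨x, l⟩
  · exact (smul_zero _).symm
  · exact mul_smul _ _ _

end Extend

open LeftBialgebroid AeRing LeftHopfAlgebroid

/-! ### Galois coordinates -/

section GaloisForm

variable {k A U : Type*} [CommRing k] [Ring A] [Algebra k A] [Ring U] [Algebra k U]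
variable (H : LeftHopfAlgebroid k A U)
variable {N : Type*} [AddCommGroup N]

/-- `g (v₊, v₋ x, …)` as a function of `x, …`. -/
def transHead (v : U) (g : List U → N) : List U → N
  | [] => 0
  | x :: l => H.sumTrans v (fun p q => g (p :: q * x :: l))

/-- `g (v⁰₊, v⁰₋ v¹₊, v¹₋ v²₊, …, vⁿ⁻¹₋ vⁿ)` -/
def galoisForm : (List U → N) → List U → N
  | _, [] => 0
  | g, [x] => g [x]
  | g, v :: x :: l => galoisForm (transHead H v g) (x :: l)

variable {H}

theorem galoisForm_cons_cons (g : List U → N) (v x : U) (l : List U) :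
    galoisForm H g (v :: x :: l) = galoisForm H (transHead H v g) (x :: l) := by
  rw [galoisForm]

theorem transHead_congr {g g' : List U → N} (v : U) {l : List U}
    (h : ∀ l', l'.length = l.length + 1 → g l' = g' l') :
    transHead H v g l = transHead H v g' l := by
  rcases l with _ | ⟨x, l⟩
  · rfl
  · simp only [transHead]
    congr 1; ext p q
    exact h _ rfl

theorem galoisForm_congr {g g' : List U → N} {l : List U}
    (h : ∀ l', l'.length = l.length → g l' = g' l') : galoisForm H g l = galoisForm H g' l := by
  induction l generalizing g g' with
  | nil => rfl
  | cons v l ih =>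
    rcases l with _ | ⟨x, l⟩
    · exact h _ rfl
    · simp only [galoisForm_cons_cons]
      refine ih fun l' hl' => transHead_congr v fun l'' hl'' => h _ ?_
      simp only [hl'', hl', List.length_cons]

theorem transHead_sum {ι : Type*} (s : Finset ι) (v : U) (g : ι → List U → N) :
    transHead H v (fun l' => ∑ i ∈ s, g i l') = fun l => ∑ i ∈ s, transHead H v (g i) l := by
  ext l
  rcases l with _ | ⟨x, l⟩
  · simp [transHead]
  · simp only [transHead, sumTrans]
    exact Finset.sum_comm

theorem galoisForm_sum {ι : Type*} (s : Finset ι) (g : ι → List U → N) (l : List U) :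
    galoisForm H (fun l' => ∑ i ∈ s, g i l') l = ∑ i ∈ s, galoisForm H (g i) l := by
  induction l generalizing g with
  | nil => simp [galoisForm]
  | cons v l ih =>
    rcases l with _ | ⟨x, l⟩
    · rfl
    · simp only [galoisForm_cons_cons, transHead_sum, ih]

theorem transHead_comp (φ : N →+ N) (v : U) (g : List U → N) :
    transHead H v (fun l' => φ (g l')) = fun l => φ (transHead H v g l) := by
  ext l
  rcases l with _ | ⟨x, l⟩
  · simp [transHead]
  · simp only [transHead, sumTrans, map_sum]

theorem galoisForm_comp (φ : N →+ N) (g : List U → N) (l : List U) :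
    galoisForm H (fun l' => φ (g l')) l = φ (galoisForm H g l) := by
  induction l generalizing g with
  | nil => simp [galoisForm]
  | cons v l ih =>
    rcases l with _ | ⟨x, l⟩
    · rfl
    · simp only [galoisForm_cons_cons, transHead_comp, ih]

theorem galoisForm_add (g g' : List U → N) (l : List U) :
    galoisForm H (fun l' => g l' + g' l') l = galoisForm H g l + galoisForm H g' l := by
  have h := galoisForm_sum (H := H) Finset.univ ![g, g'] l
  simpa [Fin.sum_univ_two] using h

variable [Module k N]

theorem galoisForm_balanced {Q : U → U → List U → N} (hQ : ∀ l, H.Balanced (fun x y => Q x y l))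
    (l : List U) : H.Balanced (fun x y => galoisForm H (Q x y) l) where
  add_left x x' y := by
    rw [← galoisForm_add]; congr 1; exact funext fun l' => (hQ l').add_left x x' y
  add_right x y y' := by
    rw [← galoisForm_add]; congr 1; exact funext fun l' => (hQ l').add_right x y y'
  smul_left c x y :=
    (congrArg (galoisForm H · l) (funext fun l' => (hQ l').smul_left c x y)).trans
      (galoisForm_comp (DistribSMul.toAddMonoidHom N c) _ l)
  smul_right c x y :=
    (congrArg (galoisForm H · l) (funext fun l' => (hQ l').smul_right c x y)).trans
      (galoisForm_comp (DistribSMul.toAddMonoidHom N c) _ l)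
  bal a x y := congrArg (galoisForm H · l) (funext fun l' => (hQ l').bal a x y)

theorem listBalanced_transHead {g : List U → N} (hg : H.ListBalanced g) (v : U) :
    H.ListBalanced (transHead H v g) where
  add l x y l' := by
    rcases l with _ | ⟨u, l⟩
    · simp only [transHead, List.nil_append, mul_add, (hg.cons _).add_head, sumTrans_fun_add]
    · simp only [transHead, List.cons_append, ((hg.cons _).cons _).add, sumTrans_fun_add]
  smul l c x l' := by
    rcases l with _ | ⟨u, l⟩
    · simp only [transHead, List.nil_append, mul_smul_comm, (hg.cons _).smul_head,
        sumTrans_fun_smul]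
    · simp only [transHead, List.cons_append, ((hg.cons _).cons _).smul, sumTrans_fun_smul]
  bal l x y a l' := by
    rcases l with _ | ⟨u, l⟩
    · simp only [transHead, List.nil_append, ← mul_assoc, (hg.cons _).bal_head]
    · simp only [transHead, List.cons_append, ((hg.cons _).cons _).bal]

/-- The function `g` can be recovered from its Galois form. -/
theorem eq_of_galoisForm_eq {g g' : List U → N} (hg : H.ListBalanced g) (hg' : H.ListBalanced g')
    {n : ℕ} (h : ∀ l, l.length = n + 1 → galoisForm H g l = galoisForm H g' l) {l : List U}
    (hl : l.length = n + 1) : g l = g' l := by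
  induction n generalizing g g' l with
  | zero =>
    obtain ⟨x, rfl⟩ := List.length_eq_one_iff.1 hl
    exact h [x] rfl
  | succ n ih =>
    rcases l with _ | ⟨u, _ | ⟨y, l⟩⟩
    · simp at hl
    · simp at hl
    have hR (v : U) (l' : List U) (hl' : l'.length = n + 1) :
        transHead H v g l' = transHead H v g' l' := by
      refine ih (listBalanced_transHead hg v) (listBalanced_transHead hg' v) (fun l'' hl'' => ?_) hl'
      rcases l'' with _ | ⟨x, l''⟩
      · simp at hl''
      · simpa only [galoisForm_cons_cons] using h (v :: x :: l'') (by simpa using hl'')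
    -- The inversion of one step: `u₍₁₎₊ ⊗ u₍₁₎₋u₍₂₎y = u ⊗ y` expresses `g` through `transHead`.
    have key {g : List U → N} (hg : H.ListBalanced g) : g (u :: y :: l) =
        H.sumComul u (fun u₁ u₂ => transHead H u₁ g (u₂ * y :: l)) := by
      rw [← sumComul_sumTrans_mul (hg.balancedOp l) u y]
      simp only [transHead, mul_assoc]
    rw [key hg, key hg']
    congr 1; ext u₁ u₂
    exact hR u₁ _ (by simpa using hl)

theorem transHead_transEval {g : List U → N} (hg : H.ListBalanced g) (v z : U) (l : List U)
    (y : U) :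
    transHead H v (fun l' => H.transEval g l' y) (z :: l) =
      H.transEval (transHead H v g) (z :: l) y := by
  -- Expanding `(v₋z)₊ ⊗ (v₋z)₋` makes the left side `F(v₊₊, v₋₊, v₋₋v₊₋)`, which the triple
  -- translation identity reduces to `F(v₊, v₋, 1)`.
  let F (p r c : U) : N :=
    H.sumTrans z (fun r' s' => H.transEval (fun l' => g (p :: r * r' :: l')) l (s' * (c * y)))
  have hb (p r c : U) : H.BalancedOp (fun r' s' =>
      H.transEval (fun l' => g (p :: r * r' :: l')) l (s' * (c * y))) :=
    (balancedOp_transEval (hg.cons p) l (c * y)).mul_left r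
  have h₁ (p : U) : H.BalancedOp (F p) :=
    { add_left := fun r r' c => by
        simp only [F, add_mul, (hg.cons p).add_head, transEval_add, sumTrans_fun_add]
      add_right := fun r c c' => by
        simp only [F, add_mul, mul_add, transEval_add_right ((hg.cons p).cons _), sumTrans_fun_add]
      smul_left := fun a r c => by
        simp only [F, smul_mul_assoc, (hg.cons p).smul_head, transEval_smul, sumTrans_fun_smul]
      smul_right := fun a r c => by
        simp only [F, smul_mul_assoc, mul_smul_comm, transEval_smul_right ((hg.cons p).cons _),
          sumTrans_fun_smul]
      bal := fun a r c => by
        have h := sumTrans_takeuchi (hb p r c) a z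
        simp only [mul_assoc] at h
        simp only [F, mul_assoc, h] }
  have h₂ (c : U) : H.BalancedOp (fun p r => F p r c) :=
    { add_left := fun p p' r => by simp only [F, hg.add_head, transEval_add, sumTrans_fun_add]
      add_right := fun p r r' => (h₁ p).add_left r r' c
      smul_left := fun a p r => by simp only [F, hg.smul_head, transEval_smul, sumTrans_fun_smul]
      smul_right := fun a p r => (h₁ p).smul_left a r c
      bal := fun a p r => by simp only [F, hg.bal_head, mul_assoc] }
  have h := sumTrans_sumTrans_sumTrans h₁ h₂ v
  have hl : transHead H v (fun l' => H.transEval g l' y) (z :: l) =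
      H.sumTrans v (fun p q => F p q 1) := by
    rw [← h]
    simp only [transHead, transEval_cons _ _ (_ :: _)]
    congr 1; ext p q
    congr 1; ext p' q'
    rw [transEval_cons, sumTrans_mul (balancedOp_transEval (hg.cons p') l (q' * y))]
    simp only [F, mul_assoc]
  rw [hl]
  have hr (r' : U) : (fun l' => transHead H v g (r' :: l')) = fun l' =>
    H.sumTrans v (fun p q => g (p :: q * r' :: l')) := rfl
  simp only [F, transEval_cons, hr, transEval_sumTrans, one_mul]
  exact Finset.sum_comm

/-- In Galois coordinates all the products `uⁿ₋⋯u¹₋` cancel, and evaluation on translations merely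
appends `y` as the last coordinate. -/
theorem galoisForm_transEval {g : List U → N} (hg : H.ListBalanced g) (x : U) (l : List U)
    (y : U) :
    galoisForm H (fun l' => H.transEval g l' y) (x :: l) = galoisForm H g (x :: (l ++ [y])) := by
  induction l generalizing g x with
  | nil => rfl
  | cons x' l ih =>
    simp only [List.cons_append, galoisForm_cons_cons]
    rw [← ih (listBalanced_transHead hg x)]
    refine galoisForm_congr fun l' hl' => ?_
    rcases l' with _ | ⟨z, l'⟩
    · simp at hl'
    · exact transHead_transEval hg x z l' y

end GaloisForm

open LeftBialgebroid AeRing LeftHopfAlgebroid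

section

variable {k A U : Type*} [CommRing k] [Ring A] [Algebra k A] [Ring U] [Algebra k U]
variable {H : LeftHopfAlgebroid k A U}
variable {N : Type*} [AddCommGroup N] [Module k N]

theorem LeftHopfAlgebroid.sumTrans_src_mul {F : U → U → N} (hF : H.BalancedOp F) (a : A) (u : U) :
    H.sumTrans (H.s a * u) F = H.sumTrans u (fun p q => F (H.s a * p) q) := by
  refine sumTrans_eq hF (translation_eq_sum ?_)
  have h₁ := sumTrans_sumComul ((balanced_tmul (E := H.toAeRing)).src_mul a) u
  rw [← h₁]
  exact Finset.sum_congr rfl fun i _ => sumComul_src_mul (balanced_tmul.mul_right_snd _) a _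

/-- Finitely many elements have presentations of their translations with a common number of
terms. -/
theorem LeftHopfAlgebroid.exists_common_translation {ι : Type*} [Fintype ι] (u : ι → U) :
    ∃ (L : ℕ) (p q : ι → Fin L → U),
      ∀ i, H.translation (u i) = ∑ l, H.tmulOp (p i l) (q i l) := by
  -- The common number of terms is the sum of all the individual numbers; shorter presentations are
  -- padded with zeros.
  suffices h : ∀ i, ∃ p q : Fin (∑ i, H.transCard (u i)) → U,
      H.translation (u i) = ∑ l, H.tmulOp (p l) (q l) by
    choose p q h using h
    exact ⟨_, p, q, h⟩
  intro i
  obtain ⟨m, hm⟩ := Nat.exists_eq_add_of_le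
    (Finset.single_le_sum (f := fun i => H.transCard (u i)) (fun _ _ => Nat.zero_le _)
      (Finset.mem_univ i))
  rw [hm]
  refine ⟨Fin.append (H.transFst (u i)) 0, Fin.append (H.transSnd (u i)) 0, ?_⟩
  rw [Fin.sum_univ_add, H.translation_eq]
  have h0 : H.tmulOp 0 0 = 0 := by simp [AeRing.tmulOp]
  simp [h0]

end

/-! ### The anti Yetter–Drinfel'd condition: the cyclic operator as a rotation -/

section AYD

variable {k A U : Type*} [CommRing k] [Ring A] [Algebra k A] [Ring U] [Algebra k U]
variable {H : LeftHopfAlgebroid k A U}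
variable {M : Type*} [AddCommGroup M] [Module k M] [Module Aᵐᵒᵖ M] [IsScalarTower k Aᵐᵒᵖ M]
  [Module U M] [IsScalarTower k U M]
variable {C : Contramodule H.toLeftBialgebroid M}

theorem balancedOp_smul_homOp (hM : ∀ (a : A) (m : M), H.t a • m = op a • m) {φ : U → M}
    (hφ : H.IsHomOp φ) (w x : U) : H.BalancedOp (fun p q => p • φ (q * w * x)) where
  add_left p p' q := add_smul _ _ _
  add_right p q q' := by rw [add_mul, add_mul, hφ.add, smul_add]
  smul_left c p q := smul_assoc _ _ _
  smul_right c p q := by rw [smul_mul_assoc, smul_mul_assoc, hφ.smul, smul_comm]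
  bal a p q := by simp only [mul_smul, hM, mul_assoc, hφ.tgt]

theorem isHomOp_sumTrans_smul (hM : ∀ (a : A) (m : M), H.t a • m = op a • m) {φ : U → M}
    (hφ : H.IsHomOp φ) (x y : U) :
    H.IsHomOp (fun w => H.sumTrans y (fun p q => p • φ (q * w * x))) where
  add w w' := by simp only [mul_add, add_mul, hφ.add, smul_add, sumTrans_fun_add]
  smul c w := by
    simp only [mul_smul_comm, smul_mul_assoc, hφ.smul, smul_comm _ c, sumTrans_fun_smul]
  tgt a w := by
    have h := sumTrans_takeuchi (balancedOp_smul_homOp hM hφ w x) a y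
    simp only [mul_assoc, mul_smul] at h ⊢
    rw [← h]
    simp only [hM, sumTrans, Finset.smul_sum]

theorem IsAYD.smul_contra (h : IsAYD H C) {φ : U → M} (hφ : H.IsHomOp φ) (u : U) :
    u • C.contra φ =
      C.contra (fun w => H.sumComul u (fun x y => H.sumTrans y (fun p q => p • φ (q * w * x)))) := by
  obtain ⟨f, hf⟩ := hφ.exists_eq
  obtain ⟨L, p, q, hpq⟩ := LeftHopfAlgebroid.exists_common_translation (H := H) (H.comulSnd u)
  have hχ : H.IsHomOp (fun w =>
      H.sumComul u (fun x y => H.sumTrans y (fun p q => p • φ (q * w * x)))) :=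
    AeRing.IsHomOp.sum _ fun i => isHomOp_sumTrans_smul h.right_compat hφ _ _
  obtain ⟨χ, hχ'⟩ := hχ.exists_eq
  rw [← hχ', ← hf, C.contra_coe, C.contra_coe]
  refine h.action_contra u f _ _ _ (H.comul_eq u) L p q hpq χ fun w => ?_
  rw [hχ', hf]
  exact Finset.sum_congr rfl fun i _ =>
    sumTrans_eq (balancedOp_smul_homOp h.right_compat hφ w _) (hpq i)

/-- The left `A`-action on the values can be moved into the argument of a contraaction. -/
theorem IsAYD.contra_src_smul (h : IsAYD H C) {φ : U → M} (hφ : H.IsHomOp φ) (a : A) :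
    C.contra (fun w => H.s a • φ w) = C.contra (fun w => φ (w * H.t a)) := by
  have hg : H.Balanced (fun w w' => op (H.counit (w' * H.t a)) • φ w) :=
    { add_left := fun x x' y => by rw [hφ.add, smul_add]
      add_right := fun x y y' => by rw [add_mul, map_add, op_add, add_smul]
      smul_left := fun c x y => by rw [hφ.smul, smul_comm]
      smul_right := fun c x y => by rw [smul_mul_assoc, map_smul, op_smul, smul_assoc]
      bal := fun b x y => by
        rw [hφ.tgt, ← mul_smul, ← op_mul, mul_assoc, H.counit_src_mul] }
  have h₁ (w : U) : H.s a • φ w = C.contra (fun w' => op (H.counit (w' * H.t a)) • φ w) := by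
    rw [h.left_compat, Contramodule.leftAct, ← C.contra_coe]; rfl
  simp only [h₁]
  -- Since `s(a)m = γ(m ε(- t(a)))`, two contraactions are nested; once merged, counitality
  -- evaluates `t(ε(w₍₂₎t(a)))w₍₁₎` to `wt(a)`.
  rw [C.contra_contra hg fun b u v => by rw [mul_assoc, H.counit_tgt_mul, op_mul, mul_smul]]
  refine congrArg C.contra (funext fun w => ?_)
  conv_rhs => rw [← sumComul_counit_right (B := H.toLeftBialgebroid) (w * H.t a),
    sumComul_mul_tgt balanced_counit_right]
  simp only [← hφ.tgt]
  exact (map_sum (AddMonoidHom.mk' φ hφ.add) _ _).symm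

theorem IsStable.contra_smul (hM : ∀ (a : A) (m : M), H.t a • m = op a • m) (h : IsStable H C)
    (m : M) : C.contra (fun w => w • m) = m := by
  have hφ : H.IsHomOp (fun w : U => w • m) :=
    ⟨fun x y => add_smul _ _ _, fun c x => smul_assoc _ _ _, fun a x => by rw [mul_smul, hM]⟩
  obtain ⟨F, hF⟩ := hφ.exists_eq
  rw [← hF, C.contra_coe]
  exact h m F fun u => congrFun hF u

variable {g : List U → M}

theorem transEval_smul_cons (hlin : ∀ u l, g (headMul u l) = u • g l) (u z : U) (l : List U)
    (w : U) : H.sumTrans z (fun p q => H.transEval (fun l' => g (u * p :: l')) l (q * w)) =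
      u • H.transEval g (z :: l) w := by
  have h (p : U) : (fun l' => g (u * p :: l')) =
      fun l' => DistribSMul.toAddMonoidHom M u (g (p :: l')) := funext fun l' => hlin u (p :: l')
  simp only [h, transEval_comp]
  exact Finset.smul_sum.symm

theorem transEval_mul_cons (hg : H.ListCochain g) (hlin : ∀ u l, g (headMul u l) = u • g l)
    (u z : U) (l : List U) (w : U) :
    H.transEval g (u * z :: l) w =
      H.sumTrans u (fun p q => p • H.transEval g (z :: l) (q * w)) := by
  rw [transEval_cons, sumTrans_mul (balancedOp_transEval hg.toListBalanced l w)]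
  simp only [← transEval_smul_cons hlin, mul_assoc]

theorem transEval_src_mul_cons (hg : H.ListCochain g) (hlin : ∀ u l, g (headMul u l) = u • g l)
    (a : A) (z : U) (l : List U) (w : U) :
    H.transEval g (H.s a * z :: l) w = H.s a • H.transEval g (z :: l) w := by
  rw [← transEval_smul_cons hlin, transEval_cons,
    sumTrans_src_mul (balancedOp_transEval hg.toListBalanced l w)]

theorem isHomOp_transEval_mul (hg : H.ListCochain g) (l : List U) (v : U) :
    H.IsHomOp (fun w => H.transEval g l (w * v)) where
  add x y := by rw [add_mul, (isHomOp_transEval hg l).add]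
  smul c x := by rw [smul_mul_assoc, (isHomOp_transEval hg l).smul]
  tgt a x := by rw [mul_assoc, (isHomOp_transEval hg l).tgt]

/-- Balancedness over `A` is what allows `v₊₍₁₎ ⊗ v₊₍₂₎v₋ = v ⊗ 1` to be inserted here. It holds
because `s(a)` acting on the values moves into the argument of `γ` as `wt(a)`. -/
theorem balanced_contra_transEval (hM : IsAYD H C) (hg : H.ListCochain g)
    (hlin : ∀ u l, g (headMul u l) = u • g l) (x : U) (l : List U) :
    H.Balanced (fun y z => C.contra (fun w => H.transEval g (z * x :: l) (w * y))) where
  add_left y y' z := by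
    rw [← C.contra_add (isHomOp_transEval_mul hg _ _) (isHomOp_transEval_mul hg _ _)]
    simp only [mul_add, (isHomOp_transEval hg _).add]
  add_right y z z' := by
    rw [← C.contra_add (isHomOp_transEval_mul hg _ _) (isHomOp_transEval_mul hg _ _)]
    simp only [add_mul, (listBalanced_transEval hg.toListBalanced _).add_head]
  smul_left c y z := by
    rw [← C.contra_smul c (isHomOp_transEval_mul hg _ _)]
    simp only [mul_smul_comm, (isHomOp_transEval hg _).smul]
  smul_right c y z := by
    rw [← C.contra_smul c (isHomOp_transEval_mul hg _ _)]
    simp only [smul_mul_assoc, (listBalanced_transEval hg.toListBalanced _).smul_head]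
  bal a y z := by
    have h := hM.contra_src_smul (isHomOp_transEval_mul hg (z * x :: l) y) a
    simp only [mul_assoc, transEval_src_mul_cons hg hlin] at h ⊢
    exact h.symm

/-- The condition yields `u₍₂₎₊` in front and `u₍₂₎₋(-)u₍₁₎` inside. Linearity of `g` in its head
and `(zx)₊ ⊗ (zx)₋ = z₊x₊ ⊗ x₋z₋` then absorb `u₍₂₎` into the first entry. -/
theorem smul_contraEval (hM : IsAYD H C) (hg : H.ListCochain g)
    (hlin : ∀ u l, g (headMul u l) = u • g l) (u x : U) (l : List U) :
    u • contraEval C g (x :: l) = H.sumComul u (fun y z =>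
      C.contra (fun w => H.transEval g (z * x :: l) (w * y))) := by
  rw [contraEval, hM.smul_contra (isHomOp_transEval hg _)]
  simp only [mul_assoc]
  simp only [← transEval_mul_cons hg hlin]
  exact C.contra_sum _ fun i => isHomOp_transEval_mul hg _ _

/-- The action of `v₊` leaves the first entry `v₊₍₂₎v₋x` and the argument `wv₊₍₁₎`, which collapse
to `x` and `wv`. -/
theorem transHead_contraEval (hM : IsAYD H C) (hg : H.ListCochain g)
    (hlin : ∀ u l, g (headMul u l) = u • g l) (v x : U) (l : List U) :
    transHead H v (actHead (contraEval C g)) (x :: l) =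
      C.contra (fun w => H.transEval g (x :: l) (w * v)) := by
  have h := sumTrans_sumComul (balanced_contra_transEval hM hg hlin x l) v
  simp only [one_mul] at h
  rw [← h]
  simp only [transHead, actHead, smul_contraEval hM hg hlin, mul_assoc]

theorem galoisForm_contra {h : List U → U → M} (hh : ∀ l, H.IsHomOp (h l)) (l : List U) :
    H.IsHomOp (fun w => galoisForm H (h · w) l) ∧
    galoisForm H (fun l' => C.contra (h l')) l = C.contra (fun w => galoisForm H (h · w) l) := by
  induction l generalizing h with
  | nil => exact ⟨⟨fun _ _ => (add_zero 0).symm, fun _ _ => (smul_zero _).symm,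
      fun _ _ => (smul_zero _).symm⟩, C.contra_zero.symm⟩
  | cons v l ih =>
    rcases l with _ | ⟨x, l⟩
    · exact ⟨hh [v], rfl⟩
    · let h' (l' : List U) (w : U) : M := transHead H v (h · w) l'
      have hh' (l' : List U) : H.IsHomOp (h' l') ∧
          transHead H v (fun l' => C.contra (h l')) l' = C.contra (h' l') := by
        rcases l' with _ | ⟨y, l'⟩
        · exact ⟨⟨fun _ _ => (add_zero 0).symm, fun _ _ => (smul_zero _).symm,
            fun _ _ => (smul_zero _).symm⟩, C.contra_zero.symm⟩
        · exact ⟨AeRing.IsHomOp.sum Finset.univ (φ := fun i => h (H.transFst v i ::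
            H.transSnd v i * y :: l')) fun i => hh _, (C.contra_sum Finset.univ (φ := fun i =>
            h (H.transFst v i :: H.transSnd v i * y :: l')) fun i => hh _).symm⟩
      have := ih (h := h') fun l' => (hh' l').1
      simp only [galoisForm_cons_cons]
      rw [show transHead H v (fun l' => C.contra (h l')) = fun l' => C.contra (h' l') from
        funext fun l' => (hh' l').2]
      exact this

/-- The rotation: the head `v` moves to the end, multiplied on the left by the variable of the
contraaction. -/
theorem galoisForm_contraEval (hM : IsAYD H C) (hg : H.ListCochain g)
    (hlin : ∀ u l, g (headMul u l) = u • g l) (v x : U) (l : List U) :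
    galoisForm H (actHead (contraEval C g)) (v :: x :: l) =
      C.contra (fun w => galoisForm H g (x :: (l ++ [w * v]))) := by
  rw [galoisForm_cons_cons]
  have h : galoisForm H (transHead H v (actHead (contraEval C g))) (x :: l) =
      galoisForm H (fun l' => C.contra (fun w => H.transEval g l' (w * v))) (x :: l) := by
    refine galoisForm_congr fun l' hl' => ?_
    rcases l' with _ | ⟨y, l'⟩
    · simp at hl'
    · exact transHead_contraEval hM hg hlin v y l'
  rw [h, (galoisForm_contra (fun l' => isHomOp_transEval_mul hg l' v) _).2]
  simp only [galoisForm_transEval hg.toListBalanced]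

end AYD

/-! ### Nested contraactions and the diagonal action -/

section Nested

variable {k A U : Type*} [CommRing k] [Ring A] [Algebra k A] [Ring U] [Algebra k U]
variable {H : LeftHopfAlgebroid k A U}
variable {M : Type*} [AddCommGroup M] [Module k M] [Module Aᵐᵒᵖ M] [IsScalarTower k Aᵐᵒᵖ M]
variable (C : Contramodule H.toLeftBialgebroid M)

/-- `γ (w₁ ↦ ⋯ γ (wₙ ↦ G (c, w₁ v¹, …, wₙ vⁿ)))` -/
def nestedContra : List U → (List U → M) → List U → M
  | [], G, c => G c
  | v :: l, G, c => C.contra (fun w => nestedContra l G (c ++ [w * v]))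

theorem nestedContra_congr {G G' : List U → M} {l c : List U}
    (h : ∀ c', c'.length = c.length + l.length → G c' = G' c') :
    nestedContra C l G c = nestedContra C l G' c := by
  induction l generalizing c with
  | nil => exact h c rfl
  | cons v l ih =>
    refine congrArg C.contra (funext fun w => ih fun c' hc' => h c' ?_)
    rw [hc']; simp only [List.length_append, List.length_cons, List.length_nil]; omega

theorem nestedContra_cons (G : List U → M) (l : List U) (y : U) (c : List U) :
    nestedContra C l G (y :: c) = nestedContra C l (fun c' => G (y :: c')) c := by
  induction l generalizing c with
  | nil => rfl
  | cons v l ih => exact congrArg C.contra (funext fun w => ih (c ++ [w * v]))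

variable {g : List U → M}

theorem balanced_transHead_headMul (hg : H.ListCochain g) (v : U) (l : List U) :
    H.Balanced (fun w w' => transHead H (w * v) g (headMul w' l)) := by
  rcases l with _ | ⟨x, l⟩
  · exact ⟨⟨fun _ _ _ => (add_zero 0).symm, fun _ _ _ => (add_zero 0).symm,
      fun _ _ _ => (smul_zero _).symm, fun _ _ _ => (smul_zero _).symm⟩, fun _ _ _ => rfl⟩
  have hb (w' : U) : H.BalancedOp (fun p q => g (p :: q * (w' * x) :: l)) :=
    (hg.balancedOp l).mul_right _
  exact
    { add_left := fun w₁ w₂ w' => by simp only [headMul, transHead, add_mul, sumTrans_add (hb w')]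
      add_right := fun w w₁ w₂ => by
        simp only [headMul, transHead, add_mul, mul_add, (hg.cons _).add_head, sumTrans_fun_add]
      smul_left := fun c w w' => by
        simp only [headMul, transHead, smul_mul_assoc, sumTrans_smul (hb w')]
      smul_right := fun c w w' => by
        simp only [headMul, transHead, smul_mul_assoc, mul_smul_comm, (hg.cons _).smul_head,
          sumTrans_fun_smul]
      bal := fun a w w' => by
        simp only [headMul, transHead, mul_assoc]
        simp only [sumTrans_tgt_mul (hb w'), mul_assoc] }

theorem listCochain_transHead (hg : H.ListCochain g) (v : U) :
    H.ListCochain (transHead H v g) where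
  toListBalanced := listBalanced_transHead hg.toListBalanced v
  lin a x l := by
    have h := sumTrans_takeuchi ((hg.balancedOp l).mul_right x) a v
    simp only [mul_assoc, hg.lin] at h
    simp only [transHead, ← h]
    exact Finset.smul_sum.symm

/-- Here `(w₍₁₎v)₊ ⊗ (w₍₁₎v)₋w₍₂₎x = w₍₁₎₊v₊ ⊗ v₋w₍₁₎₋w₍₂₎x = wv₊ ⊗ v₋x`. -/
theorem sumComul_transHead (hg : H.ListBalanced g) (v w : U) (l : List U) :
    H.sumComul w (fun w₁ w₂ => transHead H (w₁ * v) g (headMul w₂ l)) =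
      transHead H v (fun l' => g (headMul w l')) l := by
  rcases l with _ | ⟨x, l⟩
  · simp [headMul, transHead, sumComul]
  have hb (p c : U) : H.BalancedOp (fun p' q' => g (p * p' :: q' * (c * x) :: l)) :=
    (hg.balancedOp l).mul p (c * x)
  have hK : H.BalancedOp (fun p c => H.sumTrans v (fun p' q' => g (p * p' :: q' * (c * x) :: l))) :=
    { add_left := fun p p' c => by simp only [add_mul, hg.add_head, sumTrans_fun_add]
      add_right := fun p c c' => by
        simp only [add_mul, mul_add, (hg.cons _).add_head, sumTrans_fun_add]
      smul_left := fun a p c => by simp only [smul_mul_assoc, hg.smul_head, sumTrans_fun_smul]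
      smul_right := fun a p c => by
        simp only [smul_mul_assoc, mul_smul_comm, (hg.cons _).smul_head, sumTrans_fun_smul]
      bal := fun a p c => by
        have h := sumTrans_takeuchi (hb p c) a v
        simp only [mul_assoc] at h ⊢
        exact h }
  have h := sumComul_sumTrans hK w
  simp only [one_mul] at h
  simp only [headMul, transHead]
  rw [← h]
  congr 1; ext w₁ w₂
  rw [sumTrans_mul ((hg.balancedOp l).mul_right (w₂ * x))]
  simp only [mul_assoc]

/-- The inner contraactions are merged by induction, for `transHead` of `g`. Contraassociativity
then joins the outermost one, and the previous lemma moves the coproduct of `w` entirely into the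
head. -/
theorem nestedContra_galoisForm (hg : H.ListCochain g) (v : U) (l : List U) :
    nestedContra C (v :: l) (galoisForm H g) [] =
      C.contra (fun w => galoisForm H (fun l' => g (headMul w l')) (v :: l)) := by
  induction l generalizing g v with
  | nil => rfl
  | cons v' l ih =>
    have h₁ (w : U) : nestedContra C (v' :: l) (galoisForm H g) [w * v] =
        C.contra (fun w' => galoisForm H
          (fun l' => transHead H (w * v) g (headMul w' l')) (v' :: l)) := by
      rw [← ih (listCochain_transHead hg (w * v)), nestedContra_cons]
      refine nestedContra_congr C fun c' hc' => ?_
      rcases c' with _ | ⟨x, c'⟩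
      · simp at hc'
      · exact galoisForm_cons_cons _ _ _ _
    have h₂ : nestedContra C (v :: v' :: l) (galoisForm H g) [] =
        C.contra (fun w => nestedContra C (v' :: l) (galoisForm H g) [w * v]) := rfl
    rw [h₂]
    simp only [h₁]
    rw [C.contra_contra (galoisForm_balanced (fun l' => balanced_transHead_headMul hg v l') _)
      fun a w w' => ?_]
    · refine congrArg C.contra (funext fun w => ?_)
      rw [galoisForm_cons_cons, sumComul, ← galoisForm_sum]
      congr 1
      exact funext fun l' => sumComul_transHead hg.toListBalanced v w l'
    · refine Eq.trans (galoisForm_congr fun l' hl' => ?_)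
        (galoisForm_comp (DistribSMul.toAddMonoidHom M (op a)) _ _)
      rcases l' with _ | ⟨x, l'⟩
      · simp at hl'
      · simp only [headMul, mul_assoc]
        exact (listCochain_transHead hg (w * v)).lin a _ _

end Nested

/-! ### Cyclicity -/

section Cyclicity

variable {k A U : Type*} [CommRing k] [Ring A] [Algebra k A] [Ring U] [Algebra k U]
variable {H : LeftHopfAlgebroid k A U}
variable {M : Type*} [AddCommGroup M] [Module k M] [Module Aᵐᵒᵖ M] [IsScalarTower k Aᵐᵒᵖ M]
  [Module U M] [IsScalarTower k U M]
variable (C : Contramodule H.toLeftBialgebroid M)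

/-- The cyclic operator `(τ f) (u¹, …, uⁿ) = γ (u¹₊ f (u²₊, …, uⁿ₊, uⁿ₋ ⋯ u¹₋ (-)))`. -/
def cyclicOp (f : List U → M) : List U → M := contraEval C (actHead f)

variable {C} {f : List U → M}

theorem listCochain_cyclicOp (hM : ∀ (a : A) (m : M), H.t a • m = op a • m)
    (hf : H.ListCochain f) : H.ListCochain (cyclicOp C f) :=
  listCochain_contraEval C (listCochain_actHead hM hf)

theorem listCochain_cyclicOp_iterate (hM : ∀ (a : A) (m : M), H.t a • m = op a • m)
    (hf : H.ListCochain f) (n : ℕ) : H.ListCochain ((cyclicOp C)^[n] f) := by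
  induction n with
  | zero => exact hf
  | succ n ih => rw [Function.iterate_succ_apply']; exact listCochain_cyclicOp hM ih

/-- The rotation is iterated: `a` lists the coordinates still to be moved, `b` those already moved.
At least two coordinates are needed for a rotation step. -/
theorem galoisForm_cyclicOp_iterate (hM : IsAYD H C) (hf : H.ListCochain f) (a b : List U)
    (hab : 2 ≤ (a ++ b).length) :
    galoisForm H (actHead ((cyclicOp C)^[a.length] f)) (a ++ b) =
      nestedContra C a (galoisForm H (actHead f)) b := by
  induction a generalizing b with
  | nil => rfl
  | cons v a ih =>
    rw [List.length_cons, Function.iterate_succ_apply']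
    rcases hab' : a ++ b with _ | ⟨x, l⟩
    · simp [hab'] at hab
    · rw [List.cons_append, hab', cyclicOp, galoisForm_contraEval hM (listCochain_actHead
        hM.right_compat (listCochain_cyclicOp_iterate hM.right_compat hf _))
        fun u l => actHead_headMul _ u l]
      refine congrArg C.contra (funext fun w => ?_)
      rw [← ih (b ++ [w * v]) (by simp at hab ⊢; omega), ← List.append_assoc, hab',
        List.cons_append]

/-- `τⁿ⁺¹ = id` on functions of `n` arguments. -/
theorem cyclicOp_iterate_eq (hM : IsAYD H C) (hS : IsStable H C) (hf : H.ListCochain f)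
    (l : List U) : (cyclicOp C)^[l.length + 1] f l = f l := by
  rcases l with _ | ⟨u, l⟩
  -- Without arguments the assertion is stability itself; a single Galois coordinate could not be
  -- rotated.
  · exact hS.contra_smul hM.right_compat (f [])
  have key (l' : List U) (hl' : l'.length = (u :: l).length + 1) :
      galoisForm H (actHead ((cyclicOp C)^[(u :: l).length + 1] f)) l' =
        galoisForm H (actHead f) l' := by
    have h := galoisForm_cyclicOp_iterate hM hf l' [] (by simp [hl'])
    rw [hl', List.append_nil] at h
    rw [h]
    rcases l' with _ | ⟨v, l'⟩
    · simp at hl'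
    rw [nestedContra_galoisForm C (listCochain_actHead hM.right_compat hf)]
    conv_rhs => rw [← hS.contra_smul hM.right_compat (galoisForm H (actHead f) (v :: l'))]
    refine congrArg C.contra (funext fun w => ?_)
    simp only [actHead_headMul]
    exact galoisForm_comp (DistribSMul.toAddMonoidHom M w) _ _
  -- The Galois form determines `f̂`, and `f` is recovered from `f̂` at `u⁰ = 1`.
  have h := eq_of_galoisForm_eq
    (listCochain_actHead hM.right_compat
      (listCochain_cyclicOp_iterate hM.right_compat hf _)).toListBalanced
    (listCochain_actHead hM.right_compat hf).toListBalanced key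
    (l := 1 :: u :: l) rfl
  simpa only [actHead, one_smul] using h

end Cyclicity

open LeftBialgebroid AeRing LeftHopfAlgebroid

/-! ### Cosimplicial identities on lists -/

section Operations

variable {U N N' : Type*} [Ring U] [AddCommGroup N] [AddCommGroup N']

theorem contract_add (j : ℕ) (g g' : List U → N) (l : List U) :
    contract j (fun l' => g l' + g' l') l = contract j g l + contract j g' l := by
  simpa [Fin.sum_univ_two] using contract_sum Finset.univ j ![g, g'] l

theorem insertOne_add (j : ℕ) (g g' : List U → N) (l : List U) :
    insertOne j (fun l' => g l' + g' l') l = insertOne j g l + insertOne j g' l := by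
  simpa [Fin.sum_univ_two] using insertOne_sum Finset.univ j ![g, g'] l

theorem contract_comp (φ : N →+ N') (j : ℕ) (g : List U → N) (l : List U) :
    contract j (fun l' => φ (g l')) l = φ (contract j g l) :=
  contract_map (fun h : U → N => φ (h 0)) (map_zero φ) j (fun l' _ => g l') l

theorem insertOne_comp (φ : N →+ N') (j : ℕ) (g : List U → N) (l : List U) :
    insertOne j (fun l' => φ (g l')) l = φ (insertOne j g l) :=
  insertOne_map (fun h : U → N => φ (h 0)) (map_zero φ) j (fun l' _ => g l') l

theorem contract_nil (j : ℕ) (g : List U → N) : contract j g [] = 0 := by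
  cases j <;> rfl

theorem contract_congr {j : ℕ} {g g' : List U → N} {l : List U}
    (h : ∀ l', l'.length + 1 = l.length → g l' = g' l') : contract j g l = contract j g' l := by
  induction j generalizing g g' l with
  | zero =>
    rcases l with _ | ⟨x, _ | ⟨y, l⟩⟩
    · rfl
    · rfl
    · exact h _ rfl
  | succ j ih =>
    rcases l with _ | ⟨x, l⟩
    · rfl
    · exact ih fun l' hl' => h _ (by simp [hl'])

theorem insertOne_congr {j : ℕ} {g g' : List U → N} {l : List U}
    (h : ∀ l', l'.length = l.length + 1 → g l' = g' l') : insertOne j g l = insertOne j g' l := by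
  induction j generalizing g g' l with
  | zero => exact h _ rfl
  | succ j ih =>
    rcases l with _ | ⟨x, l⟩
    · rfl
    · exact ih fun l' hl' => h _ (by simp [hl'])

theorem contract_contract (g : List U → N) {a b : ℕ} (hab : a ≤ b) (l : List U) :
    contract a (contract b g) l = contract (b + 1) (contract a g) l := by
  induction a generalizing b g l with
  | zero =>
    rcases l with _ | ⟨x, _ | ⟨y, l⟩⟩
    · rfl
    · exact (contract_nil _ _).symm
    · rcases b with _ | b
      · rcases l with _ | ⟨z, l⟩
        · rfl
        · simp only [contract, mul_assoc]
      · rfl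
  | succ a ih =>
    obtain ⟨b, rfl⟩ := Nat.exists_eq_add_of_le' (show 1 ≤ b by omega)
    rcases l with _ | ⟨x, l⟩
    · rfl
    · exact ih _ (by omega) l

theorem insertOne_insertOne (g : List U → N) {a b : ℕ} (hab : a ≤ b) (l : List U) :
    insertOne a (insertOne (b + 1) g) l = insertOne b (insertOne a g) l := by
  induction a generalizing b g l with
  | zero => rfl
  | succ a ih =>
    obtain ⟨b, rfl⟩ := Nat.exists_eq_add_of_le' (show 1 ≤ b by omega)
    rcases l with _ | ⟨x, l⟩
    · rfl
    · exact ih _ (by omega) l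

theorem insertOne_contract_of_le (g : List U → N) {a b : ℕ} (hab : a ≤ b) (l : List U) :
    insertOne a (contract (b + 1) g) l = contract b (insertOne a g) l := by
  induction a generalizing b g l with
  | zero => rfl
  | succ a ih =>
    obtain ⟨b, rfl⟩ := Nat.exists_eq_add_of_le' (show 1 ≤ b by omega)
    rcases l with _ | ⟨x, l⟩
    · rfl
    · exact ih _ (by omega) l

theorem insertOne_contract_of_lt (g : List U → N) {a b : ℕ} (hab : b < a) (l : List U) :
    insertOne (a + 1) (contract b g) l = contract b (insertOne a g) l := by
  obtain ⟨a, rfl⟩ := Nat.exists_eq_add_of_le' (show 1 ≤ a by omega)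
  induction b generalizing a g l with
  | zero => rcases l with _ | ⟨x, _ | ⟨y, l⟩⟩ <;> rfl
  | succ b ih =>
    obtain ⟨a, rfl⟩ := Nat.exists_eq_add_of_le' (show 1 ≤ a by omega)
    rcases l with _ | ⟨x, l⟩
    · rfl
    · exact ih _ _ _ (by omega)

theorem insertOne_contract_self (g : List U → N) {a : ℕ} {l : List U} (ha : a < l.length) :
    insertOne a (contract a g) l = g l := by
  induction a generalizing g l with
  | zero =>
    rcases l with _ | ⟨x, l⟩
    · simp at ha
    · simp [insertOne, contract]
  | succ a ih =>
    rcases l with _ | ⟨x, l⟩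
    · simp at ha
    · exact ih (fun l' => g (x :: l')) (by simpa using ha)

theorem insertOne_succ_contract_self (g : List U → N) {a : ℕ} {l : List U} (ha : a < l.length) :
    insertOne (a + 1) (contract a g) l = g l := by
  induction a generalizing g l with
  | zero =>
    rcases l with _ | ⟨x, l⟩
    · simp at ha
    · simp [insertOne, contract]
  | succ a ih =>
    rcases l with _ | ⟨x, l⟩
    · simp at ha
    · exact ih (fun l' => g (x :: l')) (by simpa using ha)

end Operations

section ContractEnd

variable {k A U : Type*} [CommRing k] [Ring A] [Algebra k A] [Ring U] [Algebra k U]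
variable {B : LeftBialgebroid k A U} {N N' : Type*} [AddCommGroup N] [AddCommGroup N']

theorem contractEnd_add (g g' : List U → N) (l : List U) :
    B.contractEnd (fun l' => g l' + g' l') l = B.contractEnd g l + B.contractEnd g' l := by
  simpa [Fin.sum_univ_two] using B.contractEnd_sum Finset.univ ![g, g'] l

theorem contractEnd_comp (φ : N →+ N') (g : List U → N) (l : List U) :
    B.contractEnd (fun l' => φ (g l')) l = φ (B.contractEnd g l) :=
  B.contractEnd_map (fun h : U → N => φ (h 0)) (map_zero φ) (fun l' _ => g l') l

theorem contractEnd_cons (g : List U → N) (x : U) {l : List U} (hl : 2 ≤ l.length) :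
    B.contractEnd g (x :: l) = B.contractEnd (fun l' => g (x :: l')) l := by
  rcases l with _ | ⟨y, _ | ⟨z, l⟩⟩
  · simp at hl
  · simp at hl
  · rfl

theorem contractEnd_congr {g g' : List U → N} {l : List U}
    (h : ∀ l', l'.length + 1 = l.length → g l' = g' l') :
    B.contractEnd g l = B.contractEnd g' l := by
  induction l generalizing g g' with
  | nil => rfl
  | cons x l ih =>
    rcases l with _ | ⟨y, _ | ⟨z, l⟩⟩
    · rfl
    · exact h _ rfl
    · exact ih fun l' hl' => h _ (by simp [hl'])

theorem contractEnd_append (g : List U → N) (l : List U) (x y : U) :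
    B.contractEnd g (l ++ [x, y]) = g (l ++ [x * B.t (B.counit y)]) := by
  induction l generalizing g with
  | nil => rfl
  | cons z l ih => rw [List.cons_append, contractEnd_cons _ _ (by simp), ih]; rfl

theorem contract_contractEnd (g : List U → N) {a : ℕ} {l : List U} (ha : a + 3 ≤ l.length) :
    contract a (B.contractEnd g) l = B.contractEnd (contract a g) l := by
  induction a generalizing g l with
  | zero =>
    rcases l with _ | ⟨x, _ | ⟨y, _ | ⟨z, _ | ⟨w, l⟩⟩⟩⟩
    · rfl
    · rfl
    · rfl
    · simp [contract, contractEnd, mul_assoc]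
    · rfl
  | succ a ih =>
    rcases l with _ | ⟨x, l⟩
    · rfl
    · simp only [List.length_cons] at ha
      rw [contractEnd_cons _ _ (by omega)]
      simp only [contract]
      rw [← ih _ (by omega)]
      exact contract_congr fun l' hl' => contractEnd_cons _ _ (by omega)

/-- The overlapping case, where the product and the counit meet in the last two slots: it is `ε(yz)
= ε(yt(ε(z)))`. -/
theorem contract_last_contractEnd (g : List U → N) {n : ℕ} {l : List U} (hl : l.length = n + 3) :
    contract (n + 1) (B.contractEnd g) l = B.contractEnd (B.contractEnd g) l := by
  induction n generalizing g l with
  | zero =>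
    obtain ⟨x, y, z, rfl⟩ := List.length_eq_three.1 hl
    simp only [contract, contractEnd]
    rw [B.counit_mul' y z]
  | succ n ih =>
    rcases l with _ | ⟨x, l⟩
    · simp at hl
    · simp only [List.length_cons] at hl
      rw [contractEnd_cons _ _ (by omega), contract]
      have h (l' : List U) (hl' : l'.length + 1 = l.length) :
        B.contractEnd g (x :: l') = B.contractEnd (fun l'' => g (x :: l'')) l' :=
          contractEnd_cons _ _ (by omega)
      rw [contract_congr h, contractEnd_congr h, ih _ (by omega)]

/-- Balancedness enters when `1` is inserted just before the last argument: `t(ε(y))` then has to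
cross it. -/
theorem insertOne_contractEnd [Module k N] {g : List U → N} (hg : B.ListBalanced g) {a : ℕ}
    {l : List U} (ha : a + 1 < l.length) :
    insertOne (a + 1) (B.contractEnd g) l = B.contractEnd (insertOne (a + 1) g) l := by
  induction a generalizing g l with
  | zero =>
    rcases l with _ | ⟨x, _ | ⟨y, _ | ⟨z, l⟩⟩⟩
    · rfl
    · simp at ha
    · simp only [insertOne, contractEnd, hg.bal_head, mul_one, one_mul]
    · rfl
  | succ a ih =>
    rcases l with _ | ⟨x, l⟩
    · rfl
    · simp only [List.length_cons] at ha
      rw [contractEnd_cons _ _ (by omega), insertOne]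
      exact (insertOne_congr fun l' hl' => contractEnd_cons _ _ (by omega)).trans
        (ih (hg.cons x) (by omega))

theorem insertOne_length_contractEnd (g : List U → N) {l : List U} (hl : l ≠ []) :
    insertOne l.length (B.contractEnd g) l = g l := by
  rw [insertOne_length]
  obtain ⟨l, x, rfl⟩ := (List.eq_nil_or_concat' l).resolve_left hl
  rw [List.append_assoc, List.singleton_append, contractEnd_append, B.counit_one, B.t_one, mul_one]

end ContractEnd

section Balanced

variable {k A U : Type*} [CommRing k] [Ring A] [Algebra k A] [Ring U] [Algebra k U]
variable {B : LeftBialgebroid k A U} {N : Type*} [AddCommGroup N] [Module k N]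
variable {g : List U → N}

theorem listBalanced_contract (hg : B.ListBalanced g) (j : ℕ) :
    B.ListBalanced (contract j g) where
  add l x y l' := by
    induction j generalizing g l with
    | zero =>
      rcases l with _ | ⟨u, _ | ⟨v, l⟩⟩
      · rcases l' with _ | ⟨z, l'⟩
        · exact (add_zero 0).symm
        · simp only [List.nil_append, contract, add_mul, hg.add_head]
      · simp only [List.nil_append, List.cons_append, contract, mul_add, hg.add_head]
      · exact hg.add ((u * v) :: l) x y l'
    | succ j ih =>
      rcases l with _ | ⟨u, l⟩
      · simp only [List.nil_append, contract, hg.add_head, contract_add]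
      · exact ih (hg.cons u) l
  smul l c x l' := by
    induction j generalizing g l with
    | zero =>
      rcases l with _ | ⟨u, _ | ⟨v, l⟩⟩
      · rcases l' with _ | ⟨z, l'⟩
        · exact (smul_zero c).symm
        · simp only [List.nil_append, contract, smul_mul_assoc, hg.smul_head]
      · simp only [List.nil_append, List.cons_append, contract, mul_smul_comm, hg.smul_head]
      · exact hg.smul ((u * v) :: l) c x l'
    | succ j ih =>
      rcases l with _ | ⟨u, l⟩
      · simp only [List.nil_append, contract, hg.smul_head]
        exact contract_comp (DistribSMul.toAddMonoidHom N c) _ _ _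
      · exact ih (hg.cons u) l
  bal l x y a l' := by
    induction j generalizing g l with
    | zero =>
      rcases l with _ | ⟨u, _ | ⟨v, l⟩⟩
      · simp only [List.nil_append, contract, mul_assoc]
      · simp only [List.nil_append, List.cons_append, contract, ← mul_assoc, hg.bal_head]
      · exact hg.bal ((u * v) :: l) x y a l'
    | succ j ih =>
      rcases l with _ | ⟨u, l⟩
      · rcases j with _ | j
        · rcases l' with _ | ⟨z, l'⟩
          · rfl
          · simp only [List.nil_append, contract, mul_assoc, hg.bal_head]
        · simp only [List.nil_append, contract, hg.bal_head]
      · exact ih (hg.cons u) l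

theorem listBalanced_insertOne (hg : B.ListBalanced g) (j : ℕ) :
    B.ListBalanced (insertOne j g) where
  add l x y l' := by
    induction j generalizing g l with
    | zero => exact (hg.cons 1).add l x y l'
    | succ j ih =>
      rcases l with _ | ⟨u, l⟩
      · simp only [List.nil_append, insertOne, hg.add_head, insertOne_add]
      · exact ih (hg.cons u) l
  smul l c x l' := by
    induction j generalizing g l with
    | zero => exact (hg.cons 1).smul l c x l'
    | succ j ih =>
      rcases l with _ | ⟨u, l⟩
      · simp only [List.nil_append, insertOne, hg.smul_head]
        exact insertOne_comp (DistribSMul.toAddMonoidHom N c) _ _ _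
      · exact ih (hg.cons u) l
  bal l x y a l' := by
    induction j generalizing g l with
    | zero => exact (hg.cons 1).bal l x y a l'
    | succ j ih =>
      rcases l with _ | ⟨u, l⟩
      · rcases j with _ | j
        · simp only [List.nil_append, insertOne, hg.bal_head]
          -- The `1` stands between the two balanced entries, so `t(a)` crosses it in two balancing
          -- moves.
          rw [mul_one, ← (hg.cons x).bal_head, one_mul]
        · simp only [List.nil_append, insertOne, hg.bal_head]
      · exact ih (hg.cons u) l

theorem listBalanced_contractEnd (hg : B.ListBalanced g) : B.ListBalanced (B.contractEnd g) where
  add l x y l' := by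
    induction l generalizing g with
    | nil =>
      rcases l' with _ | ⟨z, _ | ⟨w, l'⟩⟩
      · exact (add_zero 0).symm
      · simp only [List.nil_append, contractEnd, add_mul, hg.add_head]
      · simp only [List.nil_append, contractEnd, hg.add_head, contractEnd_add]
    | cons u l ih =>
      by_cases h : 2 ≤ (l ++ x :: l').length
      · have h' (z : U) : 2 ≤ (l ++ z :: l').length := by simpa using h
        simp only [List.cons_append, contractEnd_cons _ _ (h' _), ih (hg.cons u)]
      · simp only [List.length_append, List.length_cons] at h
        obtain rfl := List.length_eq_zero_iff.1 (show l.length = 0 by omega)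
        obtain rfl := List.length_eq_zero_iff.1 (show l'.length = 0 by omega)
        simp only [List.nil_append, List.cons_append, contractEnd, map_add, B.t_add, mul_add,
          hg.add_head]
  smul l c x l' := by
    induction l generalizing g with
    | nil =>
      rcases l' with _ | ⟨z, _ | ⟨w, l'⟩⟩
      · exact (smul_zero c).symm
      · simp only [List.nil_append, contractEnd, smul_mul_assoc, hg.smul_head]
      · simp only [List.nil_append, contractEnd, hg.smul_head]
        exact contractEnd_comp (DistribSMul.toAddMonoidHom N c) _ _
    | cons u l ih =>
      by_cases h : 2 ≤ (l ++ x :: l').length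
      · have h' (z : U) : 2 ≤ (l ++ z :: l').length := by simpa using h
        simp only [List.cons_append, contractEnd_cons _ _ (h' _), ih (hg.cons u)]
      · simp only [List.length_append, List.length_cons] at h
        obtain rfl := List.length_eq_zero_iff.1 (show l.length = 0 by omega)
        obtain rfl := List.length_eq_zero_iff.1 (show l'.length = 0 by omega)
        simp only [List.nil_append, List.cons_append, contractEnd, map_smul, B.t_smul,
          mul_smul_comm, hg.smul_head]
  bal l x y a l' := by
    induction l generalizing g with
    | nil =>
      rcases l' with _ | ⟨z, _ | ⟨w, l'⟩⟩
      · simp only [List.nil_append, contractEnd, B.counit_tgt_mul, B.t_mul, mul_assoc]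
      · simp only [List.nil_append, contractEnd, mul_assoc, hg.bal_head]
      · simp only [List.nil_append, contractEnd, hg.bal_head]
    | cons u l ih =>
      have h (z w : U) : 2 ≤ (l ++ z :: w :: l').length := by simp; omega
      simp only [List.cons_append, contractEnd_cons _ _ (h _ _), ih (hg.cons u)]

end Balanced

section HeadLinear

variable {k A U : Type*} [CommRing k] [Ring A] [Algebra k A] [Ring U] [Algebra k U]
variable {B : LeftBialgebroid k A U} {M : Type*} [AddCommGroup M] [Module U M]
variable {g : List U → M}

/-- Left linearity in the head survives, so the result is again of the form `u⁰ f(u¹,…)`; this is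
how cofaces pass between `f` and `f̂`. -/
theorem contract_headMul (hlin : ∀ u l, g (headMul u l) = u • g l) (j : ℕ) (u : U) (l : List U) :
    contract j g (headMul u l) = u • contract j g l := by
  rcases l with _ | ⟨x, l⟩
  · simp [headMul, contract_nil]
  rcases j with _ | j
  · rcases l with _ | ⟨y, l⟩
    · exact (smul_zero u).symm
    · exact (congrArg (fun z => g (z :: l)) (mul_assoc u x y)).trans (hlin u (x * y :: l))
  · have h : (fun l' => g (u * x :: l')) =
        fun l' => DistribSMul.toAddMonoidHom M u (g (x :: l')) := funext fun l' => hlin u (x :: l')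
    simp only [headMul, contract, h, contract_comp]; rfl

theorem contractEnd_headMul (hlin : ∀ u l, g (headMul u l) = u • g l) (u : U) (l : List U) :
    B.contractEnd g (headMul u l) = u • B.contractEnd g l := by
  rcases l with _ | ⟨x, _ | ⟨y, _ | ⟨z, l⟩⟩⟩
  · exact (smul_zero u).symm
  · exact (smul_zero u).symm
  · exact (congrArg (fun z => g [z]) (mul_assoc u x _)).trans (hlin u [x * _])
  · have h : (fun l' => g (u * x :: l')) =
        fun l' => DistribSMul.toAddMonoidHom M u (g (x :: l')) := funext fun l' => hlin u (x :: l')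
    simp only [headMul, contractEnd, h, contractEnd_comp]; rfl

end HeadLinear

open LeftBialgebroid AeRing LeftHopfAlgebroid

/-! ### From lists to multilinear cochains -/

section Tuples

variable {α : Type*}

theorem ofFn_update {n : ℕ} (u : Fin n → α) (i : Fin n) (x : α) :
    List.ofFn (Function.update u i x) = (List.ofFn u).set i x := by
  refine List.ext_getElem (by simp) fun j h₁ h₂ => ?_
  simp only [List.getElem_ofFn, List.getElem_set, Function.update_apply, Fin.ext_iff, eq_comm]

theorem exists_ofFn_eq {n : ℕ} {l : List α} (h : l.length = n) :
    ∃ u : Fin n → α, List.ofFn u = l := by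
  subst h; exact ⟨l.get, List.ofFn_get l⟩

theorem exists_ofFn_update_eq {n : ℕ} (u : Fin n → α) (i : Fin n) :
    ∃ l l' : List α, l.length = i ∧ List.ofFn u = l ++ u i :: l' ∧
      ∀ x, List.ofFn (Function.update u i x) = l ++ x :: l' := by
  have h (x : α) : List.ofFn (Function.update u i x) =
      (List.ofFn u).take i ++ x :: (List.ofFn u).drop (i + 1) := by
    rw [ofFn_update, List.set_eq_take_append_cons_drop, if_pos (by simp)]
  refine ⟨(List.ofFn u).take i, (List.ofFn u).drop (i + 1), by simp, ?_, h⟩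
  rw [← h, Function.update_eq_self]

theorem ofFn_update_append {n : ℕ} {u : Fin n → α} {l l' : List α} {y : α}
    (hu : List.ofFn u = l ++ y :: l') {i : Fin n} (hi : (i : ℕ) = l.length) (x : α) :
    List.ofFn (Function.update u i x) = l ++ x :: l' := by
  rw [ofFn_update, hu, hi]; simp

theorem apply_eq_of_ofFn_eq_append {n : ℕ} {u : Fin n → α} {l l' : List α} {y : α}
    (hu : List.ofFn u = l ++ y :: l') {i : Fin n} (hi : (i : ℕ) = l.length) : u i = y := by
  have h : (List.ofFn u)[(i : ℕ)]? = some (u i) := by simp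
  rw [hu, hi] at h
  simpa using h.symm

theorem ofFn_snoc {n : ℕ} (u : Fin n → α) (x : α) :
    List.ofFn (Fin.snoc (α := fun _ => α) u x) = List.ofFn u ++ [x] := by
  rw [List.ofFn_succ']; simp

end Tuples

section Bridge

variable {k A U : Type*} [CommRing k] [Ring A] [Algebra k A] [Ring U] [Algebra k U]
variable {E : AeRing k A U}
variable {M : Type*} [AddCommGroup M] [Module k M] [Module Aᵐᵒᵖ M] [IsScalarTower k Aᵐᵒᵖ M]

/-- A function of `n` arguments as a function on lists that vanishes on lists of length
other than `n`. -/
def listExtend {n : ℕ} (f : (Fin n → U) → M) (l : List U) : M :=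
  if h : l.length = n then f (fun i => l[(i : ℕ)]) else 0

theorem listExtend_ofFn {n : ℕ} (f : (Fin n → U) → M) (u : Fin n → U) :
    listExtend f (List.ofFn u) = f u := by
  rw [listExtend, dif_pos (List.length_ofFn)]; simp

theorem listExtend_of_ne {n : ℕ} (f : (Fin n → U) → M) {l : List U} (h : l.length ≠ n) :
    listExtend f l = 0 := dif_neg h

theorem listExtend_cons {n : ℕ} (f : (Fin n → U) → M) {u : Fin n → U} {l : List U}
    (h : List.ofFn u = l) : listExtend f l = f u := by
  rw [← h, listExtend_ofFn]

theorem listCochain_listExtend {n : ℕ} (f : E.cochain M n) :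
    E.ListCochain (listExtend (f.1 : (Fin n → U) → M)) where
  add l x y l' := by
    by_cases h : (l ++ (0 : U) :: l').length = n
    · obtain ⟨u, hu⟩ := exists_ofFn_eq h
      have h' (z : U) := listExtend_cons f.1
        (ofFn_update_append hu (i := ⟨l.length, by simp at h; omega⟩) rfl z)
      rw [h', h', h', f.1.map_update_add]
    · have h' (z : U) := listExtend_of_ne f.1 (l := l ++ z :: l') (by simpa using h)
      rw [h', h', h', add_zero]
  smul l c x l' := by
    by_cases h : (l ++ (0 : U) :: l').length = n
    · obtain ⟨u, hu⟩ := exists_ofFn_eq h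
      have h' (z : U) := listExtend_cons f.1
        (ofFn_update_append hu (i := ⟨l.length, by simp at h; omega⟩) rfl z)
      rw [h', h', f.1.map_update_smul]
    · have h' (z : U) := listExtend_of_ne f.1 (l := l ++ z :: l') (by simpa using h)
      rw [h', h', smul_zero]
  bal l x y a l' := by
    by_cases h : (l ++ x :: y :: l').length = n
    · obtain ⟨u, hu⟩ := exists_ofFn_eq h
      simp only [List.length_append, List.length_cons] at h
      have hu' : List.ofFn u = (l ++ [x]) ++ y :: l' := by simp [hu]
      let i : Fin n := ⟨l.length, by omega⟩
      let j : Fin n := ⟨l.length + 1, by omega⟩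
      have hi : u i = x := apply_eq_of_ofFn_eq_append hu rfl
      have hj : u j = y := apply_eq_of_ofFn_eq_append hu' (by simp [j])
      have h₁ := listExtend_cons f.1 (ofFn_update_append hu (i := i) rfl (x * E.t a))
      have h₂ := listExtend_cons f.1 (ofFn_update_append hu' (i := j) (by simp [j]) (E.t a * y))
      have h₃ := f.2.2 a u i j rfl
      rw [hi, hj] at h₃
      simpa [h₁, h₃] using h₂.symm
    · rw [listExtend_of_ne _ (by simpa using h), listExtend_of_ne _ (by simpa using h)]
  lin a x l := by
    by_cases h : (x :: l).length = n
    · obtain ⟨u, hu⟩ := exists_ofFn_eq h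
      let i : Fin n := ⟨0, by simp at h; omega⟩
      have hi : u i = x := apply_eq_of_ofFn_eq_append (l := []) hu rfl
      have h₁ := listExtend_cons f.1 (ofFn_update_append (l := []) hu (i := i) rfl (E.t a * x))
      have h₂ := f.2.1 a u i rfl
      rw [hi] at h₂
      rw [listExtend_cons _ hu, ← h₂]
      exact h₁
    · rw [listExtend_of_ne _ h, listExtend_of_ne _ (by simpa using h), smul_zero]

/-- The restriction of a cochain on lists to lists of a given length. -/
def listRestrict {g : List U → M} (hg : E.ListCochain g) (n : ℕ) : E.cochain M n :=
  ⟨{ toFun := fun u => g (List.ofFn u)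
     map_update_add' := fun {inst} u i x y => by
       -- The axioms of a multilinear map allow any decidable equality on the indices; the standard
       -- one is needed here.
       rw [Subsingleton.elim inst (instDecidableEqFin n)]
       obtain ⟨l, l', -, -, h⟩ := exists_ofFn_update_eq u i
       rw [h, h, h, hg.add]
     map_update_smul' := fun {inst} u i c x => by
       rw [Subsingleton.elim inst (instDecidableEqFin n)]
       obtain ⟨l, l', -, -, h⟩ := exists_ofFn_update_eq u i
       rw [h, h, hg.smul] },
   fun a u i hi => by
     obtain ⟨l, l', hl, h₀, h⟩ := exists_ofFn_update_eq u i
     obtain rfl := List.length_eq_zero_iff.1 (hl.trans hi)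
     change g _ = op a • g _
     rw [h, h₀]
     exact hg.lin a _ _,
   fun a u i j hij => by
     obtain ⟨l, l', hl, h₀, h⟩ := exists_ofFn_update_eq u i
     have hlen := congrArg List.length h₀
     rcases l' with _ | ⟨z, l'⟩
     · simp at hlen; omega
     have h₀' : List.ofFn u = (l ++ [u i]) ++ z :: l' := by simp [h₀]
     have hj : (j : ℕ) = (l ++ [u i]).length := by simp [hl, hij]
     change g _ = g _
     rw [h, ofFn_update_append h₀' hj, apply_eq_of_ofFn_eq_append h₀' hj, hg.bal]
     simp⟩

theorem listRestrict_apply {g : List U → M} (hg : E.ListCochain g) {n : ℕ} (u : Fin n → U) :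
    (listRestrict hg n).1 u = g (List.ofFn u) := rfl

variable (E M) in
/-- A `k`-linear operation on cochains on lists. -/
structure AeRing.CochainOp where
  /-- the underlying function -/
  toFun : (List U → M) → List U → M
  listCochain : ∀ {g}, E.ListCochain g → E.ListCochain (toFun g)
  map_add : ∀ {g g'}, E.ListCochain g → E.ListCochain g' → ∀ l,
    toFun (fun l => g l + g' l) l = toFun g l + toFun g' l
  map_smul : ∀ {g} (c : k), E.ListCochain g → ∀ l, toFun (fun l => c • g l) l = c • toFun g l

theorem listExtend_add {n : ℕ} (f f' : E.cochain M n) :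
    listExtend ((f + f').1 : (Fin n → U) → M) = fun l => listExtend f.1 l + listExtend f'.1 l := by
  ext l
  by_cases h : l.length = n
  · obtain ⟨u, rfl⟩ := exists_ofFn_eq h
    simp only [listExtend_ofFn]; rfl
  · simp only [listExtend_of_ne _ h, add_zero]

theorem listExtend_smul {n : ℕ} (c : k) (f : E.cochain M n) :
    listExtend ((c • f).1 : (Fin n → U) → M) = fun l => c • listExtend f.1 l := by
  ext l
  by_cases h : l.length = n
  · obtain ⟨u, rfl⟩ := exists_ofFn_eq h
    simp only [listExtend_ofFn]; rfl
  · simp only [listExtend_of_ne _ h, smul_zero]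

/-- The operation on `C^•(U, M)` induced by an operation on cochains on lists. -/
def AeRing.CochainOp.toLinearMap (Φ : E.CochainOp M) (n m : ℕ) :
    E.cochain M n →ₗ[k] E.cochain M m where
  toFun f := listRestrict (Φ.listCochain (listCochain_listExtend f)) m
  map_add' f f' := Subtype.ext (MultilinearMap.ext fun u => by
    rw [listRestrict_apply, listExtend_add,
      Φ.map_add (listCochain_listExtend f) (listCochain_listExtend f')]; rfl)
  map_smul' c f := Subtype.ext (MultilinearMap.ext fun u => by
    rw [listRestrict_apply, listExtend_smul, Φ.map_smul c (listCochain_listExtend f)]; rfl)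

/-- Vanishing off length `m` is what makes composites of operators on cochains agree with composites
on lists. -/
theorem AeRing.CochainOp.listExtend_toLinearMap (Φ : E.CochainOp M) {n m : ℕ} (f : E.cochain M n)
    (h : ∀ l, l.length ≠ m → Φ.toFun (listExtend f.1) l = 0) :
    listExtend ((Φ.toLinearMap n m f).1 : (Fin m → U) → M) = Φ.toFun (listExtend f.1) := by
  ext l
  by_cases hl : l.length = m
  · obtain ⟨u, rfl⟩ := exists_ofFn_eq hl
    rw [listExtend_ofFn]; rfl
  · rw [listExtend_of_ne _ hl, h l hl]

end Bridge

open LeftBialgebroid AeRing LeftHopfAlgebroid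

/-! ### The explicit operators -/

section Construction

variable {k A U : Type*} [CommRing k] [Ring A] [Algebra k A] [Ring U] [Algebra k U]
variable {M : Type*} [AddCommGroup M] [Module k M] [Module Aᵐᵒᵖ M] [IsScalarTower k Aᵐᵒᵖ M]
  [Module U M] [IsScalarTower k U M]

theorem actHead_add (g g' : List U → M) :
    actHead (fun l => g l + g' l) = fun l => actHead g l + actHead g' l := by
  ext l
  rcases l with _ | ⟨u, l⟩
  · exact (add_zero 0).symm
  · exact smul_add _ _ _

theorem actHead_smul (c : k) (g : List U → M) :
    actHead (fun l => c • g l) = fun l => c • actHead g l := by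
  ext l
  rcases l with _ | ⟨u, l⟩
  · exact (smul_zero _).symm
  · exact smul_comm _ _ _

/-- The coface `δ_i` in terms of `f̂ (u⁰, …, uⁿ) = u⁰ f (u¹, …, uⁿ)`. -/
def LeftBialgebroid.faceHead (B : LeftBialgebroid k A U) {N : Type*} [AddCommGroup N] (n i : ℕ)
    (h : List U → N) : List U → N :=
  -- Positions count from `u⁰`, so `uⁿ⁻ⁱ⁺¹` has position `n + 1 - i`. The case `i = n + 1` is then
  -- included as the product `u⁰u¹`, which acts on `M`.
  if i = 0 then B.contractEnd h else contract (n + 1 - i) h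

variable {B : LeftBialgebroid k A U}

theorem faceHead_zero {N : Type*} [AddCommGroup N] (n : ℕ) (h : List U → N) :
    B.faceHead n 0 h = B.contractEnd h := if_pos rfl

theorem faceHead_of_ne {N : Type*} [AddCommGroup N] (n : ℕ) {i : ℕ} (hi : i ≠ 0)
    (h : List U → N) : B.faceHead n i h = contract (n + 1 - i) h := if_neg hi

theorem listBalanced_faceHead {h : List U → M} (hh : B.ListBalanced h) (n i : ℕ) :
    B.ListBalanced (B.faceHead n i h) := by
  rw [faceHead]; split_ifs
  · exact listBalanced_contractEnd hh
  · exact listBalanced_contract hh _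

theorem faceHead_headMul {h : List U → M} (hlin : ∀ u l, h (headMul u l) = u • h l) (n i : ℕ)
    (u : U) (l : List U) : B.faceHead n i h (headMul u l) = u • B.faceHead n i h l := by
  rw [faceHead]; split_ifs
  · exact contractEnd_headMul hlin u l
  · exact contract_headMul hlin _ u l

theorem faceHead_add (n i : ℕ) (g g' : List U → M) (l : List U) :
    B.faceHead n i (fun l => g l + g' l) l = B.faceHead n i g l + B.faceHead n i g' l := by
  simp only [faceHead]; split_ifs
  · exact contractEnd_add _ _ _
  · exact contract_add _ _ _ _

theorem faceHead_comp (φ : M →+ M) (n i : ℕ) (g : List U → M) (l : List U) :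
    B.faceHead n i (fun l => φ (g l)) l = φ (B.faceHead n i g l) := by
  simp only [faceHead]; split_ifs
  · exact contractEnd_comp _ _ _
  · exact contract_comp _ _ _ _

theorem faceHead_nil (n i : ℕ) (h : List U → M) : B.faceHead n i h [] = 0 := by
  rw [faceHead]; split_ifs
  · rfl
  · exact contract_nil _ _

theorem faceHead_congr {n i : ℕ} {h h' : List U → M} {l : List U}
    (hh : ∀ l', l'.length + 1 = l.length → h l' = h' l') :
    B.faceHead n i h l = B.faceHead n i h' l := by
  simp only [faceHead]; split_ifs
  · exact contractEnd_congr hh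
  · exact contract_congr hh

/-- The coface `δ_i` as an operation on cochains on lists. -/
def cofaceOp (hM : ∀ (a : A) (m : M), B.t a • m = op a • m) (n i : ℕ) : B.CochainOp M where
  toFun g l := B.faceHead n i (actHead g) (1 :: l)
  listCochain {g} hg :=
    { toListBalanced := (listBalanced_faceHead (listCochain_actHead hM hg).toListBalanced n i).cons 1
      lin := fun a x l => by
        rw [← (listBalanced_faceHead (listCochain_actHead hM hg).toListBalanced n i).bal_head,
          one_mul, ← hM, ← faceHead_headMul (actHead_headMul g), headMul, mul_one] }
  map_add {g g'} _ _ l := by rw [actHead_add, faceHead_add]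
  map_smul {g} c _ l := by
    rw [actHead_smul]
    exact faceHead_comp (DistribSMul.toAddMonoidHom M c) n i _ _

variable (B M) in
/-- The insertion of `1` as an operation on cochains on lists. -/
def codegeneracyOp (j : ℕ) : B.CochainOp M where
  toFun := insertOne j
  listCochain {g} hg :=
    { toListBalanced := listBalanced_insertOne hg.toListBalanced j
      lin := fun a x l => by
        rcases j with _ | j
        · simp only [insertOne]
          rw [← hg.bal_head, one_mul, ← mul_one (B.t a), hg.lin]
        · simp only [insertOne, hg.lin]
          exact insertOne_comp (DistribSMul.toAddMonoidHom M (op a)) _ _ _ }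
  map_add _ _ l := insertOne_add _ _ _ _
  map_smul c _ l := insertOne_comp (DistribSMul.toAddMonoidHom M c) _ _ _

variable {H : LeftHopfAlgebroid k A U}

/-- The cyclic operator as an operation on cochains on lists. -/
def cyclicCochainOp (hM : ∀ (a : A) (m : M), H.t a • m = op a • m)
    (C : Contramodule H.toLeftBialgebroid M) : H.CochainOp M where
  toFun := cyclicOp C
  listCochain hg := listCochain_cyclicOp hM hg
  map_add hg hg' l := by
    rw [cyclicOp, actHead_add,
      contraEval_add C (listCochain_actHead hM hg) (listCochain_actHead hM hg')]; rfl
  map_smul c hg l := by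
    rw [cyclicOp, actHead_smul, contraEval_smul C (listCochain_actHead hM hg)]; rfl

/-- The operators on `C^•(U, M)`. -/
def cochainOperators (hM : ∀ (a : A) (m : M), H.t a • m = op a • m)
    (C : Contramodule H.toLeftBialgebroid M) : Operators k (fun n => H.cochain M n) where
  δ n i := (cofaceOp (B := H.toLeftBialgebroid) hM n i).toLinearMap n (n + 1)
  -- The `1` is inserted after `uⁿ⁻ʲ`, hence at position `n - j` of a list without `u⁰`.
  σ n j := (codegeneracyOp M H.toLeftBialgebroid (n - j)).toLinearMap (n + 1) n
  τ n := (cyclicCochainOp hM C).toLinearMap n n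

end Construction

/-! ### Agreement with the formulas -/

section Formulas

variable {k A U : Type*} [CommRing k] [Ring A] [Algebra k A] [Ring U] [Algebra k U]
variable {N : Type*} [AddCommGroup N]

theorem contract_ofFn {n : ℕ} (g : List U → N) (j : ℕ) (hj : j < n) (u : Fin (n + 1) → U) :
    contract j g (List.ofFn u) =
      g (List.ofFn (Fin.contractNth ⟨j, by omega⟩ (· * ·) u)) := by
  induction j generalizing n g with
  | zero =>
    obtain ⟨n, rfl⟩ := Nat.exists_eq_add_of_le' (show 1 ≤ n by omega)
    rw [List.ofFn_succ, List.ofFn_succ, contract, List.ofFn_succ]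
    rfl
  | succ j ih =>
    obtain ⟨n, rfl⟩ := Nat.exists_eq_add_of_le' (show 1 ≤ n by omega)
    rw [List.ofFn_succ, contract, ih _ (by omega), List.ofFn_succ]
    congr 3
    · ext i
      simp [Fin.contractNth]

theorem insertOne_ofFn {n : ℕ} (g : List U → N) (j : Fin (n + 1)) (u : Fin n → U) :
    insertOne j g (List.ofFn u) = g (List.ofFn (j.insertNth (α := fun _ => U) 1 u)) := by
  induction n generalizing g with
  | zero =>
    obtain rfl : j = 0 := Fin.fin_one_eq_zero j
    simp [insertOne]
  | succ n ih =>
    refine Fin.cases ?_ (fun j => ?_) j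
    · rw [Fin.insertNth_zero', List.ofFn_succ (f := Fin.cons _ _)]; rfl
    · have h : Fin.cons (α := fun _ => U) (u 0) (fun i => u i.succ) = u := Fin.cons_self_tail u
      have h' := Fin.insertNth_succ_cons j 1 (u 0) (fun i => u i.succ)
      rw [h] at h'
      rw [List.ofFn_succ, Fin.val_succ, insertOne, ih, h', List.ofFn_succ (f := Fin.cons _ _)]
      rfl

variable [Module k N] {H : LeftHopfAlgebroid k A U}

/-- The recursive definition expands to the closed formula for arbitrary presentations; the last
slot collects the `qⁱ` in reverse order because each new one is multiplied on the left. -/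
theorem transEval_ofFn {g : List U → N} (hg : H.ListBalanced g) {n L : ℕ} (u : Fin n → U)
    (p q : Fin n → Fin L → U) (h : ∀ i, H.translation (u i) = ∑ l, H.tmulOp (p i l) (q i l))
    (w : U) :
    H.transEval g (List.ofFn u) w = ∑ l : Fin n → Fin L,
      g (List.ofFn (fun i => p i (l i)) ++
        [(List.ofFn (fun i => q i (l i))).reverse.prod * w]) := by
  induction n generalizing g w with
  | zero => simp
  | succ n ih =>
    rw [List.ofFn_succ, transEval_cons, sumTrans_eq (balancedOp_transEval hg _ w) (h 0)]
    rw [← (Fin.consEquiv (fun _ => Fin L)).sum_comp, Fintype.sum_prod_type]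
    refine Finset.sum_congr rfl fun l₀ _ => ?_
    rw [ih (hg.cons _) (fun i => u i.succ) (fun i => p i.succ) (fun i => q i.succ)
      fun i => h i.succ]
    refine Finset.sum_congr rfl fun l _ => ?_
    simp [List.ofFn_succ, Fin.consEquiv, mul_assoc]

end Formulas

open LeftBialgebroid AeRing LeftHopfAlgebroid

/-! ### The relations and the conclusion -/

section

variable {k A U : Type*} [CommRing k] [Ring A] [Algebra k A] [Ring U] [Algebra k U]
variable {M : Type*} [AddCommGroup M] [Module k M] [Module Aᵐᵒᵖ M] [IsScalarTower k Aᵐᵒᵖ M]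
  [Module U M] [IsScalarTower k U M]
variable {H : LeftHopfAlgebroid k A U}

theorem actHead_one_cons (f : List U → M) : (fun l => actHead f (1 :: l)) = f :=
  funext fun l => one_smul U (f l)

theorem actHead_nil (f : List U → M) : actHead f [] = 0 := rfl

theorem actHead_cons (f : List U → M) (u : U) (l : List U) : actHead f (u :: l) = u • f l := rfl

theorem listExtend_nil {n : ℕ} (f : (Fin n → U) → M) (u : Fin n → U) (hn : n = 0) :
    listExtend f [] = f u := by
  subst hn
  rw [← listExtend_ofFn f u]; simp

theorem contractEnd_ofFn {N : Type*} [AddCommGroup N] (B : LeftBialgebroid k A U) {n : ℕ}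
    (g : List U → N) (u : Fin (n + 2) → U) :
    B.contractEnd g (List.ofFn u) = g (List.ofFn (Function.update (Fin.init u) (Fin.last n)
      (Fin.init u (Fin.last n) * B.t (B.counit (u (Fin.last (n + 1))))))) := by
  have h (v : Fin (n + 1) → U) (x : U) :
      Function.update v (Fin.last n) x = Fin.snoc (α := fun _ => U) (Fin.init v) x := by
    conv_lhs => rw [← Fin.snoc_init_self v]
    exact Fin.update_snoc_last _ _ _
  have h' : List.ofFn u = List.ofFn (Fin.init (Fin.init u)) ++
      [Fin.init u (Fin.last n), u (Fin.last (n + 1))] := by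
    conv_lhs => rw [← Fin.snoc_init_self u, ofFn_snoc, ← Fin.snoc_init_self (Fin.init u), ofFn_snoc]
    simp
  rw [h, ofFn_snoc, h', contractEnd_append]

theorem cyclicTerm_eq {n : ℕ} (f : MultilinearMap k (fun _ : Fin n => U) M) (p q : Fin n → U)
    (w : U) : cyclicTerm n f p q w =
      actHead (listExtend f) (List.ofFn p ++ [(List.ofFn q).reverse.prod * w]) := by
  rcases n with _ | n
  · simp [cyclicTerm, actHead, listExtend_nil f ![] rfl]
  · rw [List.ofFn_succ (f := p), List.cons_append, ← ofFn_snoc, actHead, listExtend_ofFn]; rfl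

theorem isGivenByFormulas_cochainOperators (hM : ∀ (a : A) (m : M), H.t a • m = op a • m)
    (C : Contramodule H.toLeftBialgebroid M) : IsGivenByFormulas H C (cochainOperators hM C) where
  δ_zero n f u := by
    change H.faceHead n 0 (actHead (listExtend f.1)) (1 :: List.ofFn u) = _
    rw [faceHead_zero]
    rcases n with _ | n
    · rw [List.ofFn_succ, List.ofFn_zero, contractEnd, one_mul, actHead, hM,
        listExtend_nil f.1 ![] rfl, cofaceZero]
    · rw [contractEnd_cons _ _ (by simp), actHead_one_cons, contractEnd_ofFn, listExtend_ofFn]; rfl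
  δ_mid n i h₁ h₂ f u := by
    change H.faceHead n i (actHead (listExtend f.1)) (1 :: List.ofFn u) = _
    rw [faceHead_of_ne _ (by omega), show n + 1 - (i : ℕ) = n - i + 1 by omega, contract,
      actHead_one_cons, contract_ofFn _ _ (by omega), listExtend_ofFn]
  δ_last n f u := by
    change H.faceHead n (n + 1) (actHead (listExtend f.1)) (1 :: List.ofFn u) = _
    rw [faceHead_of_ne _ (by omega), Nat.sub_self, List.ofFn_succ, contract, one_mul, actHead]
    exact congrArg (u 0 • ·) (listExtend_ofFn f.1 (Fin.tail u))
  σ_apply n j f u := by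
    change insertOne (n - j) (listExtend f.1) (List.ofFn u) = _
    rw [← listExtend_ofFn f.1, ← insertOne_ofFn (listExtend f.1) (Fin.rev j) u, Fin.val_rev]
    congr 1; omega
  τ_apply n f u L p q h := by
    have hf := listCochain_actHead hM (listCochain_listExtend f)
    obtain ⟨φ, hφ⟩ := (isHomOp_transEval hf (List.ofFn u)).exists_eq
    refine ⟨φ, fun w => ?_, ?_⟩
    · rw [hφ, transEval_ofFn hf.toListBalanced u p q h]
      simp only [cyclicTerm_eq]
    · rw [← C.contra_coe, hφ]; rfl

/-- For `τ`, presentations with a common number of terms exist, and the formula then fixes the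
argument of `γ` pointwise. -/
theorem eq_of_isGivenByFormulas {C : Contramodule H.toLeftBialgebroid M}
    {P P' : Operators k (fun n => H.cochain M n)} (hP : IsGivenByFormulas H C P)
    (hP' : IsGivenByFormulas H C P') : P = P' := by
  have hδ : P.δ = P'.δ := by
    funext n i
    refine LinearMap.ext fun f => Subtype.ext (MultilinearMap.ext fun u => ?_)
    by_cases h₀ : i = 0
    · subst h₀; rw [hP.δ_zero, hP'.δ_zero]
    by_cases h₁ : i = Fin.last (n + 1)
    · subst h₁; rw [hP.δ_last, hP'.δ_last]
    have h₂ : 1 ≤ (i : ℕ) := Nat.one_le_iff_ne_zero.2 fun h => h₀ (Fin.ext h)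
    have h₃ : (i : ℕ) ≤ n := by
      have := i.is_lt
      have : (i : ℕ) ≠ n + 1 := fun h => h₁ (Fin.ext h)
      omega
    rw [hP.δ_mid n i h₂ h₃, hP'.δ_mid n i h₂ h₃]
  have hσ : P.σ = P'.σ := by
    funext n j
    refine LinearMap.ext fun f => Subtype.ext (MultilinearMap.ext fun u => ?_)
    rw [hP.σ_apply, hP'.σ_apply]
  have hτ : P.τ = P'.τ := by
    funext n
    refine LinearMap.ext fun f => Subtype.ext (MultilinearMap.ext fun u => ?_)
    obtain ⟨L, p, q, hpq⟩ := LeftHopfAlgebroid.exists_common_translation (H := H) u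
    obtain ⟨φ, hφ, h⟩ := hP.τ_apply n f u L p q hpq
    obtain ⟨φ', hφ', h'⟩ := hP'.τ_apply n f u L p q hpq
    rw [h, h', show φ = φ' from Subtype.ext (LinearMap.ext fun w => by rw [hφ, hφ'])]
  cases P; cases P'
  simp only at hδ hσ hτ
  subst hδ hσ hτ
  rfl

theorem actHead_eq_zero {n : ℕ} {f : (Fin n → U) → M} {l : List U} (hl : l.length ≠ n + 1) :
    actHead (listExtend f) l = 0 := by
  rcases l with _ | ⟨u, l⟩
  · rfl
  · rw [actHead, listExtend_of_ne _ (by simpa using hl), smul_zero]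

variable {hM : ∀ (a : A) (m : M), H.t a • m = op a • m} {C : Contramodule H.toLeftBialgebroid M}

section

variable {N : Type*} [AddCommGroup N]

theorem contract_zero_fun (j : ℕ) (l : List U) : contract j (fun _ => (0 : N)) l = 0 :=
  contract_comp (0 : N →+ N) j (fun _ => 0) l

theorem insertOne_zero_fun (j : ℕ) (l : List U) : insertOne j (fun _ => (0 : N)) l = 0 :=
  insertOne_comp (0 : N →+ N) j (fun _ => 0) l

end

theorem faceHead_zero_fun (n i : ℕ) (l : List U) :
    H.faceHead n i (fun _ => (0 : M)) l = 0 :=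
  faceHead_comp (0 : M →+ M) n i (fun _ => 0) l

theorem listExtend_coface {n : ℕ} (i : Fin (n + 2)) (f : H.cochain M n) :
    listExtend (((cochainOperators hM C).δ n i f).1 : (Fin (n + 1) → U) → M) =
      fun l => H.faceHead n i (actHead (listExtend f.1)) (1 :: l) := by
  refine (cofaceOp (B := H.toLeftBialgebroid) hM n i).listExtend_toLinearMap f fun l hl => ?_
  refine (faceHead_congr (h' := fun _ => 0) fun l' hl' => actHead_eq_zero ?_).trans
    (faceHead_zero_fun _ _ _)
  simp only [List.length_cons] at hl'
  omega

/-- Together with `actHead_codegeneracy` this translates every composite of operators into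
operations on the single function `f̂`. -/
theorem actHead_coface {n : ℕ} (i : Fin (n + 2)) (f : H.cochain M n) :
    actHead (listExtend (((cochainOperators hM C).δ n i f).1 : (Fin (n + 1) → U) → M)) =
      H.faceHead n i (actHead (listExtend f.1)) := by
  ext l
  rcases l with _ | ⟨u, l⟩
  · rw [faceHead_nil, actHead_nil]
  · rw [listExtend_coface, actHead_cons, ← faceHead_headMul (actHead_headMul _), headMul, mul_one]

theorem listExtend_codegeneracy {n : ℕ} (j : Fin (n + 1)) (f : H.cochain M (n + 1)) :
    listExtend (((cochainOperators hM C).σ n j f).1 : (Fin n → U) → M) =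
      insertOne (n - j) (listExtend f.1) := by
  refine (codegeneracyOp M H.toLeftBialgebroid (n - j)).listExtend_toLinearMap f fun l hl => ?_
  refine (insertOne_congr (g' := fun _ => 0) fun l' hl' => listExtend_of_ne _ ?_).trans
    (insertOne_zero_fun _ _)
  omega

theorem actHead_insertOne (j : ℕ) (f : List U → M) :
    actHead (insertOne j f) = insertOne (j + 1) (actHead f) := by
  ext l
  rcases l with _ | ⟨u, l⟩
  · rfl
  · exact (insertOne_comp (DistribSMul.toAddMonoidHom M u) _ _ _).symm

theorem insertOne_eq_actHead (j : ℕ) (f : List U → M) (l : List U) :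
    insertOne j f l = insertOne (j + 1) (actHead f) (1 :: l) := by
  rw [← actHead_insertOne, actHead_cons, one_smul]

theorem actHead_codegeneracy {n : ℕ} (j : Fin (n + 1)) (f : H.cochain M (n + 1)) :
    actHead (listExtend (((cochainOperators hM C).σ n j f).1 : (Fin n → U) → M)) =
      insertOne (n - j + 1) (actHead (listExtend f.1)) := by
  rw [listExtend_codegeneracy, actHead_insertOne]

theorem listExtend_cyclic {n : ℕ} (f : H.cochain M n) :
    listExtend (((cochainOperators hM C).τ n f).1 : (Fin n → U) → M) =
      cyclicOp C (listExtend f.1) := by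
  refine (cyclicCochainOp hM C).listExtend_toLinearMap f fun l hl => ?_
  have h := contraEval_congr C (g := actHead (listExtend (f.1 : (Fin n → U) → M)))
    (g' := fun _ => 0) (l := l) fun l' hl' => actHead_eq_zero (by omega)
  refine h.trans ?_
  simp only [contraEval, funext (transEval_zero l), C.contra_zero]

theorem coface_apply {n : ℕ} (i : Fin (n + 2)) (f : H.cochain M n) (u : Fin (n + 1) → U) :
    ((cochainOperators hM C).δ n i f).1 u =
      H.faceHead n i (actHead (listExtend f.1)) (1 :: List.ofFn u) := rfl

theorem codegeneracy_apply {n : ℕ} (j : Fin (n + 1)) (f : H.cochain M (n + 1)) (u : Fin n → U) :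
    ((cochainOperators hM C).σ n j f).1 u =
      insertOne (n - j + 1) (actHead (listExtend f.1)) (1 :: List.ofFn u) :=
  insertOne_eq_actHead _ _ _

theorem cyclic_apply {n : ℕ} (f : H.cochain M n) (u : Fin n → U) :
    ((cochainOperators hM C).τ n f).1 u =
      contraEval C (actHead (listExtend f.1)) (List.ofFn u) := rfl

theorem isParaCocyclic_cochainOperators :
    (cochainOperators (M := M) hM C).IsParaCocyclic where
  δ_δ n i j hij := by
    refine LinearMap.ext fun f => Subtype.ext (MultilinearMap.ext fun u => ?_)
    have hij' : (i : ℕ) ≤ j := hij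
    have hj := j.is_lt
    simp only [LinearMap.comp_apply, coface_apply, actHead_coface, Fin.val_succ, Fin.val_castSucc]
    rw [faceHead_of_ne _ (Nat.succ_ne_zero _)]
    by_cases hi : (i : ℕ) = 0
    · rw [hi, faceHead_zero, faceHead_zero]
      -- For `j = 0` the coface `δ_1` multiplies the last two arguments, the very place where `δ_0`
      -- acts; otherwise the two operations do not meet in the absorbed argument.
      by_cases hj0 : (j : ℕ) = 0
      · rw [hj0, faceHead_zero]
        exact contract_last_contractEnd _ (by simp)
      · rw [faceHead_of_ne _ hj0, contract_contractEnd _ (by simp; omega)]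
        congr 2; omega
    · rw [faceHead_of_ne _ hi, faceHead_of_ne _ hi, faceHead_of_ne _ (by omega),
        contract_contract _ (by omega)]
      congr 1
      · omega
      · congr 1; omega
  σ_σ n i j hij := by
    refine LinearMap.ext fun f => Subtype.ext (MultilinearMap.ext fun u => ?_)
    have hij' : (i : ℕ) ≤ j := hij
    have hj := j.is_lt
    simp only [LinearMap.comp_apply, codegeneracy_apply, actHead_codegeneracy, Fin.val_succ,
      Fin.val_castSucc]
    rw [show n + 1 - (i : ℕ) + 1 = (n - i + 1) + 1 by omega,
      insertOne_insertOne _ (by omega : n - (j : ℕ) + 1 ≤ n - i + 1)]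
    congr 2; omega
  σ_δ_of_le n i j hij := by
    refine LinearMap.ext fun f => Subtype.ext (MultilinearMap.ext fun u => ?_)
    have hij' : (i : ℕ) ≤ j := hij
    have hj := j.is_lt
    simp only [LinearMap.comp_apply, codegeneracy_apply, coface_apply, actHead_codegeneracy,
      actHead_coface, Fin.val_succ, Fin.val_castSucc]
    rw [show n + 1 - ((j : ℕ) + 1) = n - j by omega]
    by_cases hi : (i : ℕ) = 0
    · rw [hi, faceHead_zero, faceHead_zero]
      exact insertOne_contractEnd
        (listCochain_actHead hM (listCochain_listExtend f)).toListBalanced (by simp)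
    · rw [faceHead_of_ne _ hi, faceHead_of_ne _ hi,
        show n + 1 + 1 - (i : ℕ) = (n + 1 - i) + 1 by omega]
      exact insertOne_contract_of_le _ (by omega) _
  σ_δ_self n j := by
    refine LinearMap.ext fun f => Subtype.ext (MultilinearMap.ext fun u => ?_)
    have hj := j.is_lt
    simp only [LinearMap.comp_apply, codegeneracy_apply, actHead_coface, Fin.val_castSucc,
      LinearMap.id_apply]
    have h₁ : actHead (listExtend f.1) (1 :: List.ofFn u) = f.1 u := by
      rw [actHead_cons, one_smul, listExtend_ofFn]
    rw [← h₁]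
    by_cases hj0 : (j : ℕ) = 0
    · rw [hj0, faceHead_zero]
      have := insertOne_length_contractEnd (B := H.toLeftBialgebroid)
        (actHead (listExtend f.1)) (List.cons_ne_nil 1 (List.ofFn u))
      simpa using this
    · rw [faceHead_of_ne _ hj0, show n + 1 - (j : ℕ) = n - j + 1 by omega]
      exact insertOne_contract_self _ (by rw [List.length_cons, List.length_ofFn]; omega)
  σ_δ_succ n j := by
    refine LinearMap.ext fun f => Subtype.ext (MultilinearMap.ext fun u => ?_)
    have hj := j.is_lt
    simp only [LinearMap.comp_apply, codegeneracy_apply, actHead_coface, Fin.val_succ,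
      LinearMap.id_apply]
    have h₁ : actHead (listExtend f.1) (1 :: List.ofFn u) = f.1 u := by
      rw [actHead_cons, one_smul, listExtend_ofFn]
    rw [← h₁, faceHead_of_ne _ (Nat.succ_ne_zero _),
      show n + 1 - ((j : ℕ) + 1) = n - j by omega]
    exact insertOne_succ_contract_self _ (by simp)
  σ_δ_of_gt n i j hij := by
    refine LinearMap.ext fun f => Subtype.ext (MultilinearMap.ext fun u => ?_)
    have hij' : (j : ℕ) < i := hij
    have hi := i.is_lt
    simp only [LinearMap.comp_apply, codegeneracy_apply, coface_apply, actHead_codegeneracy,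
      actHead_coface, Fin.val_succ, Fin.val_castSucc]
    rw [faceHead_of_ne _ (Nat.succ_ne_zero _), faceHead_of_ne _ (by omega),
      show n + 1 - (j : ℕ) + 1 = (n - j + 1) + 1 by omega,
      show n + 1 + 1 - ((i : ℕ) + 1) = n + 1 - i by omega]
    exact insertOne_contract_of_lt _ (by omega) _
  τ_δ_zero n := by
    refine LinearMap.ext fun f => Subtype.ext (MultilinearMap.ext fun u => ?_)
    simp only [LinearMap.comp_apply, cyclic_apply, coface_apply, actHead_coface, Fin.val_last]
    rw [faceHead_of_ne _ (Nat.succ_ne_zero _), Nat.sub_self, List.ofFn_succ]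
    simp only [Fin.val_zero, faceHead_zero, contract, one_mul]
    exact contraEval_contractEnd C (listCochain_actHead hM (listCochain_listExtend f)) _ _
  τ_δ_succ n i := by
    refine LinearMap.ext fun f => Subtype.ext (MultilinearMap.ext fun u => ?_)
    have hi := i.is_lt
    have hf := listCochain_actHead hM (listCochain_listExtend f)
    simp only [LinearMap.comp_apply, cyclic_apply, coface_apply, actHead_coface, Fin.val_succ,
      Fin.val_castSucc, listExtend_cyclic]
    rw [faceHead_of_ne _ (Nat.succ_ne_zero _)]
    by_cases hi0 : (i : ℕ) = 0
    · rw [hi0, faceHead_zero, show n + 1 - (0 + 1) = n by omega]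
      -- For `n = 0` no further translation factor can absorb `s(ε(u))`; it stays in the argument of
      -- `γ` and comes out as the right action of `ε(u)`.
      rcases n with _ | n
      · rw [List.ofFn_succ, List.ofFn_zero, contraEval_contract_zero C hf, contractEnd, one_mul,
          actHead_cons, hM]; rfl
      · rw [contractEnd_cons _ _ (by simp), actHead_one_cons, List.ofFn_succ, List.ofFn_succ]
        have h := contraEval_contract_last C hf (u 0) (u (Fin.succ 0))
          (List.ofFn fun i => u i.succ.succ)
        rw [List.length_ofFn] at h
        exact h
    · rw [faceHead_of_ne _ hi0, show n + 1 - (i : ℕ) = n - i + 1 by omega,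
        show n + 1 - ((i : ℕ) + 1) = n - i by omega, contract, actHead_one_cons]
      exact contraEval_contract C hf (by rw [List.length_ofFn]; omega)
  τ_σ_zero n := by
    refine LinearMap.ext fun f => Subtype.ext (MultilinearMap.ext fun u => ?_)
    have hf := listCochain_actHead hM (listCochain_listExtend f)
    have hf' := listCochain_actHead hM (listCochain_cyclicOp (C := C) hM (listCochain_listExtend f))
    simp only [LinearMap.comp_apply, cyclic_apply, codegeneracy_apply, actHead_codegeneracy,
      listExtend_cyclic, Fin.val_last, Fin.val_zero]
    rw [Nat.sub_self, insertOne, actHead_one_cons, cyclicOp,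
      ← contraEval_insertOne C hf' (Nat.zero_le _)]
    -- Setting the head of `actHead` to `1` undoes it, so `σ_nτ²f` is `contraEval` applied twice to
    -- `f̂`.
    have h : insertOne 0 (actHead (cyclicOp C (listExtend f.1))) =
        contraEval C (actHead (listExtend f.1)) := actHead_one_cons _
    rw [h, contraEval_contraEval C hf]
    refine contraEval_congr C fun l' hl' => ?_
    rw [← insertOne_length (actHead (listExtend f.1)) l']
    congr 1
    simpa using hl'.symm
  τ_σ_succ n j := by
    refine LinearMap.ext fun f => Subtype.ext (MultilinearMap.ext fun u => ?_)
    have hj := j.is_lt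
    have hf := listCochain_actHead hM (listCochain_listExtend f)
    simp only [LinearMap.comp_apply, cyclic_apply, codegeneracy_apply, actHead_codegeneracy,
      listExtend_cyclic, Fin.val_succ, Fin.val_castSucc]
    rw [insertOne, actHead_one_cons, show n + 1 - ((j : ℕ) + 1) + 1 = n + 1 - j by omega]
    exact contraEval_insertOne C hf (by simp)

theorem listExtend_cyclic_pow {n : ℕ} (m : ℕ) (f : H.cochain M n) :
    listExtend ((((cochainOperators hM C).τ n ^ m) f).1 : (Fin n → U) → M) =
      (cyclicOp C)^[m] (listExtend f.1) := by
  induction m with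
  | zero => rfl
  | succ m ih =>
    rw [Function.iterate_succ_apply', ← ih, ← listExtend_cyclic (hM := hM), pow_succ']; rfl

theorem isCocyclic_cochainOperators (hA : IsAYD H C) (hS : IsStable H C) :
    (cochainOperators (M := M) hM C).IsCocyclic where
  toIsParaCocyclic := isParaCocyclic_cochainOperators
  τ_pow n := by
    refine LinearMap.ext fun f => Subtype.ext (MultilinearMap.ext fun u => ?_)
    have h := cyclicOp_iterate_eq hA hS (listCochain_listExtend f) (List.ofFn u)
    rw [List.length_ofFn, ← listExtend_cyclic_pow (hM := hM), listExtend_ofFn,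
      listExtend_ofFn] at h
    exact h

end

end HopfAlgebroid

end
theorem corollary4p7 {k A U M : Type*} [CommRing k] [Ring A] [Algebra k A] [Ring U] [Algebra k U]
    [AddCommGroup M] [Module k M] [Module Aᵐᵒᵖ M] [IsScalarTower k Aᵐᵒᵖ M]
    [Module U M] [IsScalarTower k U M]
    (H : HopfAlgebroid.LeftHopfAlgebroid k A U)
    (C : HopfAlgebroid.Contramodule H.toLeftBialgebroid M)
    (hM : ∀ (a : A) (m : M), H.t a • m = op a • m) :
    (∃! P : HopfAlgebroid.Operators k (fun n => H.cochain M n),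
      HopfAlgebroid.IsGivenByFormulas H C P) ∧
    ∀ P : HopfAlgebroid.Operators k (fun n => H.cochain M n),
      HopfAlgebroid.IsGivenByFormulas H C P →
        P.IsParaCocyclic ∧
        (HopfAlgebroid.IsAYD H C → HopfAlgebroid.IsStable H C → P.IsCocyclic) := by
  have h := HopfAlgebroid.isGivenByFormulas_cochainOperators hM C
  refine ⟨⟨_, h, fun P hP => HopfAlgebroid.eq_of_isGivenByFormulas hP h⟩, fun P hP => ?_⟩
  -- Any operators given by the formulas are the constructed ones.
  rw [HopfAlgebroid.eq_of_isGivenByFormulas hP h]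
  exact ⟨HopfAlgebroid.isParaCocyclic_cochainOperators,
    HopfAlgebroid.isCocyclic_cochainOperators⟩
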